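/- Let $H(\mathbb{R})$ be the real Heisenberg group in exponential coordinates, i.e. $\mathbb{R}^3$ with the product $(a,b,c)(a',b',c')=\bigl(a+a',\,b+b',\,c+c'+\tfrac12(ab'-a'b)\bigr)$, and let $\|\cdot\|$ be a rational polygonal norm on the horizontal plane $\mathfrak m=\mathbb{R}^2$, i.e. a norm whose closed unit ball is the convex hull of finitely many points with rational coordinates. A curve $\gamma$ in $H(\mathbb{R})$ is admissible if it is continuous, differentiable except at finitely many times, and each of its velocity vectors $\gamma'(t)$ is the push-forward, under left multiplication by $\gamma(t)$, of a vector $u(t)\in\mathfrak m$ at the identity; its length is $\int\|u(t)\|\,dt$. The CC metric $d$ induced by $\|\cdot\|$ is defined by letting $d(x,y)$ be the infimum of the lengths of the admissible curves from $x$ to $y$. Then the metric space $(H(\mathbb{R}),d)$ is almost convex: for every $k\in\mathbb R$ there is a constant $M=M(k)$ such that for every $x_0\in H(\mathbb{R})$, every real $n$, and any two points $x,y$ of the metric sphere $\{p: d(p,x_0)=n\}$ with $d(x,y)\le k$, there is a continuous path from $x$ to $y$ contained in the closed ball $\{p : d(p,x_0)\le n\}$ whose length with respect to $d$ is at most $M$.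 -/

import Mathlib

open MeasureTheory Set Filter Topology
open scoped ENNReal

/-- The real Heisenberg group `H(ℝ)` in exponential coordinates `(x, y, z)`. -/
@[ext]
structure Heis where
  x : ℝ
  y : ℝ
  z : ℝ

namespace Heis

/-- The unipotent matrix with exponential coordinates `(x, y, z)`. -/
noncomputable def toMatrix (p : Heis) : Matrix (Fin 3) (Fin 3) ℝ :=
  !![1, p.x, p.z + p.x * p.y / 2; 0, 1, p.y; 0, 0, 1]

noncomputable instance : Mul Heis :=
  ⟨fun p q => ⟨p.x + q.x, p.y + q.y, p.z + q.z + (p.x * q.y - p.y * q.x) / 2⟩⟩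

instance : One Heis := ⟨⟨0, 0, 0⟩⟩

noncomputable instance : Inv Heis := ⟨fun p => ⟨-p.x, -p.y, -p.z⟩⟩

@[simp] theorem mul_x (p q : Heis) : (p * q).x = p.x + q.x := rfl
@[simp] theorem mul_y (p q : Heis) : (p * q).y = p.y + q.y := rfl
@[simp] theorem mul_z (p q : Heis) :
    (p * q).z = p.z + q.z + (p.x * q.y - p.y * q.x) / 2 := rfl
@[simp] theorem one_x : (1 : Heis).x = 0 := rfl
@[simp] theorem one_y : (1 : Heis).y = 0 := rfl
@[simp] theorem one_z : (1 : Heis).z = 0 := rfl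
@[simp] theorem inv_x (p : Heis) : (p⁻¹).x = -p.x := rfl
@[simp] theorem inv_y (p : Heis) : (p⁻¹).y = -p.y := rfl
@[simp] theorem inv_z (p : Heis) : (p⁻¹).z = -p.z := rfl

noncomputable instance : Group Heis :=
  Group.ofLeftAxioms
    (fun p q r => by ext <;> simp <;> ring)
    (fun p => by ext <;> simp)
    (fun p => by
      ext <;> simp
      ring)

/-- The group law in exponential coordinates is matrix multiplication. -/
theorem toMatrix_mul (p q : Heis) : (p * q).toMatrix = p.toMatrix * q.toMatrix := by
  ext i j
  fin_cases i <;> fin_cases j <;> simp [toMatrix, Matrix.mul_apply, Fin.sum_univ_three] <;> ring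

/-- The coordinate chart `H(ℝ) → ℝ³`. -/
def coords (p : Heis) : ℝ × ℝ × ℝ := (p.x, p.y, p.z)

/-- The push-forward to the point `p`, under left multiplication by `p`, of the horizontal
vector `u = (u₁, u₂)`, i.e. of `u₁ X + u₂ Y` at the identity. -/
noncomputable def push (p : Heis) (u : ℝ × ℝ) : ℝ × ℝ × ℝ :=
  (u.1, u.2, (p.x * u.2 - p.y * u.1) / 2)

theorem hasDerivAt_push (p : Heis) (u : ℝ × ℝ) :
    HasDerivAt (fun s : ℝ => (p * ⟨s * u.1, s * u.2, 0⟩ : Heis).coords) (p.push u) 0 := by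
  have hs : ∀ c : ℝ, HasDerivAt (fun s : ℝ => s * c) c 0 := fun c => by
    simpa using (hasDerivAt_id (0 : ℝ)).mul_const c
  have h1 : HasDerivAt (fun s : ℝ => p.x + s * u.1) u.1 0 := (hs u.1).const_add _
  have h2 : HasDerivAt (fun s : ℝ => p.y + s * u.2) u.2 0 := (hs u.2).const_add _
  have h3 : HasDerivAt (fun s : ℝ => p.z + 0 + (p.x * (s * u.2) - p.y * (s * u.1)) / 2)
      ((p.x * u.2 - p.y * u.1) / 2) 0 :=
    ((((hs u.2).const_mul p.x).sub ((hs u.1).const_mul p.y)).div_const 2).const_add _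
  exact h1.prodMk (h2.prodMk h3)

end Heis

/-- A rational polygonal norm on the horizontal plane `ℝ²`: a norm whose closed unit ball is the
convex hull of finitely many points with rational coordinates. -/
structure RationalPolygonalNorm where
  toSeminorm : Seminorm ℝ (ℝ × ℝ)
  eq_zero_of_map_eq_zero : ∀ v, toSeminorm v = 0 → v = 0
  exists_vertices : ∃ V : Set (ℝ × ℝ), V.Finite ∧
    (∀ v ∈ V, ∃ a b : ℚ, v = ((a : ℝ), (b : ℝ))) ∧
    {v : ℝ × ℝ | toSeminorm v ≤ 1} = convexHull ℝ V

/-- A piecewise differentiable admissible curve from `p` to `q`, defined on `[0, T]`: off a finite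
set of times it is differentiable, and its velocity is the push-forward of a horizontal
vector `vel t`. -/
structure AdmissibleCurve (p q : Heis) where
  T : ℝ
  T_nonneg : 0 ≤ T
  γ : ℝ → Heis
  source : γ 0 = p
  target : γ T = q
  continuousOn : ContinuousOn (fun t => (γ t).coords) (Icc 0 T)
  vel : ℝ → ℝ × ℝ
  exceptional : Set ℝ
  finite_exceptional : exceptional.Finite
  hasDerivAt : ∀ t ∈ Ioo 0 T \ exceptional,
    HasDerivAt (fun s => (γ s).coords) ((γ t).push (vel t)) t

/-- The length of an admissible curve: the integral of the norms of its velocity vectors. -/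
noncomputable def AdmissibleCurve.length {p q : Heis} (c : AdmissibleCurve p q)
    (N : RationalPolygonalNorm) : ℝ≥0∞ :=
  ∫⁻ t in Ioc 0 c.T, ENNReal.ofReal (N.toSeminorm (c.vel t))

/-- The Carnot–Carathéodory distance: the infimal length of an admissible curve. -/
noncomputable def ccEDist (N : RationalPolygonalNorm) (p q : Heis) : ℝ≥0∞ :=
  ⨅ c : AdmissibleCurve p q, c.length N

namespace AdmissibleCurve

/-- The curve `t ↦ p · exp (t u)`, `0 ≤ t ≤ 1`. -/
noncomputable def line (p : Heis) (u : ℝ × ℝ) : AdmissibleCurve p (p * ⟨u.1, u.2, 0⟩) where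
  T := 1
  T_nonneg := zero_le_one
  γ t := p * ⟨t * u.1, t * u.2, 0⟩
  source := by ext <;> simp
  target := by simp
  continuousOn := by
    apply Continuous.continuousOn
    simp only [Heis.coords, Heis.mul_x, Heis.mul_y, Heis.mul_z]
    fun_prop
  vel _ := u
  exceptional := ∅
  finite_exceptional := finite_empty
  hasDerivAt t _ := by
    have hs : ∀ c : ℝ, HasDerivAt (fun s : ℝ => s * c) c t := fun c => by
      simpa using (hasDerivAt_id t).mul_const c
    have h1 : HasDerivAt (fun s : ℝ => p.x + s * u.1) u.1 t := (hs u.1).const_add _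
    have h2 : HasDerivAt (fun s : ℝ => p.y + s * u.2) u.2 t := (hs u.2).const_add _
    have h3 : HasDerivAt (fun s : ℝ => p.z + 0 + (p.x * (s * u.2) - p.y * (s * u.1)) / 2)
        ((p.x * u.2 - p.y * u.1) / 2) t :=
      ((((hs u.2).const_mul p.x).sub ((hs u.1).const_mul p.y)).div_const 2).const_add _
    refine (h1.prodMk (h2.prodMk h3)).congr_deriv (Prod.ext rfl (Prod.ext rfl ?_))
    simp only [Heis.push, Heis.mul_x, Heis.mul_y]
    ring

/-- The curve run backwards. -/
noncomputable def symm {p q : Heis} (c : AdmissibleCurve p q) : AdmissibleCurve q p where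
  T := c.T
  T_nonneg := c.T_nonneg
  γ t := c.γ (c.T - t)
  source := by simpa using c.target
  target := by simpa using c.source
  continuousOn := by
    refine c.continuousOn.comp (f := fun t => c.T - t) (by fun_prop) ?_
    intro t ht
    exact ⟨by linarith [ht.2], by linarith [ht.1]⟩
  vel t := -c.vel (c.T - t)
  exceptional := (fun t => c.T - t) '' c.exceptional
  finite_exceptional := c.finite_exceptional.image _
  hasDerivAt t ht := by
    have h := c.hasDerivAt (c.T - t) ⟨⟨by linarith [ht.1.2], by linarith [ht.1.1]⟩,
      fun h => ht.2 ⟨_, h, by simp⟩⟩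
    have h2 : HasDerivAt (fun s : ℝ => c.T - s) (-1) t := by
      simpa using (hasDerivAt_id t).const_sub c.T
    refine (h.scomp t h2).congr_deriv (Prod.ext ?_ (Prod.ext ?_ ?_))
    · simp [Heis.push]
    · simp [Heis.push]
    · simp [Heis.push]
      ring

theorem length_symm {p q : Heis} (c : AdmissibleCurve p q) (N : RationalPolygonalNorm) :
    c.symm.length N = c.length N := by
  unfold length
  have h := (Measure.measurePreserving_sub_left (volume : Measure ℝ) c.T).setLIntegral_comp_preimage_emb
    (MeasurableEquiv.subLeft c.T).measurableEmbedding
    (fun t => ENNReal.ofReal (N.toSeminorm (c.vel t))) (Ioc 0 c.T)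
  rw [← h]
  simp only [symm, map_neg_eq_map]
  rw [preimage_const_sub_Ioc, sub_self, sub_zero]
  exact setLIntegral_congr (Ioc_ae_eq_Icc.trans Ico_ae_eq_Icc.symm)

/-- Concatenation of curves. -/
noncomputable def trans {p q r : Heis} (c : AdmissibleCurve p q) (d : AdmissibleCurve q r) :
    AdmissibleCurve p r where
  T := c.T + d.T
  T_nonneg := add_nonneg c.T_nonneg d.T_nonneg
  γ t := if t ≤ c.T then c.γ t else d.γ (t - c.T)
  source := by simp [c.T_nonneg, c.source]
  target := by
    rcases d.T_nonneg.eq_or_lt with h | h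
    · have h2 := d.target
      rw [← h, d.source] at h2
      simp [← h, c.target, h2]
    · simp [h, d.target]
  continuousOn := by
    have h1 : ContinuousOn (fun t => (d.γ (t - c.T)).coords) (Icc c.T (c.T + d.T)) := by
      refine d.continuousOn.comp (f := fun t => t - c.T) (by fun_prop) ?_
      intro t ht
      exact ⟨by linarith [ht.1], by linarith [ht.2]⟩
    rw [← Icc_union_Icc_eq_Icc c.T_nonneg (le_add_of_nonneg_right d.T_nonneg)]
    refine ContinuousOn.union_of_isClosed ?_ ?_ isClosed_Icc isClosed_Icc
    · refine c.continuousOn.congr fun t ht => ?_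
      simp [ht.2]
    · refine h1.congr fun t ht => ?_
      rcases ht.1.eq_or_lt with h | h
      · simp [← h, c.target, d.source]
      · simp [not_le.2 h]
  vel t := if t ≤ c.T then c.vel t else d.vel (t - c.T)
  exceptional := c.exceptional ∪ {c.T} ∪ (fun t => t + c.T) '' d.exceptional
  finite_exceptional :=
    (c.finite_exceptional.union (finite_singleton _)).union (d.finite_exceptional.image _)
  hasDerivAt t ht := by
    have hne : t ≠ c.T := fun h => ht.2 (Or.inl (Or.inr h))
    rcases lt_or_gt_of_ne hne with h | h
    · have := c.hasDerivAt t ⟨⟨ht.1.1, h⟩, fun h' => ht.2 (Or.inl (Or.inl h'))⟩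
      simp only [h.le, if_true]
      refine this.congr_of_eventuallyEq ?_
      filter_upwards [Iio_mem_nhds h] with s hs
      simp [(mem_Iio.1 hs).le]
    · have h0 := d.hasDerivAt (t - c.T) ⟨⟨by linarith, by linarith [ht.1.2]⟩,
        fun h' => ht.2 (Or.inr ⟨_, h', by simp⟩)⟩
      have h1 := h0.comp_sub_const t c.T
      simp only [not_le.2 h, if_false]
      refine h1.congr_of_eventuallyEq ?_
      filter_upwards [Ioi_mem_nhds h] with s hs
      simp [not_le.2 (mem_Ioi.1 hs)]

theorem length_trans {p q r : Heis} (c : AdmissibleCurve p q) (d : AdmissibleCurve q r)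
    (N : RationalPolygonalNorm) : (c.trans d).length N = c.length N + d.length N := by
  unfold length
  have hT : (c.trans d).T = c.T + d.T := rfl
  have h := (measurePreserving_sub_right (volume : Measure ℝ) c.T).setLIntegral_comp_preimage_emb
    (MeasurableEquiv.subRight c.T).measurableEmbedding
    (fun t => ENNReal.ofReal (N.toSeminorm (d.vel t))) (Ioc 0 d.T)
  rw [hT, ← h, ← Ioc_union_Ioc_eq_Ioc c.T_nonneg (le_add_of_nonneg_right d.T_nonneg),
    lintegral_union measurableSet_Ioc (Ioc_disjoint_Ioc_of_le le_rfl),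
    preimage_sub_const_Ioc, zero_add, add_comm d.T]
  congr 1
  · refine setLIntegral_congr_fun measurableSet_Ioc fun t ht => ?_
    simp [trans, ht.2]
  · refine setLIntegral_congr_fun measurableSet_Ioc fun t ht => ?_
    simp [trans, not_le.2 ht.1]

end AdmissibleCurve

section ccEDist

variable (N : RationalPolygonalNorm)

theorem ccEDist_self (p : Heis) : ccEDist N p p = 0 := by
  let c : AdmissibleCurve p p :=
    { T := 0
      T_nonneg := le_rfl
      γ := fun _ => p
      source := rfl
      target := rfl
      continuousOn := continuousOn_const
      vel := fun _ => 0
      exceptional := ∅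
      finite_exceptional := finite_empty
      hasDerivAt := fun t ht => absurd (ht.1.1.trans ht.1.2) (lt_irrefl _) }
  refine le_antisymm ((iInf_le _ c).trans ?_) zero_le
  simp [AdmissibleCurve.length, c]

theorem ccEDist_comm (p q : Heis) : ccEDist N p q = ccEDist N q p := by
  have h : ∀ p q, ccEDist N p q ≤ ccEDist N q p := fun p q =>
    le_iInf fun c => (iInf_le _ c.symm).trans (c.length_symm N).le
  exact le_antisymm (h p q) (h q p)

theorem ccEDist_triangle (p q r : Heis) : ccEDist N p r ≤ ccEDist N p q + ccEDist N q r := by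
  refine ENNReal.le_iInf_add_iInf fun c d => ?_
  rw [← AdmissibleCurve.length_trans]
  exact iInf_le _ _

theorem ccEDist_line (p : Heis) (a b : ℝ) : ccEDist N p (p * ⟨a, b, 0⟩) < ∞ := by
  refine (iInf_le _ (AdmissibleCurve.line p (a, b))).trans_lt ?_
  simp [AdmissibleCurve.length, AdmissibleCurve.line]

theorem ccEDist_lt_top (p q : Heis) : ccEDist N p q < ∞ := by
  have step : ∀ (r : Heis) (a b : ℝ), ccEDist N p r < ∞ → ccEDist N p (r * ⟨a, b, 0⟩) < ∞ :=
    fun r a b h =>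
      (ccEDist_triangle N p r _).trans_lt (ENNReal.add_lt_top.2 ⟨h, ccEDist_line N r a b⟩)
  let w : ℝ := (p⁻¹ * q).z - (p⁻¹ * q).x * (p⁻¹ * q).y / 2
  have h0 : ccEDist N p p < ∞ := by simp [ccEDist_self]
  have h := step _ 0 (-1) (step _ (-w) 0 (step _ 0 1 (step _ w 0
    (step _ 0 (p⁻¹ * q).y (step _ (p⁻¹ * q).x 0 h0)))))
  have hq : p * ⟨(p⁻¹ * q).x, 0, 0⟩ * ⟨0, (p⁻¹ * q).y, 0⟩ * ⟨w, 0, 0⟩ * ⟨0, 1, 0⟩ *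
      ⟨-w, 0, 0⟩ * ⟨0, -1, 0⟩ = q := by
    refine Heis.ext ?_ ?_ ?_ <;> simp [w] <;> ring
  rwa [hq] at h

/-- The integral of the velocity controls displacement. -/
theorem AdmissibleCurve.abs_sub_le {p q : Heis} (c : AdmissibleCurve p q)
    (hfin : c.length N ≠ ∞) {C : ℝ} (hC : 0 ≤ C) (f f' : ℝ → ℝ) {t : ℝ} (ht : t ∈ Icc 0 c.T)
    (hf : ContinuousOn f (Icc 0 t))
    (hd : ∀ s ∈ Ioo 0 t \ c.exceptional, HasDerivAt f (f' s) s)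
    (hb : ∀ s ∈ Ioc 0 t, |f' s| ≤ C * N.toSeminorm (c.vel s)) :
    |f t - f 0| ≤ C * (c.length N).toReal := by
  have hae : f' =ᵐ[volume.restrict (Ioc 0 t)] deriv f := by
    have h1 : ∀ᵐ s ∂(volume : Measure ℝ), s ∉ c.exceptional ∪ {t} :=
      measure_eq_zero_iff_ae_notMem.1
        ((c.finite_exceptional.union (finite_singleton t)).measure_zero _)
    rw [Filter.EventuallyEq, ae_restrict_iff' measurableSet_Ioc]
    filter_upwards [h1] with s hs hst
    have hne : s ≠ t := fun h => hs (Or.inr h)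
    exact (hd s ⟨⟨hst.1, lt_of_le_of_ne hst.2 hne⟩, fun h => hs (Or.inl h)⟩).deriv.symm
  have hmeas : AEStronglyMeasurable f' (volume.restrict (Ioc 0 t)) :=
    (stronglyMeasurable_deriv f).aestronglyMeasurable.congr hae.symm
  have hle : ∫⁻ s in Ioc 0 t, ‖f' s‖ₑ ≤ ENNReal.ofReal C * c.length N := by
    calc ∫⁻ s in Ioc 0 t, ‖f' s‖ₑ
        ≤ ∫⁻ s in Ioc 0 t, ENNReal.ofReal C * ENNReal.ofReal (N.toSeminorm (c.vel s)) := by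
          refine setLIntegral_mono' measurableSet_Ioc fun s hs => ?_
          rw [← ENNReal.ofReal_mul hC, Real.enorm_eq_ofReal_abs]
          exact ENNReal.ofReal_le_ofReal (hb s hs)
      _ = ENNReal.ofReal C * ∫⁻ s in Ioc 0 t, ENNReal.ofReal (N.toSeminorm (c.vel s)) :=
          lintegral_const_mul' _ _ ENNReal.ofReal_ne_top
      _ ≤ ENNReal.ofReal C * c.length N := by
          gcongr
          exact lintegral_mono_set (Ioc_subset_Ioc_right ht.2)
  have htop : ENNReal.ofReal C * c.length N ≠ ∞ := ENNReal.mul_ne_top ENNReal.ofReal_ne_top hfin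
  have hint : IntegrableOn f' (Ioc 0 t) := ⟨hmeas, hle.trans_lt htop.lt_top⟩
  have hftc := integral_eq_of_hasDerivAt_off_countable_of_le f f' ht.1
    c.finite_exceptional.countable hf hd ((intervalIntegrable_iff_integrableOn_Ioc_of_le ht.1).2 hint)
  rw [← hftc, intervalIntegral.integral_of_le ht.1, ← Real.norm_eq_abs]
  refine (norm_integral_le_lintegral_norm _).trans ?_
  refine (ENNReal.toReal_mono htop (by simpa only [ofReal_norm] using hle)).trans ?_
  simp [ENNReal.toReal_ofReal hC]

theorem RationalPolygonalNorm.exists_bound : ∃ R : ℝ, 0 ≤ R ∧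
    ∀ v : ℝ × ℝ, |v.1| ≤ R * N.toSeminorm v ∧ |v.2| ≤ R * N.toSeminorm v := by
  obtain ⟨V, hV, -, hball⟩ := N.exists_vertices
  obtain ⟨R, hR⟩ := (hV.isCompact_convexHull ℝ).isBounded.exists_norm_le
  rw [← hball] at hR
  have key : ∀ v : ℝ × ℝ, ‖v‖ ≤ R * N.toSeminorm v := by
    intro v
    rcases (apply_nonneg N.toSeminorm v).eq_or_lt with h | h
    · simp [N.eq_zero_of_map_eq_zero v h.symm]
    · have h1 := hR ((N.toSeminorm v)⁻¹ • v) (by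
        simp [map_smul_eq_mul, abs_of_pos h, h.ne'])
      rw [norm_smul, norm_inv, Real.norm_eq_abs, abs_of_pos h, inv_mul_le_iff₀ h] at h1
      linarith
  refine ⟨R, (norm_nonneg _).trans (hR 0 (by simp)), fun v => ⟨?_, ?_⟩⟩
  · exact (norm_fst_le v).trans (key v)
  · exact (norm_snd_le v).trans (key v)

theorem eq_of_ccEDist_eq_zero {p q : Heis} (h : ccEDist N p q = 0) : p = q := by
  obtain ⟨R, hR0, hR⟩ := N.exists_bound
  have key : ∀ ε : ℝ, 0 < ε → |q.x - p.x| ≤ R * ε ∧ |q.y - p.y| ≤ R * ε ∧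
      |(q.z - (p.x * q.y - p.y * q.x) / 2) - p.z| ≤ R * ε * R * ε := by
    intro ε hε
    obtain ⟨c, hc⟩ : ∃ c : AdmissibleCurve p q, c.length N < ENNReal.ofReal ε :=
      iInf_lt_iff.1 (by
        change ccEDist N p q < _
        rw [h]
        exact ENNReal.ofReal_pos.2 hε)
    have hfin := (hc.trans ENNReal.ofReal_lt_top).ne
    have hL : (c.length N).toReal ≤ ε := ENNReal.toReal_le_of_le_ofReal hε.le hc.le
    have hmem : c.T ∈ Icc 0 c.T := ⟨c.T_nonneg, le_rfl⟩
    have cx : ContinuousOn (fun t => (c.γ t).x) (Icc 0 c.T) := c.continuousOn.fst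
    have cy : ContinuousOn (fun t => (c.γ t).y) (Icc 0 c.T) := c.continuousOn.snd.fst
    have cz : ContinuousOn (fun t => (c.γ t).z) (Icc 0 c.T) := c.continuousOn.snd.snd
    have dx : ∀ s ∈ Ioo 0 c.T \ c.exceptional,
        HasDerivAt (fun t => (c.γ t).x) (c.vel s).1 s := fun s hs => (c.hasDerivAt s hs).fst
    have dy : ∀ s ∈ Ioo 0 c.T \ c.exceptional,
        HasDerivAt (fun t => (c.γ t).y) (c.vel s).2 s := fun s hs => (c.hasDerivAt s hs).snd.fst
    have dz : ∀ s ∈ Ioo 0 c.T \ c.exceptional, HasDerivAt (fun t => (c.γ t).z)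
        (((c.γ s).x * (c.vel s).2 - (c.γ s).y * (c.vel s).1) / 2) s :=
      fun s hs => (c.hasDerivAt s hs).snd.snd
    have sub : ∀ t ∈ Icc 0 c.T, Icc 0 t ⊆ Icc 0 c.T := fun t ht => Icc_subset_Icc_right ht.2
    have subo : ∀ t ∈ Icc 0 c.T, Ioo 0 t \ c.exceptional ⊆ Ioo 0 c.T \ c.exceptional :=
      fun t ht => sdiff_subset_sdiff_left (Ioo_subset_Ioo_right ht.2)
    have hx : ∀ t ∈ Icc 0 c.T, |(c.γ t).x - p.x| ≤ R * ε := by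
      intro t ht
      have := c.abs_sub_le N hfin hR0 (fun t => (c.γ t).x) (fun s => (c.vel s).1) ht
        (cx.mono (sub t ht)) (fun s hs => dx s (subo t ht hs)) (fun s _ => (hR _).1)
      simp only [c.source] at this
      exact this.trans (by gcongr)
    have hy : ∀ t ∈ Icc 0 c.T, |(c.γ t).y - p.y| ≤ R * ε := by
      intro t ht
      have := c.abs_sub_le N hfin hR0 (fun t => (c.γ t).y) (fun s => (c.vel s).2) ht
        (cy.mono (sub t ht)) (fun s hs => dy s (subo t ht hs)) (fun s _ => (hR _).2)
      simp only [c.source] at this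
      exact this.trans (by gcongr)
    have hz := c.abs_sub_le N hfin (C := R * ε * R) (by positivity)
      (fun t => (c.γ t).z - (p.x * (c.γ t).y - p.y * (c.γ t).x) / 2)
      (fun s => ((c.γ s).x * (c.vel s).2 - (c.γ s).y * (c.vel s).1) / 2 -
        (p.x * (c.vel s).2 - p.y * (c.vel s).1) / 2) hmem
      (cz.sub (((cy.const_mul _).sub (cx.const_mul _)).div_const 2))
      (fun s hs => (dz s hs).sub
        ((((dy s hs).const_mul p.x).sub ((dx s hs).const_mul p.y)).div_const 2))
      (fun s hs => by
        have hs' : s ∈ Icc 0 c.T := ⟨hs.1.le, hs.2⟩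
        have e1 : |((c.γ s).x - p.x) * (c.vel s).2| ≤
            R * ε * (R * N.toSeminorm (c.vel s)) := by
          rw [abs_mul]
          exact mul_le_mul (hx s hs') (hR _).2 (abs_nonneg _) (by positivity)
        have e2 : |((c.γ s).y - p.y) * (c.vel s).1| ≤
            R * ε * (R * N.toSeminorm (c.vel s)) := by
          rw [abs_mul]
          exact mul_le_mul (hy s hs') (hR _).1 (abs_nonneg _) (by positivity)
        rw [abs_le] at e1 e2 ⊢
        constructor <;> linarith [e1.1, e1.2, e2.1, e2.2])
    have hx' := hx _ hmem
    have hy' := hy _ hmem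
    rw [c.target] at hx' hy'
    refine ⟨hx', hy', ?_⟩
    simp only [c.source, c.target] at hz
    have e3 : p.z - (p.x * p.y - p.y * p.x) / 2 = p.z := by ring
    rw [e3] at hz
    exact hz.trans (by gcongr)
  have lim : ∀ (a : ℝ) (g : ℝ → ℝ), Continuous g → g 0 = 0 → (∀ ε, 0 < ε → |a| ≤ g ε) → a = 0 := by
    intro a g hg hg0 hle
    have h1 : Tendsto g (𝓝[>] 0) (𝓝 0) := by
      have := hg.tendsto 0
      rw [hg0] at this
      exact this.mono_left nhdsWithin_le_nhds
    have h2 : |a| ≤ 0 := ge_of_tendsto h1 (by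
      filter_upwards [self_mem_nhdsWithin] with ε hε using hle ε hε)
    exact abs_nonpos_iff.1 h2
  have hx := lim _ (fun ε => R * ε) (by fun_prop) (by simp) fun ε hε => (key ε hε).1
  have hy := lim _ (fun ε => R * ε) (by fun_prop) (by simp) fun ε hε => (key ε hε).2.1
  have hz := lim _ (fun ε => R * ε * R * ε) (by fun_prop) (by simp) fun ε hε => (key ε hε).2.2
  have hx' : q.x = p.x := sub_eq_zero.1 hx
  have hy' : q.y = p.y := sub_eq_zero.1 hy
  rw [hx', hy'] at hz
  exact Heis.ext hx'.symm hy'.symm (by linarith)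

end ccEDist

/-- `H(ℝ)` as a metric space, with the CC metric induced by the norm `N`. -/
def CCHeis (_ : RationalPolygonalNorm) : Type := Heis

noncomputable instance (N : RationalPolygonalNorm) : EMetricSpace (CCHeis N) where
  edist p q := ccEDist N p q
  edist_self := ccEDist_self N
  edist_comm := ccEDist_comm N
  edist_triangle := ccEDist_triangle N
  eq_of_edist_eq_zero := eq_of_ccEDist_eq_zero N

noncomputable instance (N : RationalPolygonalNorm) : MetricSpace (CCHeis N) :=
  EMetricSpace.toMetricSpace fun p q => (ccEDist_lt_top N p q).ne

/-- The property `AC(k)` of a metric space: there is a bound `M` such that any two points at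
distance at most `k` on a common metric sphere are joined, inside the closed ball bounded by
that sphere, by a path of length at most `M`. -/
def IsAlmostConvexAt (X : Type*) [MetricSpace X] (k : ℝ) : Prop :=
  ∃ M : ℝ, ∀ (x₀ : X) (n : ℝ) (x y : X),
    x ∈ Metric.sphere x₀ n → y ∈ Metric.sphere x₀ n → dist x y ≤ k →
      ∃ γ : Path x y, (∀ t, γ t ∈ Metric.closedBall x₀ n) ∧
        eVariationOn γ univ ≤ ENNReal.ofReal M

/-- A metric space is almost convex if it satisfies `AC(k)` for every `k`. -/
def IsAlmostConvex (X : Type*) [MetricSpace X] : Prop :=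
  ∀ k : ℝ, IsAlmostConvexAt X k

/-! More is true: two points of a sphere are joined inside the ball by a curve of length at most a
fixed multiple of their distance, with a constant independent of the radius
(`exists_curve_in_closedBall`). Left translations and dilations reduce this to the unit sphere about
the identity, and compactness (`exists_joinedInBall_sphere`) to a local statement near each of its
points; pairs that are not close are joined through the identity.

Locally, the point is that the distance `ccn` to the identity has no critical points on the sphere.
Suppose that near `q` it decreases at a rate `c` in one horizontal direction `w`. Push `x` and `y`
along `w` by a multiple of `ε = d(x, y)`. Their distance grows only by a square-root term due to
non-commutativity, while both gain depth linearly in the push; for a large multiple an almost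
shortest curve between the pushed points stays in the ball
(`exists_joinedInBall_of_common_descent`). Near the vertical axis the descent is radial, in a
direction that depends on the point; there `x` and `y` first move outwards and then along a common
vector (`HasRadialDescent.locallyJoined`).

Descent is proved infinitesimally. A proximal subgradient `(p, ξ)` of `ccn` obeys a first variation
inequality (inserting a short segment into a geodesic), Euler's identity for dilations and an
eikonal inequality. A discrete area estimate (`exists_isBetween_depth`) shows that a geodesic to a
point above the plane, unless its length is just the norm of its chord, leaves the chord by a
definite depth. Together these give a horizontal vector on which all subgradients near `q` are
positive (`exists_noncritical_nhds`), or, near the axis, negativity on the radial vector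
(`exists_radial_subgrad_bound`). The mean value inequality `ccn_mul_hexp_le_of_subgrad` turns this
into descent. -/

open Heis

/-! ### Automorphisms and Euclidean topology of the Heisenberg group -/

namespace Heis

/-- The projection to the horizontal plane. -/
def pr (q : Heis) : ℝ × ℝ := (q.x, q.y)

/-- The exponential of a horizontal vector. -/
def hexp (w : ℝ × ℝ) : Heis := ⟨w.1, w.2, 0⟩

/-- The central element with last coordinate `c`. -/
def vert (c : ℝ) : Heis := ⟨0, 0, c⟩

/-- The automorphism induced by the diagonal linear map `(a, b)`. -/
def diag (a b : ℝ) (q : Heis) : Heis := ⟨a * q.x, b * q.y, a * b * q.z⟩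

/-- The dilation by the factor `s`. -/
def dil (s : ℝ) (q : Heis) : Heis := diag s s q

@[simp] theorem pr_fst (q : Heis) : q.pr.1 = q.x := rfl
@[simp] theorem pr_snd (q : Heis) : q.pr.2 = q.y := rfl
@[simp] theorem hexp_x (w : ℝ × ℝ) : (hexp w).x = w.1 := rfl
@[simp] theorem hexp_y (w : ℝ × ℝ) : (hexp w).y = w.2 := rfl
@[simp] theorem hexp_z (w : ℝ × ℝ) : (hexp w).z = 0 := rfl
@[simp] theorem vert_x (c : ℝ) : (vert c).x = 0 := rfl
@[simp] theorem vert_y (c : ℝ) : (vert c).y = 0 := rfl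
@[simp] theorem vert_z (c : ℝ) : (vert c).z = c := rfl
@[simp] theorem diag_x (a b : ℝ) (q : Heis) : (diag a b q).x = a * q.x := rfl
@[simp] theorem diag_y (a b : ℝ) (q : Heis) : (diag a b q).y = b * q.y := rfl
@[simp] theorem diag_z (a b : ℝ) (q : Heis) : (diag a b q).z = a * b * q.z := rfl
@[simp] theorem dil_x (s : ℝ) (q : Heis) : (dil s q).x = s * q.x := rfl
@[simp] theorem dil_y (s : ℝ) (q : Heis) : (dil s q).y = s * q.y := rfl
@[simp] theorem dil_z (s : ℝ) (q : Heis) : (dil s q).z = s * s * q.z := rfl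

theorem diag_mul (a b : ℝ) (p q : Heis) : diag a b (p * q) = diag a b p * diag a b q := by
  ext <;> simp <;> ring

theorem diag_one (a b : ℝ) : diag a b 1 = 1 := by
  ext <;> simp

theorem diag_inv (a b : ℝ) (p : Heis) : diag a b p⁻¹ = (diag a b p)⁻¹ := by
  ext <;> simp

theorem dil_mul (s : ℝ) (p q : Heis) : dil s (p * q) = dil s p * dil s q := diag_mul s s p q

theorem dil_inv (s : ℝ) (p : Heis) : dil s p⁻¹ = (dil s p)⁻¹ := diag_inv s s p

theorem dil_dil (s t : ℝ) (p : Heis) : dil s (dil t p) = dil (s * t) p := by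
  ext <;> simp <;> ring

theorem dil_one_left (p : Heis) : dil 1 p = p := by
  ext <;> simp

theorem pr_mul (p q : Heis) : (p * q).pr = p.pr + q.pr := rfl
theorem pr_inv (p : Heis) : (p⁻¹).pr = -p.pr := rfl
theorem pr_hexp (w : ℝ × ℝ) : (hexp w).pr = w := rfl
theorem pr_one : (1 : Heis).pr = 0 := rfl

theorem hexp_mul_vert (q : Heis) : hexp q.pr * vert q.z = q := by
  ext <;> simp

theorem coords_injective : Function.Injective coords := by
  intro p q h
  simp only [coords, Prod.mk.injEq] at h
  exact Heis.ext h.1 h.2.1 h.2.2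

/-- The Euclidean (sup) metric in exponential coordinates. -/
noncomputable instance : MetricSpace Heis :=
  MetricSpace.induced coords coords_injective inferInstance

theorem isometry_coords : Isometry coords := fun _ _ => rfl

theorem continuous_coords : Continuous coords := isometry_coords.continuous

theorem continuous_iff_coords {X : Type*} [TopologicalSpace X] {f : X → Heis} :
    Continuous f ↔ Continuous fun t => (f t).coords :=
  isometry_coords.isEmbedding.isInducing.continuous_iff

@[fun_prop]
theorem continuous_x : Continuous Heis.x := continuous_fst.comp continuous_coords
@[fun_prop]
theorem continuous_y : Continuous Heis.y := (continuous_fst.comp continuous_snd).comp continuous_coords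
@[fun_prop]
theorem continuous_z : Continuous Heis.z := (continuous_snd.comp continuous_snd).comp continuous_coords

theorem continuous_mk {X : Type*} [TopologicalSpace X] {f g h : X → ℝ} (hf : Continuous f)
    (hg : Continuous g) (hh : Continuous h) : Continuous fun t => (⟨f t, g t, h t⟩ : Heis) :=
  continuous_iff_coords.2 (hf.prodMk (hg.prodMk hh))

@[fun_prop]
theorem continuous_pr : Continuous pr := continuous_x.prodMk continuous_y

@[fun_prop]
theorem continuous_hexp : Continuous hexp :=
  continuous_mk continuous_fst continuous_snd continuous_const

instance : ContinuousMul Heis where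
  continuous_mul := by
    change Continuous fun p : Heis × Heis => (⟨_, _, _⟩ : Heis)
    apply continuous_mk <;> fun_prop

instance : ContinuousInv Heis where
  continuous_inv := by
    change Continuous fun p : Heis => (⟨_, _, _⟩ : Heis)
    apply continuous_mk <;> fun_prop

theorem dist_le_iff {p q : Heis} {r : ℝ} : dist p q ≤ r ↔
    |p.x - q.x| ≤ r ∧ |p.y - q.y| ≤ r ∧ |p.z - q.z| ≤ r := by
  change dist p.coords q.coords ≤ r ↔ _
  simp [coords, Prod.dist_eq, Real.dist_eq]

theorem abs_x_sub_le (p q : Heis) : |p.x - q.x| ≤ dist p q := (dist_le_iff.1 le_rfl).1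
theorem abs_y_sub_le (p q : Heis) : |p.y - q.y| ≤ dist p q := (dist_le_iff.1 le_rfl).2.1
theorem abs_z_sub_le (p q : Heis) : |p.z - q.z| ≤ dist p q := (dist_le_iff.1 le_rfl).2.2

instance : ProperSpace Heis where
  isCompact_closedBall p r := by
    have : Metric.closedBall p r = coords ⁻¹' Metric.closedBall p.coords r := rfl
    rw [this]
    refine Topology.IsClosedEmbedding.isCompact_preimage ?_ (isCompact_closedBall _ _)
    refine ⟨isometry_coords.isEmbedding, ?_⟩
    have : range coords = univ := by
      refine eq_univ_of_forall fun c => ⟨⟨c.1, c.2.1, c.2.2⟩, rfl⟩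
    rw [this]
    exact isClosed_univ

end Heis

/-- The standard area form on the plane. -/
def wedge (a b : ℝ × ℝ) : ℝ := a.1 * b.2 - a.2 * b.1

/-- The standard pairing of the plane with itself. -/
def dot (p w : ℝ × ℝ) : ℝ := p.1 * w.1 + p.2 * w.2

/-! ### The norm on the plane and its norming functionals -/

namespace RationalPolygonalNorm

variable (N : RationalPolygonalNorm)

/-- The value of the norm. -/
def nm (v : ℝ × ℝ) : ℝ := N.toSeminorm v

theorem nm_nonneg (v : ℝ × ℝ) : 0 ≤ N.nm v := apply_nonneg N.toSeminorm v
theorem nm_add (v w : ℝ × ℝ) : N.nm (v + w) ≤ N.nm v + N.nm w := map_add_le_add N.toSeminorm v w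
theorem nm_neg (v : ℝ × ℝ) : N.nm (-v) = N.nm v := map_neg_eq_map N.toSeminorm v
theorem nm_sub_rev (v w : ℝ × ℝ) : N.nm (v - w) = N.nm (w - v) := map_sub_rev N.toSeminorm v w
theorem nm_smul (s : ℝ) (v : ℝ × ℝ) : N.nm (s • v) = |s| * N.nm v := by
  simp [nm, map_smul_eq_mul]
theorem nm_zero : N.nm 0 = 0 := map_zero N.toSeminorm
theorem nm_pos {v : ℝ × ℝ} (hv : v ≠ 0) : 0 < N.nm v :=
  (N.nm_nonneg v).lt_of_ne fun h => hv (N.eq_zero_of_map_eq_zero v h.symm)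
theorem nm_smul_of_nonneg {s : ℝ} (hs : 0 ≤ s) (v : ℝ × ℝ) : N.nm (s • v) = s * N.nm v := by
  rw [nm_smul, abs_of_nonneg hs]

@[fun_prop]
theorem continuous_nm : Continuous N.nm := by
  rw [← continuousOn_univ]
  exact N.toSeminorm.convexOn.continuousOn isOpen_univ

/-- Hahn–Banach: the functional `c • v ↦ c * N.nm v` on the line of `v` extends to the plane below
`N.nm`. -/
theorem exists_norming (v : ℝ × ℝ) : ∃ p : ℝ × ℝ, (∀ w, dot p w ≤ N.nm w) ∧ dot p v = N.nm v := by
  by_cases hv : v = 0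
  · refine ⟨0, fun w => ?_, ?_⟩
    · simpa [dot] using N.nm_nonneg w
    · simp [dot, hv, nm_zero]
  obtain ⟨g, hg1, hg2⟩ := exists_extension_of_le_sublinear
    (LinearPMap.mkSpanSingleton v (N.nm v) hv) N.nm
    (fun c hc x => by rw [N.nm_smul, abs_of_pos hc]) N.nm_add (by
      rintro ⟨x, hx⟩
      obtain ⟨c, rfl⟩ := Submodule.mem_span_singleton.1 hx
      rw [LinearPMap.mkSpanSingleton'_apply]
      simp only [smul_eq_mul]
      rw [N.nm_smul]
      exact mul_le_mul_of_nonneg_right (le_abs_self c) (N.nm_nonneg v))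
  have hdot : ∀ w : ℝ × ℝ, dot (g (1, 0), g (0, 1)) w = g w := by
    intro w
    have : w = w.1 • ((1 : ℝ), (0 : ℝ)) + w.2 • ((0 : ℝ), (1 : ℝ)) := by
      ext <;> simp
    conv_rhs => rw [this, map_add, map_smul, map_smul]
    simp [dot, mul_comm]
  refine ⟨(g (1, 0), g (0, 1)), fun w => by rw [hdot]; exact hg2 w, ?_⟩
  rw [hdot]
  have h := hg1 ⟨v, Submodule.mem_span_singleton_self v⟩
  rw [h]
  exact LinearPMap.mkSpanSingleton_apply ℝ ℝ hv (N.nm v)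

end RationalPolygonalNorm

theorem dot_abs_le {N : RationalPolygonalNorm} {p : ℝ × ℝ} (hp : ∀ w, dot p w ≤ N.nm w)
    (w : ℝ × ℝ) : |dot p w| ≤ N.nm w := by
  refine abs_le.2 ⟨?_, hp w⟩
  have h := hp (-w)
  rw [N.nm_neg] at h
  simp only [dot, Prod.fst_neg, Prod.snd_neg] at h ⊢
  linarith

/-! ### Images and restrictions of admissible curves -/

namespace AdmissibleCurve

/-- Left translation of an admissible curve. -/
noncomputable def translate (g : Heis) {p q : Heis} (c : AdmissibleCurve p q) :
    AdmissibleCurve (g * p) (g * q) where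
  T := c.T
  T_nonneg := c.T_nonneg
  γ t := g * c.γ t
  source := by rw [c.source]
  target := by rw [c.target]
  continuousOn := by
    have cx : ContinuousOn (fun t => (c.γ t).x) (Icc 0 c.T) := c.continuousOn.fst
    have cy : ContinuousOn (fun t => (c.γ t).y) (Icc 0 c.T) := c.continuousOn.snd.fst
    have cz : ContinuousOn (fun t => (c.γ t).z) (Icc 0 c.T) := c.continuousOn.snd.snd
    simp only [Heis.coords, Heis.mul_x, Heis.mul_y, Heis.mul_z]
    fun_prop
  vel := c.vel
  exceptional := c.exceptional
  finite_exceptional := c.finite_exceptional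
  hasDerivAt t ht := by
    have h := c.hasDerivAt t ht
    have dx : HasDerivAt (fun t => (c.γ t).x) (c.vel t).1 t := h.fst
    have dy : HasDerivAt (fun t => (c.γ t).y) (c.vel t).2 t := h.snd.fst
    have dz : HasDerivAt (fun t => (c.γ t).z)
        (((c.γ t).x * (c.vel t).2 - (c.γ t).y * (c.vel t).1) / 2) t := h.snd.snd
    have h3 : HasDerivAt (fun s => g.z + (c.γ s).z + (g.x * (c.γ s).y - g.y * (c.γ s).x) / 2) _ t :=
      (dz.const_add g.z).add (((dy.const_mul g.x).sub (dx.const_mul g.y)).div_const 2)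
    refine ((dx.const_add g.x).prodMk ((dy.const_add g.y).prodMk h3)).congr_deriv
      (Prod.ext rfl (Prod.ext rfl ?_))
    simp only [Heis.push, Heis.mul_x, Heis.mul_y]
    ring

/-- The image of an admissible curve under a diagonal automorphism. -/
noncomputable def mapDiag (a b : ℝ) {p q : Heis} (c : AdmissibleCurve p q) :
    AdmissibleCurve (Heis.diag a b p) (Heis.diag a b q) where
  T := c.T
  T_nonneg := c.T_nonneg
  γ t := Heis.diag a b (c.γ t)
  source := by rw [c.source]
  target := by rw [c.target]
  continuousOn := by
    have cx : ContinuousOn (fun t => (c.γ t).x) (Icc 0 c.T) := c.continuousOn.fst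
    have cy : ContinuousOn (fun t => (c.γ t).y) (Icc 0 c.T) := c.continuousOn.snd.fst
    have cz : ContinuousOn (fun t => (c.γ t).z) (Icc 0 c.T) := c.continuousOn.snd.snd
    simp only [Heis.coords, Heis.diag]
    fun_prop
  vel t := (a * (c.vel t).1, b * (c.vel t).2)
  exceptional := c.exceptional
  finite_exceptional := c.finite_exceptional
  hasDerivAt t ht := by
    have h := c.hasDerivAt t ht
    have dx : HasDerivAt (fun t => (c.γ t).x) (c.vel t).1 t := h.fst
    have dy : HasDerivAt (fun t => (c.γ t).y) (c.vel t).2 t := h.snd.fst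
    have dz : HasDerivAt (fun t => (c.γ t).z)
        (((c.γ t).x * (c.vel t).2 - (c.γ t).y * (c.vel t).1) / 2) t := h.snd.snd
    refine ((dx.const_mul a).prodMk ((dy.const_mul b).prodMk (dz.const_mul (a * b)))).congr_deriv
      (Prod.ext rfl (Prod.ext rfl ?_))
    simp only [Heis.push, Heis.diag]
    ring

/-- The restriction of an admissible curve to `[s, t]`. -/
noncomputable def restrict {p q : Heis} (c : AdmissibleCurve p q) {s t : ℝ} (hs : 0 ≤ s)
    (hst : s ≤ t) (ht : t ≤ c.T) : AdmissibleCurve (c.γ s) (c.γ t) where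
  T := t - s
  T_nonneg := sub_nonneg.2 hst
  γ r := c.γ (r + s)
  source := by simp
  target := by simp
  continuousOn := by
    refine c.continuousOn.comp (f := fun r => r + s) (by fun_prop) ?_
    intro r hr
    exact ⟨by linarith [hr.1], by linarith [hr.2]⟩
  vel r := c.vel (r + s)
  exceptional := (fun r => r - s) '' c.exceptional
  finite_exceptional := c.finite_exceptional.image _
  hasDerivAt r hr := by
    have h := c.hasDerivAt (r + s) ⟨⟨by linarith [hr.1.1], by linarith [hr.1.2]⟩,
      fun h' => hr.2 ⟨_, h', by simp⟩⟩
    exact h.comp_add_const r s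

theorem length_restrict {p q : Heis} (c : AdmissibleCurve p q) {s t : ℝ} (hs : 0 ≤ s)
    (hst : s ≤ t) (ht : t ≤ c.T) (N : RationalPolygonalNorm) :
    (c.restrict hs hst ht).length N =
      ∫⁻ r in Ioc s t, ENNReal.ofReal (N.toSeminorm (c.vel r)) := by
  unfold length
  have h := (measurePreserving_add_right (volume : Measure ℝ) s).setLIntegral_comp_preimage_emb
    (MeasurableEquiv.addRight s).measurableEmbedding
    (fun t => ENNReal.ofReal (N.toSeminorm (c.vel t))) (Ioc s t)
  rw [← h, preimage_add_const_Ioc, sub_self]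
  rfl

theorem ccEDist_le_setLIntegral {p q : Heis} (c : AdmissibleCurve p q) {s t : ℝ} (hs : 0 ≤ s)
    (hst : s ≤ t) (ht : t ≤ c.T) (N : RationalPolygonalNorm) :
    ccEDist N (c.γ s) (c.γ t) ≤ ∫⁻ r in Ioc s t, ENNReal.ofReal (N.toSeminorm (c.vel r)) := by
  rw [← c.length_restrict hs hst ht]
  exact iInf_le _ _

end AdmissibleCurve

/-! ### The CC norm: invariance, homogeneity, comparison with coordinates -/

section ccn

variable (N : RationalPolygonalNorm)

theorem ccEDist_mul_left_le (g p q : Heis) : ccEDist N (g * p) (g * q) ≤ ccEDist N p q :=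
  le_iInf fun c => iInf_le (fun c : AdmissibleCurve (g * p) (g * q) => c.length N) (c.translate g)

theorem ccEDist_mul_left (g p q : Heis) : ccEDist N (g * p) (g * q) = ccEDist N p q := by
  refine le_antisymm (ccEDist_mul_left_le N g p q) ?_
  simpa using ccEDist_mul_left_le N g⁻¹ (g * p) (g * q)

/-- Two norms and two factors are allowed so that both dilations and the reflection of the norm are
covered. -/
theorem ccEDist_diag_le {N N' : RationalPolygonalNorm} {a b C : ℝ} (hC : 0 ≤ C)
    (h : ∀ u : ℝ × ℝ, N'.nm (a * u.1, b * u.2) ≤ C * N.nm u) (p q : Heis) :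
    ccEDist N' (diag a b p) (diag a b q) ≤ ENNReal.ofReal C * ccEDist N p q := by
  unfold ccEDist
  have hne : Nonempty (AdmissibleCurve p q) := by
    by_contra h0
    have h1 := ccEDist_lt_top N p q
    have := not_nonempty_iff.1 h0
    rw [ccEDist, iInf_of_empty] at h1
    exact lt_irrefl _ h1
  rw [ENNReal.mul_iInf fun h => (ENNReal.ofReal_ne_top h).elim]
  refine le_iInf fun c => (iInf_le _ (c.mapDiag a b)).trans ?_
  unfold AdmissibleCurve.length
  rw [← lintegral_const_mul' _ _ ENNReal.ofReal_ne_top]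
  refine lintegral_mono fun t => ?_
  rw [← ENNReal.ofReal_mul hC]
  exact ENNReal.ofReal_le_ofReal (h _)

/-- The CC distance to the identity. -/
noncomputable def ccn (q : Heis) : ℝ := (ccEDist N 1 q).toReal

theorem ccEDist_eq (p q : Heis) : ccEDist N p q = ENNReal.ofReal (ccn N (p⁻¹ * q)) := by
  rw [ccn, ENNReal.ofReal_toReal (ccEDist_lt_top N _ _).ne, ← ccEDist_mul_left N p⁻¹ p q,
    inv_mul_cancel]

theorem ccn_nonneg (q : Heis) : 0 ≤ ccn N q := ENNReal.toReal_nonneg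

theorem ccn_one : ccn N 1 = 0 := by simp [ccn, ccEDist_self]

theorem ccn_eq_zero {q : Heis} (h : ccn N q = 0) : q = 1 := by
  have := ccEDist_eq N 1 q
  simp [h] at this
  exact (eq_of_ccEDist_eq_zero N this).symm

theorem ccn_inv (q : Heis) : ccn N q⁻¹ = ccn N q := by
  have h := ccEDist_eq N q 1
  rw [mul_one] at h
  rw [ccn, ccn, ccEDist_comm N 1 q, h, ccEDist_eq N 1 q⁻¹]
  simp

theorem ccn_mul_le (p q : Heis) : ccn N (p * q) ≤ ccn N p + ccn N q := by
  have h := ccEDist_triangle N 1 p (p * q)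
  simp only [ccEDist_eq, inv_one, one_mul, inv_mul_cancel_left] at h
  rw [← ENNReal.ofReal_add (ccn_nonneg N _) (ccn_nonneg N _)] at h
  exact (ENNReal.ofReal_le_ofReal_iff (add_nonneg (ccn_nonneg N _) (ccn_nonneg N _))).1 h

theorem ccn_diag_le {N N' : RationalPolygonalNorm} {a b C : ℝ} (hC : 0 ≤ C)
    (h : ∀ u : ℝ × ℝ, N'.nm (a * u.1, b * u.2) ≤ C * N.nm u) (q : Heis) :
    ccn N' (diag a b q) ≤ C * ccn N q := by
  have h := ccEDist_diag_le hC h 1 q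
  rw [diag_one, ccEDist_eq, ccEDist_eq] at h
  simp only [inv_one, one_mul] at h
  rw [← ENNReal.ofReal_mul hC] at h
  exact (ENNReal.ofReal_le_ofReal_iff (mul_nonneg hC (ccn_nonneg N _))).1 h

theorem ccn_dil {s : ℝ} (hs : 0 ≤ s) (q : Heis) : ccn N (dil s q) = s * ccn N q := by
  have key : ∀ s : ℝ, 0 ≤ s → ∀ q, ccn N (dil s q) ≤ s * ccn N q := fun s hs q =>
    ccn_diag_le hs (fun u => (N.nm_smul_of_nonneg hs u).le) q
  rcases hs.eq_or_lt with rfl | h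
  · refine le_antisymm (key 0 le_rfl q) ?_
    simpa using ccn_nonneg N _
  · refine le_antisymm (key s hs q) ?_
    have h2 := key s⁻¹ (by positivity) (dil s q)
    rw [dil_dil, inv_mul_cancel₀ h.ne', dil_one_left, inv_mul_eq_div, le_div_iff₀ h] at h2
    linarith

theorem ccn_hexp_le (w : ℝ × ℝ) : ccn N (hexp w) ≤ N.nm w := by
  have h : ccEDist N 1 (1 * hexp w) ≤ ENNReal.ofReal (N.nm w) := by
    refine (iInf_le _ (AdmissibleCurve.line 1 w)).trans ?_
    simp [AdmissibleCurve.length, AdmissibleCurve.line, RationalPolygonalNorm.nm]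
  rw [one_mul, ccEDist_eq] at h
  simpa using (ENNReal.ofReal_le_ofReal_iff (N.nm_nonneg w)).1 h

theorem exists_curve_lt {p q : Heis} {L : ℝ} (h : ccn N (p⁻¹ * q) < L) :
    ∃ c : AdmissibleCurve p q, c.length N < ENNReal.ofReal L := by
  refine iInf_lt_iff.1 ?_
  change ccEDist N p q < _
  rw [ccEDist_eq]
  exact (ENNReal.ofReal_lt_ofReal_iff ((ccn_nonneg N _).trans_lt h)).2 h

/-- Replaces shortest curves: a bound is proved for curves of length below every `L > d` and passes
to the limit. -/
theorem le_of_forall_gt_continuous {a d : ℝ} {f : ℝ → ℝ} (hf : Continuous f)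
    (h : ∀ L, d < L → a ≤ f L) : a ≤ f d := by
  have h1 : Tendsto f (𝓝[>] d) (𝓝 (f d)) := (hf.tendsto d).mono_left nhdsWithin_le_nhds
  refine ge_of_tendsto h1 ?_
  filter_upwards [self_mem_nhdsWithin] with L hL using h L hL

/-- A covector of dual norm at most one is a calibration: along an admissible curve it changes no
faster than the length. -/
theorem dot_pr_le_ccn {p : ℝ × ℝ} (hp : ∀ w, dot p w ≤ N.nm w) (q : Heis) :
    |dot p q.pr| ≤ ccn N q := by
  refine le_of_forall_gt_continuous (f := fun L => L) continuous_id fun L hL => ?_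
  obtain ⟨c, hc⟩ := exists_curve_lt N (p := 1) (q := q) (L := L) (by simpa using hL)
  have hL0 : 0 ≤ L := (ccn_nonneg N q).trans hL.le
  have hfin := (hc.trans ENNReal.ofReal_lt_top).ne
  have cx : ContinuousOn (fun t => (c.γ t).x) (Icc 0 c.T) := c.continuousOn.fst
  have cy : ContinuousOn (fun t => (c.γ t).y) (Icc 0 c.T) := c.continuousOn.snd.fst
  have h := c.abs_sub_le N hfin zero_le_one (fun t => dot p (c.γ t).pr)
    (fun t => dot p (c.vel t)) (t := c.T) ⟨c.T_nonneg, le_rfl⟩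
    ((cx.const_mul p.1).add (cy.const_mul p.2))
    (fun s hs => by
      have dx : HasDerivAt (fun t => (c.γ t).x) (c.vel s).1 s := (c.hasDerivAt s hs).fst
      have dy : HasDerivAt (fun t => (c.γ t).y) (c.vel s).2 s := (c.hasDerivAt s hs).snd.fst
      exact (dx.const_mul p.1).add (dy.const_mul p.2))
    (fun s _ => by rw [one_mul]; exact dot_abs_le hp _)
  simp only [c.source, c.target, pr_one] at h
  have h0 : dot p 0 = 0 := by simp [dot]
  rw [h0, sub_zero, one_mul] at h
  exact h.trans (ENNReal.toReal_le_of_le_ofReal hL0 hc.le)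

theorem nm_pr_le_ccn (q : Heis) : N.nm q.pr ≤ ccn N q := by
  obtain ⟨p, hp, hpv⟩ := N.exists_norming q.pr
  rw [← hpv]
  exact (le_abs_self _).trans (dot_pr_le_ccn N hp q)

/-- The CC norm controls the exponential coordinates. -/
theorem exists_coord_bound : ∃ R : ℝ, 0 < R ∧ (∀ w : ℝ × ℝ, |w.1| ≤ R * N.nm w ∧ |w.2| ≤ R * N.nm w) ∧
    ∀ q : Heis, |q.x| ≤ R * ccn N q ∧ |q.y| ≤ R * ccn N q ∧ |q.z| ≤ (R * ccn N q) ^ 2 := by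
  obtain ⟨R₀, hR0, hR₀⟩ := N.exists_bound
  obtain ⟨R, hRpos, hR⟩ : ∃ R : ℝ, 0 < R ∧
      ∀ w : ℝ × ℝ, |w.1| ≤ R * N.nm w ∧ |w.2| ≤ R * N.nm w := by
    refine ⟨R₀ + 1, by positivity, fun w => ⟨(hR₀ w).1.trans ?_, (hR₀ w).2.trans ?_⟩⟩ <;>
    · change R₀ * N.nm w ≤ _
      nlinarith [N.nm_nonneg w]
  refine ⟨R, hRpos, hR, fun q => ⟨?_, ?_, ?_⟩⟩
  · exact (hR q.pr).1.trans (by gcongr; exact nm_pr_le_ccn N q)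
  · exact (hR q.pr).2.trans (by gcongr; exact nm_pr_le_ccn N q)
  · refine le_of_forall_gt_continuous (f := fun L => (R * L) ^ 2) (by fun_prop) fun L hL => ?_
    obtain ⟨c, hc⟩ := exists_curve_lt N (p := 1) (q := q) (L := L) (by simpa using hL)
    have hL0 : 0 ≤ L := (ccn_nonneg N q).trans hL.le
    have hfin := (hc.trans ENNReal.ofReal_lt_top).ne
    have hlen : (c.length N).toReal ≤ L := ENNReal.toReal_le_of_le_ofReal hL0 hc.le
    have hmem : c.T ∈ Icc 0 c.T := ⟨c.T_nonneg, le_rfl⟩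
    -- All points of the curve lie within distance `L` of the identity, so `z'`, bilinear in
    -- position and velocity, is at most `R * L * R` times the speed.
    have hpt : ∀ s ∈ Icc 0 c.T, ccn N (c.γ s) ≤ L := fun s hs => by
      have h := c.ccEDist_le_setLIntegral le_rfl hs.1 hs.2 N
      rw [c.source, ccEDist_eq, inv_one, one_mul] at h
      refine (ENNReal.ofReal_le_ofReal_iff hL0).1 (h.trans (le_trans ?_ hc.le))
      exact lintegral_mono_set (Ioc_subset_Ioc_right hs.2)
    have cz : ContinuousOn (fun t => (c.γ t).z) (Icc 0 c.T) := c.continuousOn.snd.snd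
    have h := c.abs_sub_le N hfin (C := R * L * R) (by positivity) (fun t => (c.γ t).z)
      (fun s => ((c.γ s).x * (c.vel s).2 - (c.γ s).y * (c.vel s).1) / 2) hmem cz
      (fun s hs => (c.hasDerivAt s hs).snd.snd) (fun s hs => by
        have hs' : s ∈ Icc 0 c.T := ⟨hs.1.le, hs.2⟩
        have hN : N.nm (c.γ s).pr ≤ L := (nm_pr_le_ccn N _).trans (hpt s hs')
        have e1 : |(c.γ s).x * (c.vel s).2| ≤ R * L * (R * N.nm (c.vel s)) := by
          rw [abs_mul]
          exact mul_le_mul ((hR (c.γ s).pr).1.trans (by gcongr)) (hR _).2 (abs_nonneg _)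
            (by positivity)
        have e2 : |(c.γ s).y * (c.vel s).1| ≤ R * L * (R * N.nm (c.vel s)) := by
          rw [abs_mul]
          exact mul_le_mul ((hR (c.γ s).pr).2.trans (by gcongr)) (hR _).1 (abs_nonneg _)
            (by positivity)
        change _ ≤ R * L * R * N.nm (c.vel s)
        rw [abs_le] at e1 e2 ⊢
        constructor <;> linarith [e1.1, e1.2, e2.1, e2.2])
    simp only [c.source, c.target, one_z, sub_zero] at h
    calc |q.z| ≤ R * L * R * (c.length N).toReal := h
      _ ≤ R * L * R * L := by gcongr
      _ = (R * L) ^ 2 := by ring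

/-- Dilations scale the centre quadratically; inversion takes care of the sign. -/
theorem ccn_vert (c : ℝ) : ccn N (vert c) = √|c| * ccn N (vert 1) := by
  rcases le_total 0 c with h | h
  · rw [abs_of_nonneg h, ← ccn_dil N (Real.sqrt_nonneg c)]
    congr 1
    ext <;> simp [Real.mul_self_sqrt h]
  · rw [abs_of_nonpos h, ← ccn_dil N (Real.sqrt_nonneg _), ← ccn_inv]
    congr 1
    ext <;> simp [Real.mul_self_sqrt (neg_nonneg.2 h)]

theorem ccn_le_nm_add (q : Heis) : ccn N q ≤ N.nm q.pr + √|q.z| * ccn N (vert 1) := by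
  conv_lhs => rw [← hexp_mul_vert q]
  refine (ccn_mul_le N _ _).trans ?_
  rw [ccn_vert]
  gcongr
  exact ccn_hexp_le N _

theorem abs_ccn_sub_le (p q : Heis) : |ccn N p - ccn N q| ≤ ccn N (p⁻¹ * q) := by
  have h1 := ccn_mul_le N p (p⁻¹ * q)
  have h2 := ccn_mul_le N q (p⁻¹ * q)⁻¹
  rw [ccn_inv] at h2
  simp only [mul_inv_cancel_left, mul_inv_rev, inv_inv] at h1 h2
  rw [abs_le]
  constructor <;> linarith

-- Continuity for the Euclidean topology: the bound of `ccn_le_nm_add` at `p⁻¹ * q` tends to zero as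
-- `q → p`.
@[fun_prop]
theorem continuous_ccn : Continuous (ccn N) := by
  rw [continuous_iff_continuousAt]
  intro p
  have h : Tendsto (fun q => N.nm (p⁻¹ * q).pr + √|(p⁻¹ * q).z| * ccn N (vert 1)) (𝓝 p) (𝓝 0) := by
    have : Continuous (fun q => N.nm (p⁻¹ * q).pr + √|(p⁻¹ * q).z| * ccn N (vert 1)) := by fun_prop
    simpa [pr_one, N.nm_zero] using this.tendsto p
  refine tendsto_iff_dist_tendsto_zero.2 (squeeze_zero (fun _ => dist_nonneg) (fun q => ?_) h)
  rw [dist_comm, Real.dist_eq]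
  exact (abs_ccn_sub_le N p q).trans (ccn_le_nm_add N _)

theorem isCompact_ccn_le (r : ℝ) : IsCompact {q : Heis | ccn N q ≤ r} := by
  obtain ⟨R, hR, -, hb⟩ := exists_coord_bound N
  refine Metric.isCompact_of_isClosed_isBounded
    (isClosed_le (continuous_ccn N) continuous_const) ?_
  refine (Metric.isBounded_closedBall (x := (1 : Heis)) (r := R * r + (R * r) ^ 2)).subset
    fun q hq => ?_
  have h0 : 0 ≤ r := (ccn_nonneg N q).trans hq
  have h1 : R * ccn N q ≤ R * r := by gcongr; exact hq
  have h2 : (R * ccn N q) ^ 2 ≤ (R * r) ^ 2 := by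
    have := ccn_nonneg N q
    gcongr
  obtain ⟨hx, hy, hz⟩ := hb q
  have h3 : 0 ≤ R * r := by positivity
  have h4 := sq_nonneg (R * r)
  rw [Metric.mem_closedBall, dist_le_iff]
  simp only [one_x, one_y, one_z, sub_zero]
  exact ⟨by linarith, by linarith, by linarith⟩

end ccn

/-! ### Points on geodesics -/

section splitting

variable (N : RationalPolygonalNorm)

theorem AdmissibleCurve.continuousOn_heis {p q : Heis} (c : AdmissibleCurve p q) :
    ContinuousOn c.γ (Icc 0 c.T) :=
  isometry_coords.isEmbedding.isInducing.continuousOn_iff.2 c.continuousOn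

theorem ccn_inv_mul_le_setLIntegral {p q : Heis} (c : AdmissibleCurve p q) {s t : ℝ} (hs : 0 ≤ s)
    (hst : s ≤ t) (ht : t ≤ c.T) :
    ENNReal.ofReal (ccn N ((c.γ s)⁻¹ * c.γ t)) ≤
      ∫⁻ r in Ioc s t, ENNReal.ofReal (N.toSeminorm (c.vel r)) := by
  rw [← ccEDist_eq]
  exact c.ccEDist_le_setLIntegral hs hst ht N

theorem AdmissibleCurve.length_eq_add {p q : Heis} (c : AdmissibleCurve p q) {t : ℝ} (h0 : 0 ≤ t)
    (ht : t ≤ c.T) : c.length N = (∫⁻ r in Ioc 0 t, ENNReal.ofReal (N.toSeminorm (c.vel r))) +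
      ∫⁻ r in Ioc t c.T, ENNReal.ofReal (N.toSeminorm (c.vel r)) := by
  unfold AdmissibleCurve.length
  rw [← Ioc_union_Ioc_eq_Ioc h0 ht,
    lintegral_union measurableSet_Ioc (Ioc_disjoint_Ioc_of_le le_rfl)]

theorem ccn_add_ccn_le_of_length_le {p q : Heis} (c : AdmissibleCurve p q) {L : ℝ} (hL : 0 ≤ L)
    (hc : c.length N ≤ ENNReal.ofReal L) {t : ℝ} (ht : t ∈ Icc 0 c.T) :
    ccn N (p⁻¹ * c.γ t) + ccn N ((c.γ t)⁻¹ * q) ≤ L := by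
  have h1 := ccn_inv_mul_le_setLIntegral N c le_rfl ht.1 ht.2
  have h2 := ccn_inv_mul_le_setLIntegral N c ht.1 ht.2 le_rfl
  rw [c.source] at h1
  rw [c.target] at h2
  rw [c.length_eq_add N ht.1 ht.2] at hc
  have h := (add_le_add h1 h2).trans hc
  rw [← ENNReal.ofReal_add (ccn_nonneg N _) (ccn_nonneg N _)] at h
  exact (ENNReal.ofReal_le_ofReal_iff hL).1 h

/-- The intermediate value theorem on an almost shortest curve finds a point at distance exactly
`a`. -/
theorem exists_approx_split {q : Heis} {a b η : ℝ} (ha : 0 ≤ a) (hb : 0 ≤ b) (hη : 0 < η)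
    (h : ccn N q ≤ a + b) : ∃ g, ccn N g ≤ a ∧ ccn N (g⁻¹ * q) ≤ b + η := by
  rcases le_or_gt (ccn N q) a with hq | hq
  · refine ⟨q, hq, ?_⟩
    rw [inv_mul_cancel, ccn_one]
    positivity
  obtain ⟨c, hc⟩ := exists_curve_lt N (p := 1) (q := q) (L := a + b + η)
    (by simpa using h.trans_lt (by linarith))
  have hcont : ContinuousOn (fun t => ccn N (c.γ t)) (Icc 0 c.T) :=
    (continuous_ccn N).comp_continuousOn c.continuousOn_heis
  obtain ⟨t, ht, hta⟩ := intermediate_value_Icc c.T_nonneg hcont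
    (show a ∈ Icc (ccn N (c.γ 0)) (ccn N (c.γ c.T)) by
      rw [c.source, c.target, ccn_one]
      exact ⟨ha, hq.le⟩)
  have h3 := ccn_add_ccn_le_of_length_le N c (by positivity) hc.le ht
  simp only [inv_one, one_mul] at h3 hta
  exact ⟨c.γ t, hta.le, by linarith⟩

/-- Points can be found on geodesics at prescribed distances from the end points. -/
theorem exists_split {q : Heis} {a b : ℝ} (ha : 0 ≤ a) (hb : 0 ≤ b) (h : ccn N q ≤ a + b) :
    ∃ g, ccn N g ≤ a ∧ ccn N (g⁻¹ * q) ≤ b := by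
  -- Minimising over the compact ball of radius `a` removes the error `η`, without any existence
  -- theorem for geodesics.
  obtain ⟨g, hg, hmin⟩ := (isCompact_ccn_le N a).exists_isMinOn ⟨1, by simpa [ccn_one] using ha⟩
    (f := fun g => ccn N (g⁻¹ * q)) (Continuous.continuousOn (by fun_prop))
  refine ⟨g, hg, le_of_forall_pos_le_add fun η hη => ?_⟩
  obtain ⟨g', hg', h'⟩ := exists_approx_split N ha hb hη h
  exact (hmin hg').trans h'

/-- A discrete geodesic with steps of length `τ`. -/
theorem exists_chain (τ : ℝ) (hτ : 0 ≤ τ) (K : ℕ) : ∀ q, ccn N q ≤ K * τ →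
    ∃ g : ℕ → Heis, g 0 = 1 ∧ g K = q ∧ ∀ i, i < K → ccn N ((g i)⁻¹ * g (i + 1)) ≤ τ := by
  induction K with
  | zero =>
    intro q hq
    have : ccn N q = 0 := le_antisymm (by simpa using hq) (ccn_nonneg N q)
    exact ⟨fun _ => 1, rfl, (ccn_eq_zero N this).symm, fun i hi => absurd hi (by simp)⟩
  | succ K ih =>
    intro q hq
    obtain ⟨m, hm, hmq⟩ := exists_split N (a := K * τ) (b := τ) (by positivity) hτ
      (by push_cast at hq; linarith)
    obtain ⟨g, h0, hK, hg⟩ := ih m hm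
    refine ⟨fun i => if i ≤ K then g i else q, by simp [h0], by simp, fun i hi => ?_⟩
    rcases (Nat.lt_succ_iff.1 hi).eq_or_lt with rfl | h
    · simpa [hK] using hmq
    · simpa [h.le, Nat.succ_le_of_lt h] using hg i h

/-- The point `g` lies on a geodesic from the identity to `q`. -/
def IsBetween (g q : Heis) : Prop := ccn N g + ccn N (g⁻¹ * q) ≤ ccn N q

theorem isBetween_one (q : Heis) : IsBetween N 1 q := by simp [IsBetween, ccn_one]

theorem isBetween_self (q : Heis) : IsBetween N q q := by simp [IsBetween, ccn_one]

/-- The `K` steps of the chain together have no slack over `ccn N q`, so the triangle inequality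
from both ends forces every vertex onto a geodesic. -/
theorem exists_geodesic_chain (q : Heis) {K : ℕ} (hK : 0 < K) :
    ∃ g : ℕ → Heis, g 0 = 1 ∧ g K = q ∧ (∀ i, i < K → ccn N ((g i)⁻¹ * g (i + 1)) ≤ ccn N q / K) ∧
      ∀ i, i ≤ K → IsBetween N (g i) q := by
  have hK' : (0 : ℝ) < K := by exact_mod_cast hK
  obtain ⟨g, h0, hgK, hg⟩ := exists_chain N (ccn N q / K) (div_nonneg (ccn_nonneg N q) hK'.le) K q
    (by rw [mul_div_cancel₀ _ hK'.ne'])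
  refine ⟨g, h0, hgK, hg, fun i hi => ?_⟩
  have h1 : ∀ i, i ≤ K → ccn N (g i) ≤ i * (ccn N q / K) := by
    intro i
    induction i with
    | zero => intro _; simp [h0, ccn_one]
    | succ i ih =>
      intro hi
      have h2 := ccn_mul_le N (g i) ((g i)⁻¹ * g (i + 1))
      rw [mul_inv_cancel_left] at h2
      have h3 := ih (Nat.le_of_succ_le hi)
      have h4 := hg i hi
      push_cast
      linarith
  have h2 : ∀ j, ∀ i, i + j = K → ccn N ((g i)⁻¹ * q) ≤ j * (ccn N q / K) := by
    intro j
    induction j with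
    | zero =>
      intro i hi
      obtain rfl : i = K := by omega
      simp [hgK, ccn_one]
    | succ j ih =>
      intro i hi
      have h2 := ccn_mul_le N ((g i)⁻¹ * g (i + 1)) ((g (i + 1))⁻¹ * q)
      rw [mul_assoc, mul_inv_cancel_left] at h2
      have h3 := ih (i + 1) (by omega)
      have h4 := hg i (by omega)
      push_cast
      linarith
  have h3 := h2 (K - i) i (by omega)
  have h4 := h1 i hi
  rw [Nat.cast_sub hi] at h3
  have h5 : (K : ℝ) * (ccn N q / K) = ccn N q := mul_div_cancel₀ _ hK'.ne'
  unfold IsBetween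
  linarith

end splitting

/-! ### The area form -/

section wedge

theorem wedge_decomp {v w : ℝ × ℝ} (h : wedge v w ≠ 0) (u : ℝ × ℝ) :
    u = (wedge u w / wedge v w) • v + (wedge v u / wedge v w) • w := by
  ext
  · simp only [Prod.fst_add, Prod.smul_fst, smul_eq_mul]
    field_simp
    simp only [wedge]
    ring
  · simp only [Prod.snd_add, Prod.smul_snd, smul_eq_mul]
    field_simp
    simp only [wedge]
    ring

theorem dot_add (p u w : ℝ × ℝ) : dot p (u + w) = dot p u + dot p w := by
  simp [dot]; ring
theorem dot_sub (p u w : ℝ × ℝ) : dot p (u - w) = dot p u - dot p w := by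
  simp [dot]; ring
theorem dot_neg (p w : ℝ × ℝ) : dot p (-w) = -dot p w := by
  simp [dot]; ring
theorem dot_smul (p : ℝ × ℝ) (s : ℝ) (w : ℝ × ℝ) : dot p (s • w) = s * dot p w := by
  simp [dot]; ring
theorem wedge_sub (p u w : ℝ × ℝ) : wedge p (u - w) = wedge p u - wedge p w := by
  simp [wedge]; ring
theorem wedge_add_left (p u w : ℝ × ℝ) : wedge (p + u) w = wedge p w + wedge u w := by
  simp [wedge]; ring
theorem wedge_neg (p w : ℝ × ℝ) : wedge p (-w) = -wedge p w := by
  simp [wedge]; ring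
theorem wedge_smul (p : ℝ × ℝ) (s : ℝ) (w : ℝ × ℝ) : wedge p (s • w) = s * wedge p w := by
  simp [wedge]; ring
theorem wedge_swap (p w : ℝ × ℝ) : wedge p w = -wedge w p := by
  simp only [wedge]; ring
theorem wedge_self (p : ℝ × ℝ) : wedge p p = 0 := by
  simp [wedge]; ring

theorem exists_wedge_bound (N : RationalPolygonalNorm) :
    ∃ L : ℝ, 0 < L ∧ ∀ a b : ℝ × ℝ, |wedge a b| ≤ L * (N.nm a * N.nm b) := by
  obtain ⟨R, hR, hb, -⟩ := exists_coord_bound N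
  refine ⟨2 * R ^ 2, by positivity, fun a b => ?_⟩
  have h1 : |a.1 * b.2| ≤ R * N.nm a * (R * N.nm b) := by
    rw [abs_mul]
    exact mul_le_mul (hb a).1 (hb b).2 (abs_nonneg _) (mul_nonneg hR.le (N.nm_nonneg a))
  have h2 : |a.2 * b.1| ≤ R * N.nm a * (R * N.nm b) := by
    rw [abs_mul]
    exact mul_le_mul (hb a).2 (hb b).1 (abs_nonneg _) (mul_nonneg hR.le (N.nm_nonneg a))
  unfold wedge
  rw [abs_le] at h1 h2 ⊢
  constructor <;> nlinarith

end wedge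

/-! ### Proximal subgradients: first variation, Euler identity, eikonal inequality -/

section subgradient

variable (N : RationalPolygonalNorm)

/-- `(p, ξ)` is a proximal subgradient of the CC norm at `q`, in the left-invariant frame. -/
def IsSubgrad (q : Heis) (p : ℝ × ℝ) (ξ : ℝ) : Prop :=
  ∃ C : ℝ, ∀ (w : ℝ × ℝ) (ζ : ℝ), ccn N q + dot p w + ξ * ζ - C * (w.1 ^ 2 + w.2 ^ 2 + ζ ^ 2) ≤
    ccn N (q * ⟨w.1, w.2, ζ⟩)

theorem le_of_eventually_right {a d : ℝ} {f : ℝ → ℝ} (hf : Continuous f)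
    (h : ∀ᶠ t in 𝓝[>] d, a ≤ f t) : a ≤ f d :=
  ge_of_tendsto ((hf.tendsto d).mono_left nhdsWithin_le_nhds) h

variable {N}

/-- To first order in `t` only the linear part of the subgradient inequality remains: the quadratic
term and the central deviation `t ^ 2 * e` vanish after division by `t`. -/
theorem IsSubgrad.le_of_curve {q : Heis} {p : ℝ × ℝ} {ξ : ℝ} (h : IsSubgrad N q p ξ)
    {w : ℝ × ℝ} {ζ e A : ℝ} (hA : ∀ t ∈ Ioo (0 : ℝ) 1,
      ccn N (q * ⟨t * w.1, t * w.2, t * ζ + t ^ 2 * e⟩) ≤ ccn N q + t * A) :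
    dot p w + ξ * ζ ≤ A := by
  obtain ⟨C, hC⟩ := h
  have key := le_of_eventually_right (a := dot p w + ξ * ζ - A) (d := 0)
      (f := fun t => t * (-(ξ * e) + C * (w.1 ^ 2 + w.2 ^ 2 + (ζ + t * e) ^ 2))) (by fun_prop) <| by
    filter_upwards [Ioo_mem_nhdsGT (show (0 : ℝ) < 1 by norm_num)] with t ht
    have h1 := (hC (t * w.1, t * w.2) (t * ζ + t ^ 2 * e)).trans (hA t ht)
    have h2 : t * (dot p w + ξ * ζ - A) ≤
        t * (t * (-(ξ * e) + C * (w.1 ^ 2 + w.2 ^ 2 + (ζ + t * e) ^ 2))) := by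
      simp only [dot] at h1 ⊢
      linarith
    exact le_of_mul_le_mul_left h2 ht.1
  simp only [zero_mul] at key
  linarith

/-- Conjugation by `g⁻¹ * q` moves a segment inserted at `g` to the end point, where it acquires a
central part. The summand `t ^ 2 * 0` matches the shape required by `IsSubgrad.le_of_curve`. -/
theorem mul_hexp_mul_eq (q g : Heis) (w : ℝ × ℝ) (t : ℝ) : g * hexp (t • w) * (g⁻¹ * q) =
    q * ⟨t * w.1, t * w.2, t * wedge w (q.pr - g.pr) + t ^ 2 * 0⟩ := by
  ext <;> simp [wedge] <;> ring

/-- First variation: inserting the segment `t • w` into a geodesic at `g` costs at most `t * N.nm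
w`. -/
theorem IsSubgrad.insert {q : Heis} {p : ℝ × ℝ} {ξ : ℝ} (h : IsSubgrad N q p ξ) {g : Heis}
    (hg : IsBetween N g q) (w : ℝ × ℝ) : dot p w + ξ * wedge w (q.pr - g.pr) ≤ N.nm w := by
  refine h.le_of_curve (e := 0) fun t ht => ?_
  rw [← mul_hexp_mul_eq]
  have h1 := ccn_mul_le N (g * hexp (t • w)) (g⁻¹ * q)
  have h2 := ccn_mul_le N g (hexp (t • w))
  have h3 := ccn_hexp_le N (t • w)
  rw [N.nm_smul_of_nonneg ht.1.le] at h3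
  unfold IsBetween at hg
  linarith

theorem IsSubgrad.dot_le {q : Heis} {p : ℝ × ℝ} {ξ : ℝ} (h : IsSubgrad N q p ξ) (w : ℝ × ℝ) :
    dot p w ≤ N.nm w := by
  simpa [wedge] using h.insert (isBetween_self N q) w

theorem IsSubgrad.dot_sub_wedge_le {q : Heis} {p : ℝ × ℝ} {ξ : ℝ} (h : IsSubgrad N q p ξ)
    (w : ℝ × ℝ) : dot p w - ξ * wedge q.pr w ≤ N.nm w := by
  have h1 := h.insert (isBetween_one N q) w
  rw [pr_one, sub_zero, wedge_swap] at h1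
  linarith

/-- Homogeneity under dilations: the curves `dil (1 ± t) q` leave `q` with central speed `±2 * q.z`,
and each gives one inequality. -/
theorem IsSubgrad.euler {q : Heis} {p : ℝ × ℝ} {ξ : ℝ} (h : IsSubgrad N q p ξ) :
    dot p q.pr + 2 * q.z * ξ = ccn N q := by
  have h1 : dot p q.pr + ξ * (2 * q.z) ≤ ccn N q := by
    refine h.le_of_curve (e := q.z) fun t ht => ?_
    have : q * ⟨t * q.pr.1, t * q.pr.2, t * (2 * q.z) + t ^ 2 * q.z⟩ = dil (1 + t) q := by
      ext <;> simp <;> ring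
    rw [this, ccn_dil N (by linarith [ht.1])]
    linarith
  have h2 : dot p (-q.pr) + ξ * (-(2 * q.z)) ≤ -ccn N q := by
    refine h.le_of_curve (e := q.z) fun t ht => ?_
    have : q * ⟨t * (-q.pr).1, t * (-q.pr).2, t * (-(2 * q.z)) + t ^ 2 * q.z⟩ = dil (1 - t) q := by
      ext <;> simp <;> ring
    rw [this, ccn_dil N (by linarith [ht.2])]
    linarith
  rw [dot_neg] at h2
  linarith

variable (N) in
theorem isCompact_nm_le (r : ℝ) : IsCompact {u : ℝ × ℝ | N.nm u ≤ r} := by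
  obtain ⟨R, hR, hb, -⟩ := exists_coord_bound N
  refine Metric.isCompact_of_isClosed_isBounded (isClosed_le N.continuous_nm continuous_const) ?_
  refine (Metric.isBounded_closedBall (x := (0 : ℝ × ℝ)) (r := R * r)).subset fun u hu => ?_
  rw [mem_closedBall_zero_iff, Prod.norm_def]
  refine max_le ((hb u).1.trans ?_) ((hb u).2.trans ?_) <;> exact mul_le_mul_of_nonneg_left hu hR.le

theorem continuous_dot : Continuous fun x : (ℝ × ℝ) × (ℝ × ℝ) => dot x.1 x.2 := by
  unfold dot
  fun_prop

theorem continuous_wedge : Continuous fun x : (ℝ × ℝ) × (ℝ × ℝ) => wedge x.1 x.2 := by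
  unfold wedge
  fun_prop

variable (N) in
theorem isCompact_dual_ball : IsCompact {p : ℝ × ℝ | ∀ w, dot p w ≤ N.nm w} := by
  refine Metric.isCompact_of_isClosed_isBounded ?_ ?_
  · rw [ofPred_forall]
    refine isClosed_iInter fun w => isClosed_le ?_ continuous_const
    exact continuous_dot.comp (continuous_id.prodMk continuous_const)
  refine (Metric.isBounded_closedBall (x := (0 : ℝ × ℝ))
    (r := max (N.nm (1, 0)) (N.nm (0, 1)))).subset fun p hp => ?_
  have h1 := dot_abs_le hp (1, 0)
  have h2 := dot_abs_le hp (0, 1)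
  simp only [dot, mul_one, mul_zero, add_zero, zero_add] at h1 h2
  rw [mem_closedBall_zero_iff, Prod.norm_def]
  exact max_le_max h1 h2

/-- Stepping back by `τ` along a geodesic lowers the CC norm by `τ`, with a horizontal displacement
of norm at most `τ` and a central one of order `τ ^ 2`. As `τ → 0`, the maximum of `p` on the unit
ball, attained at `u`, is at least one. -/
theorem IsSubgrad.exists_eikonal {q : Heis} {p : ℝ × ℝ} {ξ : ℝ} (h : IsSubgrad N q p ξ)
    (hq : 0 < ccn N q) : ∃ u, N.nm u ≤ 1 ∧ 1 ≤ dot p u := by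
  obtain ⟨u, hu, hmax⟩ := (isCompact_nm_le N 1).exists_isMaxOn ⟨0, by simp [N.nm_zero]⟩
    (f := fun u => dot p u)
    (continuous_dot.comp (continuous_const.prodMk continuous_id)).continuousOn
  refine ⟨u, hu, ?_⟩
  obtain ⟨C, hC⟩ := h
  obtain ⟨R, hR, -, hb⟩ := exists_coord_bound N
  have key := le_of_eventually_right (a := 1) (d := 0) (f := fun τ : ℝ => dot p u + τ *
      (|ξ| * R ^ 2 + |C| * (R ^ 2 + R ^ 2 + R ^ 4 * τ ^ 2))) (by fun_prop) <| by
    filter_upwards [Ioo_mem_nhdsGT hq] with τ hτ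
    obtain ⟨g, hg, hgq⟩ := exists_split N (q := q) (a := ccn N q - τ) (b := τ)
      (by linarith [hτ.2]) hτ.1.le (by linarith)
    set k := g⁻¹ * q with hk
    have h1 := hC (-k.x, -k.y) (-k.z)
    have hqk : q * ⟨-k.x, -k.y, -k.z⟩ = g := by
      change q * k⁻¹ = g
      rw [hk]
      group
    simp only [hqk] at h1
    obtain ⟨b1, b2, b3⟩ := hb k
    have hτ0 := hτ.1
    have hk0 := ccn_nonneg N k
    have b1' : |k.x| ≤ R * τ := b1.trans (by gcongr)
    have b2' : |k.y| ≤ R * τ := b2.trans (by gcongr)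
    have b3' : |k.z| ≤ (R * τ) ^ 2 := b3.trans (by gcongr)
    have h2 : dot p (τ⁻¹ • k.pr) ≤ dot p u := hmax (by
      change N.nm _ ≤ 1
      rw [N.nm_smul_of_nonneg (by positivity), inv_mul_le_iff₀ hτ0, mul_one]
      exact (nm_pr_le_ccn N k).trans hgq)
    rw [dot_smul, inv_mul_le_iff₀ hτ0] at h2
    have h3 : |ξ * k.z| ≤ |ξ| * (R * τ) ^ 2 := by
      rw [abs_mul]
      gcongr
    have h4 : C * (k.x ^ 2 + k.y ^ 2 + k.z ^ 2) ≤
        |C| * ((R * τ) ^ 2 + (R * τ) ^ 2 + ((R * τ) ^ 2) ^ 2) := by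
      refine mul_le_mul (le_abs_self C) ?_ (by positivity) (abs_nonneg C)
      have := sq_le_sq' (abs_le.1 b1').1 (abs_le.1 b1').2
      have := sq_le_sq' (abs_le.1 b2').1 (abs_le.1 b2').2
      have := sq_le_sq' (abs_le.1 b3').1 (abs_le.1 b3').2
      linarith
    have h5 : dot p (-k.x, -k.y) = -dot p k.pr := by
      simp [dot]
      ring
    have h6 := (abs_le.1 h3).2
    rw [h5] at h1
    refine le_of_mul_le_mul_left ?_ hτ0
    have e1 : (-k.x) ^ 2 + (-k.y) ^ 2 + (-k.z) ^ 2 = k.x ^ 2 + k.y ^ 2 + k.z ^ 2 := by ring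
    simp only [e1] at h1
    have e2 : τ * (dot p u + τ * (|ξ| * R ^ 2 + |C| * (R ^ 2 + R ^ 2 + R ^ 4 * τ ^ 2))) =
        τ * dot p u + |ξ| * (R * τ) ^ 2 +
          |C| * ((R * τ) ^ 2 + (R * τ) ^ 2 + ((R * τ) ^ 2) ^ 2) := by ring
    rw [e2, mul_one]
    linarith
  simpa using key

/-- If raising a point does not increase the CC norm, the point is reached by a straight line
in the plane. -/
theorem ccn_le_nm_of_vert {q : Heis} (hz : 0 < q.z) {s : ℝ} (hs : 0 < s)
    (h : ccn N (q * vert s) ≤ ccn N q) : ccn N q ≤ N.nm q.pr := by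
  set r := √(q.z / (q.z + s)) with hr
  have hzs : 0 < q.z + s := by linarith
  have hr0 : 0 ≤ r := Real.sqrt_nonneg _
  have hr2 : r * r = q.z / (q.z + s) := Real.mul_self_sqrt (by positivity)
  have hr1 : r < 1 := by
    rw [hr, Real.sqrt_lt' one_pos, div_lt_iff₀ hzs]
    linarith
  -- The factor `r` brings the raised point back to height `q.z` over `r • q.pr`; a horizontal
  -- segment completes the way to `q`.
  have hq : q = dil r (q * vert s) * hexp ((1 - r) • q.pr) := by
    ext
    · simp; ring
    · simp; ring
    · simp only [mul_z, dil_z, hexp_z, vert_z, dil_x, dil_y, mul_x, mul_y, vert_x, vert_y,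
        hexp_x, hexp_y, Prod.smul_fst, Prod.smul_snd, pr_fst, pr_snd, smul_eq_mul, hr2]
      field_simp
      ring
  have h1 := ccn_mul_le N (dil r (q * vert s)) (hexp ((1 - r) • q.pr))
  rw [← hq, ccn_dil N hr0] at h1
  have h2 := ccn_hexp_le N ((1 - r) • q.pr)
  rw [N.nm_smul_of_nonneg (by linarith)] at h2
  have h3 : r * ccn N (q * vert s) ≤ r * ccn N q := by gcongr
  have h4 : (1 - r) * ccn N q ≤ (1 - r) * N.nm q.pr := by linarith
  exact le_of_mul_le_mul_left h4 (by linarith)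

/-- Geodesics to points above the plane stay on one side of the chord. -/
theorem IsBetween.wedge_nonneg {q g : Heis} (hg : IsBetween N g q) (hz : 0 < q.z)
    (hq : N.nm q.pr < ccn N q) : 0 ≤ wedge g.pr q.pr := by
  by_contra! hneg
  -- Traversing the two pieces of the geodesic in the opposite order keeps the length and shifts the
  -- end point vertically, upwards if `g` lies on the wrong side of the chord.
  have h1 : g⁻¹ * q * g = q * vert (wedge q.pr g.pr) := by
    ext <;> simp [wedge]; ring
  have h2 := ccn_mul_le N (g⁻¹ * q) g
  rw [h1] at h2
  unfold IsBetween at hg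
  refine hq.not_ge (ccn_le_nm_of_vert hz (s := wedge q.pr g.pr) ?_ (by linarith))
  rw [wedge_swap]
  linarith

end subgradient

/-! ### Area estimates for discrete geodesics -/

section area

/-- A sequence with small steps that climbs from `0` to `D` spends some time away from the
end points of `[0, D]`. -/
theorem sum_middle_ge {y : ℕ → ℝ} {D δ : ℝ} {K j : ℕ} (hjK : j ≤ K) (h0 : y 0 = 0)
    (hj : y j = D) (hy : ∀ i ≤ K, 0 ≤ y i ∧ y i ≤ D) (hδ : ∀ i < K, |y (i + 1) - y i| ≤ δ)
    (hδ0 : 0 ≤ δ) :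
    2 / 3 * D ^ 3 - K * δ ^ 3 / 3 ≤
      ∑ i ∈ Finset.range K, δ * (2 * D) * (D - |y i + y (i + 1) - D|) := by
  have hD : 0 ≤ D := (hy 0 (Nat.zero_le K)).1.trans (hy 0 (Nat.zero_le K)).2
  have hnn : ∀ i < K, 0 ≤ D - |y i + y (i + 1) - D| := fun i hi => by
    have h1 := hy i hi.le
    have h2 := hy (i + 1) hi
    rw [sub_nonneg, abs_le]
    constructor <;> linarith
  have hsub : ∑ i ∈ Finset.range j, δ * (2 * D) * (D - |y i + y (i + 1) - D|) ≤
      ∑ i ∈ Finset.range K, δ * (2 * D) * (D - |y i + y (i + 1) - D|) := by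
    refine Finset.sum_le_sum_of_subset_of_nonneg (Finset.range_mono hjK) fun i hi _ => ?_
    exact mul_nonneg (by positivity) (hnn i (Finset.mem_range.1 hi))
  refine le_trans ?_ hsub
  -- The summands are compared with the increments of a primitive of `4 * y * (D - y)`, which
  -- telescope up to the index `j` of the maximum.
  have htel : ∑ i ∈ Finset.range j, ((2 * D * y (i + 1) ^ 2 - 4 / 3 * y (i + 1) ^ 3) -
      (2 * D * y i ^ 2 - 4 / 3 * y i ^ 3)) = 2 / 3 * D ^ 3 := by
    rw [Finset.sum_range_sub (fun i => 2 * D * y i ^ 2 - 4 / 3 * y i ^ 3), h0, hj]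
    ring
  have hjδ : ∑ i ∈ Finset.range j, δ ^ 3 / 3 ≤ K * δ ^ 3 / 3 := by
    rw [Finset.sum_const, Finset.card_range, nsmul_eq_mul, mul_div_assoc]
    gcongr
  have hterm : ∀ i ∈ Finset.range j, ((2 * D * y (i + 1) ^ 2 - 4 / 3 * y (i + 1) ^ 3) -
      (2 * D * y i ^ 2 - 4 / 3 * y i ^ 3)) - δ ^ 3 / 3 ≤
      δ * (2 * D) * (D - |y i + y (i + 1) - D|) := by
    intro i hi
    have hiK : i < K := (Finset.mem_range.1 hi).trans_le hjK
    have h1 := hy i hiK.le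
    have h2 := hy (i + 1) hiK
    have h3 := hδ i hiK
    set m := y i + y (i + 1) with hm
    set Δ := y (i + 1) - y i with hΔ
    -- The midpoint rule for the cubic primitive, with its exact error.
    have e1 : (2 * D * y (i + 1) ^ 2 - 4 / 3 * y (i + 1) ^ 3) -
        (2 * D * y i ^ 2 - 4 / 3 * y i ^ 3) = Δ * (m * (2 * D - m)) - Δ ^ 3 / 3 := by
      rw [hm, hΔ]
      ring
    have hm0 : 0 ≤ m := by linarith
    have hm2 : 0 ≤ 2 * D - m := by linarith
    have e2 : m * (2 * D - m) ≤ 2 * D * (D - |m - D|) := by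
      rcases abs_cases (m - D) with ⟨h, _⟩ | ⟨h, _⟩ <;> rw [h] <;> nlinarith
    have e3 : Δ * (m * (2 * D - m)) ≤ δ * (2 * D * (D - |m - D|)) := by
      refine (mul_le_mul_of_nonneg_right ((le_abs_self Δ).trans h3) (mul_nonneg hm0 hm2)).trans ?_
      gcongr
    have e4 : -Δ ^ 3 ≤ δ ^ 3 := by
      have h4 : -Δ ≤ δ := (neg_le_abs Δ).trans h3
      have h5 : -Δ ^ 3 = (-Δ) ^ 3 := by ring
      rw [h5]
      rcases le_total 0 (-Δ) with h6 | h6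
      · gcongr
      · have h7 : (-Δ) ^ 3 ≤ 0 := by
          have : (-Δ) ^ 3 = (-Δ) * (-Δ) ^ 2 := by ring
          rw [this]
          exact mul_nonpos_of_nonpos_of_nonneg h6 (sq_nonneg _)
        exact h7.trans (by positivity)
    rw [e1]
    linarith
  have hsum := Finset.sum_le_sum hterm
  rw [Finset.sum_sub_distrib, htel] at hsum
  linarith

variable (N : RationalPolygonalNorm)

/-- The constants in the estimates below. -/
def IsAreaBound (L E : ℝ) : Prop := 0 < L ∧ 0 < E ∧
  (∀ a b : ℝ × ℝ, |wedge a b| ≤ L * (N.nm a * N.nm b)) ∧ ∀ q : Heis, 2 * |q.z| ≤ E * ccn N q ^ 2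

theorem exists_isAreaBound : ∃ L E, IsAreaBound N L E := by
  obtain ⟨L, hL, h⟩ := exists_wedge_bound N
  obtain ⟨R, hR, -, hb⟩ := exists_coord_bound N
  refine ⟨L, 2 * R ^ 2, hL, by positivity, h, fun q => ?_⟩
  have := (hb q).2.2
  rw [mul_pow] at this
  linarith

variable {N}

/-- The heights of a discrete geodesic over its chord, and the area it encloses. -/
theorem exists_chain_heights {L E : ℝ} (hLE : IsAreaBound N L E) {q : Heis} (hv : q.pr ≠ 0)
    {K : ℕ} (hK : 0 < K) : ∃ y α : ℕ → ℝ, y 0 = 0 ∧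
      (∀ i ≤ K, ∃ g, IsBetween N g q ∧ y i = wedge g.pr q.pr / N.nm q.pr) ∧
      (∀ i < K, |y (i + 1) - y i| ≤ L * (ccn N q / K)) ∧ (∀ i < K, |α i| ≤ ccn N q / K) ∧
      ∑ i ∈ Finset.range K, α i = N.nm q.pr ∧
      2 * q.z ≤ ∑ i ∈ Finset.range K, α i * (y i + y (i + 1)) + E * ccn N q ^ 2 / K := by
  obtain ⟨hL, hE, hw, hzE⟩ := hLE
  have hρ := N.nm_pos hv
  have hK' : (0 : ℝ) < K := by exact_mod_cast hK
  obtain ⟨φ, hφ, hφv⟩ := N.exists_norming q.pr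
  obtain ⟨g, h0, hgK, hg, hbt⟩ := exists_geodesic_chain N q hK
  set ρ := N.nm q.pr with hρdef
  set τ := ccn N q / K with hτ
  set y : ℕ → ℝ := fun i => wedge (g i).pr q.pr / ρ with hy
  set k : ℕ → Heis := fun i => (g i)⁻¹ * g (i + 1) with hk
  set α : ℕ → ℝ := fun i => dot φ (k i).pr with hα
  have hgs : ∀ i, g (i + 1) = g i * k i := fun i => by simp [hk]
  have hpr : ∀ i, (g (i + 1)).pr = (g i).pr + (k i).pr := fun i => by rw [hgs, pr_mul]
  have hy0 : y 0 = 0 := by simp [hy, h0, wedge]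
  have hyK : y K = 0 := by simp [hy, hgK, wedge_self]
  have hαs : ∀ i, dot φ (g (i + 1)).pr - dot φ (g i).pr = α i := fun i => by
    rw [hpr, dot_add, hα]
    ring
  -- The area form in the coordinates `dot φ` along the chord and `wedge · q.pr / ρ`, the height
  -- over the chord.
  have hid : ∀ A B : ℝ × ℝ, wedge A B = wedge A q.pr / ρ * dot φ B - dot φ A * (wedge B q.pr / ρ) := by
    intro A B
    field_simp
    rw [← hφv]
    simp only [wedge, dot]
    ring
  refine ⟨y, α, hy0, fun i hi => ⟨g i, hbt i hi, rfl⟩, fun i hi => ?_, fun i hi => ?_, ?_, ?_⟩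
  · have : y (i + 1) - y i = wedge (k i).pr q.pr / ρ := by
      simp only [hy]
      rw [hpr, wedge_add_left]
      ring
    rw [this, abs_div, abs_of_pos hρ, div_le_iff₀ hρ]
    refine (hw _ _).trans ?_
    rw [mul_assoc]
    have := (nm_pr_le_ccn N (k i)).trans (hg i hi)
    gcongr
  · exact (dot_pr_le_ccn N hφ _).trans (hg i hi)
  · rw [← hφv, ← Finset.sum_congr rfl fun i _ => hαs i,
      Finset.sum_range_sub (fun i => dot φ (g i).pr), h0, hgK]
    simp [pr_one, dot]
  -- `2 * z` plus the product of the two coordinates telescopes to `2 * q.z`, the height being zero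
  -- at both ends. The increments are trapezoidal areas plus central parts of single steps; each of
  -- the latter is of order `1 / K ^ 2`.
  · have hQ : ∀ i, (2 * (g (i + 1)).z + dot φ (g (i + 1)).pr * y (i + 1)) -
        (2 * (g i).z + dot φ (g i).pr * y i) = 2 * (k i).z + α i * (y i + y (i + 1)) := by
      intro i
      have e1 : (g (i + 1)).z = (g i).z + (k i).z + wedge (g i).pr (k i).pr / 2 := by
        rw [hgs]
        simp [wedge]
      have e2 : wedge (k i).pr q.pr / ρ = y (i + 1) - y i := by
        simp only [hy]
        rw [hpr, wedge_add_left]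
        ring
      rw [e1, hid (g i).pr (k i).pr, e2]
      have e3 := hαs i
      have e4 : dot φ (g (i + 1)).pr = α i + dot φ (g i).pr := by linarith
      rw [e4]
      change _ = 2 * (k i).z + α i * _
      simp only [hy, hα]
      ring
    have hsum : 2 * q.z = ∑ i ∈ Finset.range K, (2 * (k i).z + α i * (y i + y (i + 1))) := by
      rw [← Finset.sum_congr rfl fun i _ => hQ i,
        Finset.sum_range_sub (fun i => 2 * (g i).z + dot φ (g i).pr * y i), hyK, hy0, h0, hgK]
      simp
    rw [hsum, Finset.sum_add_distrib, add_comm]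
    gcongr
    calc ∑ i ∈ Finset.range K, 2 * (k i).z ≤ ∑ i ∈ Finset.range K, E * τ ^ 2 := by
          refine Finset.sum_le_sum fun i hi => ?_
          have h1 := hg i (Finset.mem_range.1 hi)
          have h2 := hzE (k i)
          have h3 := ccn_nonneg N (k i)
          have h4 : E * ccn N (k i) ^ 2 ≤ E * τ ^ 2 := by gcongr
          linarith [le_abs_self (k i).z]
      _ = E * ccn N q ^ 2 / K := by
          rw [Finset.sum_const, Finset.card_range, nsmul_eq_mul, hτ]
          field_simp

/-- A geodesic projecting into the line of its chord encloses no area: all heights in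
`exists_chain_heights` vanish, and the error term alone cannot account for `2 * q.z` when `K` is
large. -/
theorem exists_isBetween_wedge_ne_zero {q : Heis} (hv : q.pr ≠ 0) (hz : 0 < q.z) :
    ∃ g, IsBetween N g q ∧ wedge g.pr q.pr ≠ 0 := by
  by_contra! hall
  obtain ⟨L, E, hLE⟩ := exists_isAreaBound N
  obtain ⟨K, hK⟩ := exists_nat_gt (E * ccn N q ^ 2 / q.z)
  have hE := hLE.2.1
  have hK0 : (0 : ℝ) < K := lt_of_le_of_lt (by positivity) hK
  obtain ⟨y, α, -, hbt, -, -, -, h⟩ := exists_chain_heights hLE hv (by exact_mod_cast hK0 : 0 < K)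
  have hy : ∀ i ≤ K, y i = 0 := fun i hi => by
    obtain ⟨g, hg, h⟩ := hbt i hi
    rw [h, hall g hg, zero_div]
  rw [Finset.sum_eq_zero fun i hi => by
    have := Finset.mem_range.1 hi
    rw [hy i this.le, hy (i + 1) this]
    ring] at h
  rw [div_lt_iff₀ hz] at hK
  rw [zero_add, le_div_iff₀ hK0] at h
  nlinarith

/-- A geodesic to a point above the plane moves far from its chord. -/
theorem exists_isBetween_depth {L E : ℝ} (hLE : IsAreaBound N L E) {q : Heis} (hv : q.pr ≠ 0)
    (hz : 0 < q.z) (hq : N.nm q.pr < ccn N q) : ∃ g D, IsBetween N g q ∧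
      D = wedge g.pr q.pr / N.nm q.pr ∧ q.z / (2 * ccn N q) ≤ D ∧
      2 * q.z ≤ D * (ccn N q + N.nm q.pr - D / (4 * L)) := by
  have hρ := N.nm_pos hv
  have hL := hLE.1
  have hE := hLE.2.1
  set d := ccn N q with hd
  set ρ := N.nm q.pr with hρd
  have hd0 : 0 < d := hρ.trans hq
  set D₀ := q.z / (2 * d) with hD₀
  have hD₀pos : 0 < D₀ := by positivity
  -- `A / K` will bound the discretisation error. `K` is so large that the crude area bound already
  -- yields `D₀ ≤ D`, and that all errors together are at most `D ^ 2 / (12 * L)`.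
  set A := L ^ 2 * d ^ 3 / (6 * D₀) with hA
  have hApos : 0 < A := by positivity
  obtain ⟨K, hK⟩ := exists_nat_gt (max (E * d ^ 2 / q.z) ((A + E * d ^ 2) / (D₀ ^ 2 / (12 * L))))
  have hK1 := (le_max_left _ _).trans_lt hK
  have hK2 := (le_max_right _ _).trans_lt hK
  have hK0 : (0 : ℝ) < K := lt_of_le_of_lt (by positivity) hK1
  have hK0' : 0 < K := by exact_mod_cast hK0
  obtain ⟨y, α, hy0, hbt, hstep, hα, hαs, h⟩ := exists_chain_heights hLE hv hK0'
  rw [← hd] at hstep hα h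
  -- The vertex of greatest height is the witness `g`.
  obtain ⟨j, hj, hjmax⟩ := Finset.exists_max_image (Finset.range (K + 1)) y ⟨0, by simp⟩
  rw [Finset.mem_range, Nat.lt_succ_iff] at hj
  have hyb : ∀ i ≤ K, 0 ≤ y i ∧ y i ≤ y j := fun i hi => by
    refine ⟨?_, hjmax i (by rw [Finset.mem_range]; omega)⟩
    obtain ⟨g, hg, h⟩ := hbt i hi
    rw [h]
    exact div_nonneg (hg.wedge_nonneg hz hq) hρ.le
  obtain ⟨g, hg, hgj⟩ := hbt j hj
  set D := y j with hDdef
  refine ⟨g, D, hg, hgj, ?_⟩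
  have hD0 : 0 ≤ D := (hyb j hj).1
  set τ := d / K with hτ
  have hτ0 : 0 < τ := by positivity
  have hKτ : K * τ = d := mul_div_cancel₀ _ hK0.ne'
  have hcrude : ∑ i ∈ Finset.range K, α i * (y i + y (i + 1)) ≤ 2 * d * D := by
    calc ∑ i ∈ Finset.range K, α i * (y i + y (i + 1)) ≤ ∑ i ∈ Finset.range K, τ * (2 * D) := by
          refine Finset.sum_le_sum fun i hi => ?_
          have hi' := Finset.mem_range.1 hi
          have h1 := hyb i hi'.le
          have h2 := hyb (i + 1) hi'
          exact mul_le_mul ((le_abs_self _).trans (hα i hi')) (by linarith) (by linarith) hτ0.le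
      _ = 2 * d * D := by
          rw [Finset.sum_const, Finset.card_range, nsmul_eq_mul, ← hKτ]
          ring
  have hEK : E * d ^ 2 / K < q.z := by
    rw [div_lt_iff₀ hz] at hK1
    rw [div_lt_iff₀ hK0]
    linarith
  have hDD : D₀ ≤ D := by
    rw [hD₀, div_le_iff₀ (by positivity)]
    linarith
  have hDpos : 0 < D := hD₀pos.trans_le hDD
  refine ⟨hDD, ?_⟩
  have hmid := sum_middle_ge hj hy0 rfl hyb hstep (by positivity)
  rw [← Finset.mul_sum] at hmid
  set S := ∑ i ∈ Finset.range K, (D - |y i + y (i + 1) - D|) with hS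
  -- Write `y i + y (i + 1)` as `D` plus a deviation. The first part sums to `D * ρ` since the `α i`
  -- add up to `ρ`; the second is bounded using `|α i| ≤ τ`. The saving over `D * (ρ + d)` is `τ *
  -- S`, large because the heights must pass through the middle of `[0, D]`.
  have hsum : ∑ i ∈ Finset.range K, α i * (y i + y (i + 1)) ≤ D * ρ + d * D - τ * S := by
    calc ∑ i ∈ Finset.range K, α i * (y i + y (i + 1))
        ≤ ∑ i ∈ Finset.range K, (α i * D + τ * D - τ * (D - |y i + y (i + 1) - D|)) := by
          refine Finset.sum_le_sum fun i hi => ?_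
          have hi' := Finset.mem_range.1 hi
          have h1 : α i * (y i + y (i + 1) - D) ≤ τ * |y i + y (i + 1) - D| := by
            refine (le_abs_self _).trans ?_
            rw [abs_mul]
            exact mul_le_mul_of_nonneg_right (hα i hi') (abs_nonneg _)
          linarith
      _ = D * ρ + d * D - τ * S := by
          rw [Finset.sum_sub_distrib, Finset.sum_add_distrib, ← Finset.sum_mul, hαs,
            Finset.sum_const, ← Finset.mul_sum, Finset.card_range, nsmul_eq_mul, ← hKτ]
          ring
  have hτS : D ^ 2 / (3 * L) - A / K ≤ τ * S := by
    have h1 : (2 / 3 * D ^ 3 - K * (L * τ) ^ 3 / 3) / (2 * L * D) ≤ τ * S := by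
      rw [div_le_iff₀ (by positivity)]
      linarith
    refine le_trans ?_ h1
    have h2 : (2 / 3 * D ^ 3 - K * (L * τ) ^ 3 / 3) / (2 * L * D) =
        D ^ 2 / (3 * L) - L ^ 2 * d ^ 3 / (6 * D) / K / K := by
      rw [hτ]
      field_simp
      ring
    rw [h2]
    have h3 : L ^ 2 * d ^ 3 / (6 * D) / K / K ≤ A / K := by
      have hK1' : (1 : ℝ) ≤ K := by exact_mod_cast hK0'
      refine (div_le_self (by positivity) hK1').trans ?_
      rw [hA]
      gcongr
    linarith
  have herr : A / K + E * d ^ 2 / K ≤ D ^ 2 / (12 * L) := by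
    rw [div_lt_iff₀ (by positivity)] at hK2
    rw [← add_div, div_le_iff₀ hK0]
    refine hK2.le.trans ?_
    rw [mul_comm]
    gcongr
  -- The errors consume a quarter of the saving `D ^ 2 / (3 * L)`.
  have hfin : D ^ 2 / (3 * L) - D ^ 2 / (12 * L) = D * (D / (4 * L)) := by
    field_simp
    ring
  linarith

end area

/-! ### A mean value inequality by quadratic penalisation -/

section meanvalue

variable (N : RationalPolygonalNorm)

/-- The squared Euclidean distance in exponential coordinates. -/
def sqd (p q : Heis) : ℝ := (p.x - q.x) ^ 2 + (p.y - q.y) ^ 2 + (p.z - q.z) ^ 2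

theorem sqd_nonneg (p q : Heis) : 0 ≤ sqd p q := by
  unfold sqd
  positivity

theorem sqd_self (p : Heis) : sqd p p = 0 := by simp [sqd]

theorem dist_le_of_sqd_le {p q : Heis} {r : ℝ} (hr : 0 ≤ r) (h : sqd p q ≤ r ^ 2) :
    dist p q ≤ r := by
  unfold sqd at h
  have h1 := sq_nonneg (p.x - q.x)
  have h2 := sq_nonneg (p.y - q.y)
  have h3 := sq_nonneg (p.z - q.z)
  exact dist_le_iff.2 ⟨abs_le_of_sq_le_sq (by linarith) hr, abs_le_of_sq_le_sq (by linarith) hr,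
    abs_le_of_sq_le_sq (by linarith) hr⟩

/-- Points of larger CC norm than `c` lose against `c` itself, so a compact sublevel set suffices.
The minimal value, as a function of `c`, is an inf-convolution regularising `ccn`. -/
theorem exists_min_penalized {C : ℝ} (hC : 0 ≤ C) (c : Heis) :
    ∃ m, ∀ m', ccn N m + C * sqd m c ≤ ccn N m' + C * sqd m' c := by
  obtain ⟨m, hm, hmin⟩ := (isCompact_ccn_le N (ccn N c)).exists_isMinOn ⟨c, le_refl (ccn N c)⟩
    (f := fun m => ccn N m + C * sqd m c) (Continuous.continuousOn (by unfold sqd; fun_prop))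
  refine ⟨m, fun m' => ?_⟩
  rcases le_or_gt (ccn N m') (ccn N c) with h | h
  · exact hmin h
  · have h1 : ccn N m + C * sqd m c ≤ ccn N c + C * sqd c c := hmin (le_refl (ccn N c))
    rw [sqd_self] at h1
    have h2 := mul_nonneg hC (sqd_nonneg m' c)
    linarith

/-- The source of subgradients: minus the gradient of the penalty at the minimiser, expressed in the
left-invariant frame at `m`. -/
theorem isSubgrad_of_min {C : ℝ} (hC : 0 ≤ C) {c m : Heis}
    (hm : ∀ m', ccn N m + C * sqd m c ≤ ccn N m' + C * sqd m' c) :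
    IsSubgrad N m (2 * C * (c.x - m.x) - 2 * C * (c.z - m.z) * m.y / 2,
      2 * C * (c.y - m.y) + 2 * C * (c.z - m.z) * m.x / 2) (2 * C * (c.z - m.z)) := by
  refine ⟨C * (2 + m.x ^ 2 + m.y ^ 2), fun w ζ => ?_⟩
  have h := hm (m * ⟨w.1, w.2, ζ⟩)
  set b := (m.x * w.2 - m.y * w.1) / 2 with hb
  have hδ : sqd (m * ⟨w.1, w.2, ζ⟩) c = sqd m c - 2 * ((c.x - m.x) * w.1 + (c.y - m.y) * w.2 +
      (c.z - m.z) * (ζ + b)) + (w.1 ^ 2 + w.2 ^ 2 + (ζ + b) ^ 2) := by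
    simp only [sqd, mul_x, mul_y, mul_z]
    rw [← hb]
    ring
  have hq : w.1 ^ 2 + w.2 ^ 2 + (ζ + b) ^ 2 ≤
      (2 + m.x ^ 2 + m.y ^ 2) * (w.1 ^ 2 + w.2 ^ 2 + ζ ^ 2) := by
    have h1 : b ^ 2 ≤ (m.x ^ 2 + m.y ^ 2) * (w.1 ^ 2 + w.2 ^ 2) / 4 := by
      rw [hb]
      nlinarith [sq_nonneg (m.x * w.1 + m.y * w.2)]
    have h2 : (ζ + b) ^ 2 ≤ 2 * ζ ^ 2 + 2 * b ^ 2 := by nlinarith [sq_nonneg (ζ - b)]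
    have h3 : 0 ≤ (m.x ^ 2 + m.y ^ 2) * (w.1 ^ 2 + w.2 ^ 2) := by positivity
    have h4 : 0 ≤ (m.x ^ 2 + m.y ^ 2) * ζ ^ 2 := by positivity
    nlinarith [sq_nonneg w.1, sq_nonneg w.2]
  have hq' := mul_le_mul_of_nonneg_left hq hC
  rw [hδ] at h
  simp only [dot]
  have e : (2 * C * (c.x - m.x) - 2 * C * (c.z - m.z) * m.y / 2) * w.1 +
      (2 * C * (c.y - m.y) + 2 * C * (c.z - m.z) * m.x / 2) * w.2 + 2 * C * (c.z - m.z) * ζ =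
      2 * C * ((c.x - m.x) * w.1 + (c.y - m.y) * w.2 + (c.z - m.z) * (ζ + b)) := by
    rw [hb]
    ring
  linarith

theorem abs_mul_le_sq_add_sq (a b : ℝ) : |a * b| ≤ a ^ 2 + b ^ 2 := by
  rw [abs_le]
  constructor <;> nlinarith [sq_nonneg (a + b), sq_nonneg (a - b), sq_nonneg a, sq_nonneg b]

/-- The old minimiser `m` competes for the new centre. The penalty changes at the rate `dot p w`, up
to the difference between the left-invariant frames at `m` and at the centre; that error is bounded
by the penalty itself, hence by `η`. -/
theorem penalized_step {C : ℝ} (hC : 0 ≤ C) {q m : Heis} {w : ℝ × ℝ} {s h c η : ℝ} (hh : 0 ≤ h)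
    (hm : ∀ m', ccn N m + C * sqd m (q * hexp (s • w)) ≤ ccn N m' + C * sqd m' (q * hexp (s • w)))
    (hη : C * sqd m (q * hexp (s • w)) ≤ η)
    (hc : ∀ p ξ, IsSubgrad N m p ξ → dot p w ≤ -c) :
    ccn N m + C * sqd m (q * hexp ((s + h) • w)) ≤ ccn N m + C * sqd m (q * hexp (s • w)) +
      h * (-c + (|w.1| + |w.2|) * η) +
        C * (w.1 ^ 2 + w.2 ^ 2 + ((q.x * w.2 - q.y * w.1) / 2) ^ 2) * h ^ 2 := by
  have hp := hc _ _ (isSubgrad_of_min N hC hm)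
  set k := q * hexp (s • w) with hk
  set a := k.x - m.x with ha
  set b := k.y - m.y with hb
  set e := k.z - m.z with he
  have hkx : k.x = q.x + s * w.1 := by simp [hk]
  have hky : k.y = q.y + s * w.2 := by simp [hk]
  have hkz : k.z = q.z + s * ((q.x * w.2 - q.y * w.1) / 2) := by simp [hk]; ring
  have h1 : sqd m (q * hexp ((s + h) • w)) = sqd m k + 2 * h * (a * w.1 + b * w.2 +
      e * ((q.x * w.2 - q.y * w.1) / 2)) +
        (w.1 ^ 2 + w.2 ^ 2 + ((q.x * w.2 - q.y * w.1) / 2) ^ 2) * h ^ 2 := by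
    simp only [sqd, mul_x, mul_y, mul_z, hexp_x, hexp_y, hexp_z, Prod.smul_fst, Prod.smul_snd,
      smul_eq_mul, ha, hb, he, hkx, hky, hkz]
    ring
  have h2 : 2 * C * (a * w.1 + b * w.2 + e * ((q.x * w.2 - q.y * w.1) / 2)) ≤
      -c + (|w.1| + |w.2|) * η := by
    have e1 : 2 * C * (a * w.1 + b * w.2 + e * ((q.x * w.2 - q.y * w.1) / 2)) =
        dot (2 * C * a - 2 * C * e * m.y / 2, 2 * C * b + 2 * C * e * m.x / 2) w +
          C * (e * a * w.2 - e * b * w.1) := by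
      simp only [dot, ha, hb, hkx, hky]
      ring
    have hsq : sqd m k = a ^ 2 + b ^ 2 + e ^ 2 := by
      simp only [sqd, ha, hb, he]
      ring
    have e2 : |e * a| ≤ sqd m k :=
      (abs_mul_le_sq_add_sq e a).trans (by rw [hsq]; linarith [sq_nonneg b])
    have e3 : |e * b| ≤ sqd m k :=
      (abs_mul_le_sq_add_sq e b).trans (by rw [hsq]; linarith [sq_nonneg a])
    have e4 : e * a * w.2 ≤ sqd m k * |w.2| := by
      refine (le_abs_self _).trans ?_
      rw [abs_mul]
      gcongr
    have e5 : -(e * b * w.1) ≤ sqd m k * |w.1| := by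
      refine (neg_le_abs _).trans ?_
      rw [abs_mul]
      gcongr
    have e6 : C * (e * a * w.2 - e * b * w.1) ≤ C * (sqd m k * (|w.1| + |w.2|)) := by
      gcongr
      linarith
    have e7 : C * sqd m k * (|w.1| + |w.2|) ≤ η * (|w.1| + |w.2|) := by gcongr
    rw [e1]
    linarith
  have h3 := mul_le_mul_of_nonneg_left h2 hh
  rw [h1]
  linarith

/-- A mean value inequality: if all subgradients near a horizontal segment are at most `-c` in its
direction, then the CC norm decreases along the segment with speed at least `c`. -/
theorem ccn_mul_hexp_le_of_subgrad {q : Heis} {w : ℝ × ℝ} {c S r : ℝ} (hS : 0 ≤ S) (hr : 0 < r)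
    (h : ∀ s ∈ Icc 0 S, ∀ m, dist m (q * hexp (s • w)) ≤ r → ∀ p ξ, IsSubgrad N m p ξ →
      dot p w ≤ -c) : ccn N (q * hexp (S • w)) ≤ ccn N q - c * S := by
  set κ := |w.1| + |w.2| with hκ
  set k : ℝ → Heis := fun s => q * hexp (s • w) with hk
  set B := ccn N q + S * N.nm w with hB
  have hkB : ∀ s ∈ Icc 0 S, ccn N (k s) ≤ B := fun s hs => by
    have h1 := ccn_mul_le N q (hexp (s • w))
    have h2 := ccn_hexp_le N (s • w)
    rw [N.nm_smul_of_nonneg hs.1] at h2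
    have h3 := mul_le_mul_of_nonneg_right hs.2 (N.nm_nonneg w)
    linarith
  have hB0 : 0 ≤ B := add_nonneg (ccn_nonneg N q) (mul_nonneg hS (N.nm_nonneg w))
  have key : ∀ η : ℝ, 0 < η → ccn N (k S) ≤ ccn N q - c * S + η * (1 + κ * S) := by
    intro η hη
    have huc := (isCompact_ccn_le N B).uniformContinuousOn_of_continuous
      (continuous_ccn N).continuousOn
    obtain ⟨δ, hδ, hδ'⟩ := Metric.uniformContinuousOn_iff.1 huc η hη
    set ρ := min r (δ / 2) with hρ
    have hρ0 : 0 < ρ := lt_min hr (by positivity)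
    -- So large that each minimiser lies within `ρ` of its centre; uniform continuity then bounds
    -- the penalty by `η`.
    set C := (B + 1) / ρ ^ 2 with hC
    have hC0 : 0 < C := by positivity
    choose m hm using fun s => exists_min_penalized N hC0.le (k s)
    have hmk : ∀ s, ccn N (m s) + C * sqd (m s) (k s) ≤ ccn N (k s) := fun s => by
      simpa [sqd_self] using hm s (k s)
    have hmB : ∀ s ∈ Icc 0 S, ccn N (m s) ≤ B := fun s hs => by
      have h1 := mul_nonneg hC0.le (sqd_nonneg (m s) (k s))
      linarith [hmk s, hkB s hs]
    have hdist : ∀ s ∈ Icc 0 S, dist (m s) (k s) ≤ ρ := fun s hs => by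
      refine dist_le_of_sqd_le hρ0.le ?_
      have h1 : C * sqd (m s) (k s) ≤ B + 1 := by
        linarith [hmk s, hkB s hs, ccn_nonneg N (m s)]
      rw [hC, div_mul_eq_mul_div, div_le_iff₀ (by positivity)] at h1
      exact le_of_mul_le_mul_left h1 (by positivity)
    have hclose : ∀ s ∈ Icc 0 S, ccn N (k s) ≤ ccn N (m s) + η := fun s hs => by
      have h1 := hδ' (m s) (hmB s hs) (k s) (hkB s hs)
        ((hdist s hs).trans_lt ((min_le_right _ _).trans_lt (by linarith)))
      rw [Real.dist_eq, abs_lt] at h1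
      linarith [h1.1]
    have hpen : ∀ s ∈ Icc 0 S, C * sqd (m s) (k s) ≤ η := fun s hs => by
      linarith [hmk s, hclose s hs]
    set A := C * (w.1 ^ 2 + w.2 ^ 2 + ((q.x * w.2 - q.y * w.1) / 2) ^ 2) with hA
    have hA0 : 0 ≤ A := by positivity
    set D : ℝ → ℝ := fun s => ccn N (m s) + C * sqd (m s) (k s) with hD
    have hstep : ∀ s t, 0 ≤ t → s ∈ Icc 0 S → D (s + t) ≤ D s + t * (-c + κ * η) + A * t ^ 2 := by
      intro s t ht hs
      exact (hm (s + t) (m s)).trans (penalized_step N hC0.le ht (hm s) (hpen s hs)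
        (h s hs (m s) ((hdist s hs).trans (min_le_left _ _))))
    -- With `n + 1` equal steps the quadratic errors add up to order `1 / (n + 1)`.
    have hn : ∀ n : ℕ, D S ≤ D 0 + S * (-c + κ * η) + A * S ^ 2 * (1 / ((n : ℝ) + 1)) := by
      intro n
      set t := S / (n + 1) with ht
      have ht0 : 0 ≤ t := by positivity
      have htn : (n + 1) * t = S := by
        rw [ht]
        field_simp
      have hj : ∀ j : ℕ, j ≤ n + 1 → D (j * t) ≤ D 0 + j * (t * (-c + κ * η) + A * t ^ 2) := by
        intro j
        induction j with
        | zero => intro _; simp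
        | succ j ih =>
          intro hj
          have h1 := ih (Nat.le_of_succ_le hj)
          have hj' : (j : ℝ) ≤ n + 1 := by exact_mod_cast Nat.le_of_succ_le hj
          have h2 := hstep (j * t) t ht0 ⟨by positivity, by rw [← htn]; gcongr⟩
          have h3 : ((j + 1 : ℕ) : ℝ) * t = j * t + t := by push_cast; ring
          rw [h3]
          push_cast
          linarith
      have h1 := hj (n + 1) le_rfl
      push_cast at h1
      rw [htn] at h1
      have h2 : ((n : ℝ) + 1) * (t * (-c + κ * η) + A * t ^ 2) =
          S * (-c + κ * η) + A * S ^ 2 * (1 / ((n : ℝ) + 1)) := by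
        rw [ht]
        field_simp
      linarith
    have hlim : D S ≤ D 0 + S * (-c + κ * η) := by
      have h1 : Tendsto (fun n : ℕ => D 0 + S * (-c + κ * η) + A * S ^ 2 * (1 / ((n : ℝ) + 1)))
          atTop (𝓝 (D 0 + S * (-c + κ * η) + A * S ^ 2 * 0)) :=
        (tendsto_one_div_add_atTop_nhds_zero_nat.const_mul _).const_add _
      rw [mul_zero, add_zero] at h1
      exact ge_of_tendsto' h1 hn
    have h0 : D 0 ≤ ccn N q := by
      have : k 0 = q := by ext <;> simp [hk]
      have h1 := hmk 0
      rw [this] at h1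
      simpa [hD, this] using h1
    have hSS : ccn N (k S) ≤ D S + η := by
      have h1 := hclose S ⟨hS, le_rfl⟩
      have h2 := mul_nonneg hC0.le (sqd_nonneg (m S) (k S))
      simp only [hD]
      linarith
    linarith
  have := le_of_eventually_right (a := ccn N (k S)) (d := 0)
    (f := fun η => ccn N q - c * S + η * (1 + κ * S)) (by fun_prop)
    (by filter_upwards [self_mem_nhdsWithin] with η hη using key η hη)
  simpa using this

end meanvalue

/-! ### Absence of critical points -/

section noncritical

variable (N : RationalPolygonalNorm)

/-- Closed conditions satisfied by the subgradients `(p, ξ)` of the CC norm at `q`. -/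
structure IsLimSub (q : Heis) (p : ℝ × ℝ) (ξ : ℝ) (u : ℝ × ℝ) : Prop where
  dot_le : ∀ w, dot p w ≤ N.nm w
  nm_le : N.nm u ≤ 1
  le_dot : 1 ≤ dot p u
  dot_sub_le : ∀ w, dot p w - ξ * wedge q.pr w ≤ N.nm w
  euler : dot p q.pr + 2 * q.z * ξ = ccn N q
  -- The inequality `IsSubgrad.dot_add_depth_le` for the depth `q.z / (2 * ccn N q)`, with `ξ * q.z`
  -- eliminated by Euler's identity and denominators cleared, so that it passes to limits.
  depth : 4 * ccn N q * dot p q.pr + N.nm q.pr * (ccn N q - dot p q.pr) ≤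
    4 * ccn N q * N.nm q.pr

variable {N}

/-- First variation for the chord vector inserted at height `D`, where the area gained is `D * N.nm
q.pr`. -/
theorem IsSubgrad.dot_add_depth_le {q g : Heis} {p : ℝ × ℝ} {ξ D : ℝ} (h : IsSubgrad N q p ξ)
    (hg : IsBetween N g q) (hv : q.pr ≠ 0) (hD : D = wedge g.pr q.pr / N.nm q.pr) :
    dot p q.pr + ξ * (D * N.nm q.pr) ≤ N.nm q.pr := by
  have h1 := h.insert hg q.pr
  have h2 : D * N.nm q.pr = wedge g.pr q.pr := by
    rw [hD, div_mul_cancel₀ _ (N.nm_pos hv).ne']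
  rw [wedge_sub, wedge_self, wedge_swap] at h1
  rw [h2]
  linarith

theorem IsSubgrad.exists_isLimSub {q : Heis} {p : ℝ × ℝ} {ξ : ℝ} (h : IsSubgrad N q p ξ)
    (hv : q.pr ≠ 0) (hz : 0 < q.z) : ∃ u, IsLimSub N q p ξ u := by
  have hρ := N.nm_pos hv
  have hd : 0 < ccn N q := hρ.trans_le (nm_pr_le_ccn N q)
  obtain ⟨u, hu, hpu⟩ := h.exists_eikonal hd
  refine ⟨u, h.dot_le, hu, hpu, h.dot_sub_wedge_le, h.euler, ?_⟩
  have hpv := h.dot_le q.pr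
  rcases (nm_pr_le_ccn N q).lt_or_eq with hlt | heq
  · obtain ⟨L, E, hLE⟩ := exists_isAreaBound N
    obtain ⟨g, D, hg, hD, hDz, -⟩ := exists_isBetween_depth hLE hv hz hlt
    have h1 := h.dot_add_depth_le hg hv hD
    have h2 := h.euler
    have hξ : 0 ≤ ξ := by
      have : 0 ≤ 2 * q.z * ξ := by linarith
      exact nonneg_of_mul_nonneg_right this (by positivity)
    have h3 : ξ * (q.z / (2 * ccn N q) * N.nm q.pr) ≤ ξ * (D * N.nm q.pr) := by gcongr
    have h4 : dot p q.pr + ξ * (q.z / (2 * ccn N q) * N.nm q.pr) ≤ N.nm q.pr := by linarith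
    have h5 : ξ * (q.z / (2 * ccn N q) * N.nm q.pr) =
        (ccn N q - dot p q.pr) * N.nm q.pr / (4 * ccn N q) := by
      have : ξ * q.z = (ccn N q - dot p q.pr) / 2 := by linarith
      field_simp
      linear_combination 4 * this
    rw [h5] at h4
    have h6 : (ccn N q - dot p q.pr) * N.nm q.pr / (4 * ccn N q) ≤ N.nm q.pr - dot p q.pr := by
      linarith
    rw [div_le_iff₀ (by positivity)] at h6
    linarith
  -- When the CC norm is the norm of the chord, the condition reduces to `dot p q.pr ≤ N.nm q.pr`.
  · rw [← heq]
    rw [← heq] at hd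
    nlinarith

theorem Continuous.dot {X : Type*} [TopologicalSpace X] {f g : X → ℝ × ℝ} (hf : Continuous f)
    (hg : Continuous g) : Continuous fun x => dot (f x) (g x) :=
  continuous_dot.comp (hf.prodMk hg)

theorem Filter.Tendsto.dot {X : Type*} {l : Filter X} {f g : X → ℝ × ℝ} {a b : ℝ × ℝ}
    (hf : Tendsto f l (𝓝 a)) (hg : Tendsto g l (𝓝 b)) :
    Tendsto (fun x => dot (f x) (g x)) l (𝓝 (_root_.dot a b)) :=
  (continuous_dot.tendsto (a, b)).comp (hf.prodMk_nhds hg)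

theorem Filter.Tendsto.wedge {X : Type*} {l : Filter X} {f g : X → ℝ × ℝ} {a b : ℝ × ℝ}
    (hf : Tendsto f l (𝓝 a)) (hg : Tendsto g l (𝓝 b)) :
    Tendsto (fun x => wedge (f x) (g x)) l (𝓝 (_root_.wedge a b)) :=
  (continuous_wedge.tendsto (a, b)).comp (hf.prodMk_nhds hg)

/-- `p` and `u` stay in compact sets; no bound on `ξ` is needed, since off the plane Euler's
identity determines it from the rest. -/
theorem IsLimSub.exists_limit {q : ℕ → Heis} {p u : ℕ → ℝ × ℝ} {ξ : ℕ → ℝ} {q₀ : Heis}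
    (hq : Tendsto q atTop (𝓝 q₀)) (hz : 0 < q₀.z)
    (h : ∀ n, IsLimSub N (q n) (p n) (ξ n) (u n)) :
    ∃ p₀ ξ₀ u₀, ∃ φ : ℕ → ℕ, StrictMono φ ∧ IsLimSub N q₀ p₀ ξ₀ u₀ ∧
      Tendsto (p ∘ φ) atTop (𝓝 p₀) := by
  obtain ⟨⟨p₀, u₀⟩, ⟨hp₀, hu₀⟩, φ, hφ, hlim⟩ :=
    ((isCompact_dual_ball N).prod (isCompact_nm_le N 1)).tendsto_subseq
      (x := fun n => (p n, u n)) fun n => ⟨(h n).dot_le, (h n).nm_le⟩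
  have hp : Tendsto (fun n => p (φ n)) atTop (𝓝 p₀) := (continuous_fst.tendsto _).comp hlim
  have hu : Tendsto (fun n => u (φ n)) atTop (𝓝 u₀) := (continuous_snd.tendsto _).comp hlim
  have hqφ : Tendsto (fun n => q (φ n)) atTop (𝓝 q₀) := hq.comp hφ.tendsto_atTop
  have hv : Tendsto (fun n => (q (φ n)).pr) atTop (𝓝 q₀.pr) := (continuous_pr.tendsto _).comp hqφ
  have hzt : Tendsto (fun n => (q (φ n)).z) atTop (𝓝 q₀.z) := (continuous_z.tendsto _).comp hqφ
  have hd : Tendsto (fun n => ccn N (q (φ n))) atTop (𝓝 (ccn N q₀)) :=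
    ((continuous_ccn N).tendsto _).comp hqφ
  have hNv : Tendsto (fun n => N.nm (q (φ n)).pr) atTop (𝓝 (N.nm q₀.pr)) :=
    (N.continuous_nm.tendsto _).comp hv
  have hpv := hp.dot hv
  have hξ : Tendsto (fun n => ξ (φ n)) atTop (𝓝 ((ccn N q₀ - dot p₀ q₀.pr) / (2 * q₀.z))) := by
    refine ((hd.sub hpv).div (hzt.const_mul 2) (by positivity)).congr' ?_
    filter_upwards [hzt.eventually (lt_mem_nhds hz)] with n hn
    have := (h (φ n)).euler
    rw [Pi.div_apply, div_eq_iff (by positivity)]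
    linarith
  refine ⟨p₀, (ccn N q₀ - dot p₀ q₀.pr) / (2 * q₀.z), u₀, φ, hφ, ⟨hp₀, hu₀, ?_, fun w => ?_, ?_, ?_⟩, hp⟩
  · exact ge_of_tendsto' (hp.dot hu) fun n => (h (φ n)).le_dot
  · exact le_of_tendsto' ((hp.dot tendsto_const_nhds).sub (hξ.mul (hv.wedge tendsto_const_nhds)))
      fun n => (h (φ n)).dot_sub_le w
  · field_simp
    ring
  · exact le_of_tendsto_of_tendsto' (((hd.const_mul 4).mul hpv).add (hNv.mul (hd.sub hpv)))
      ((hd.const_mul 4).mul hNv) fun n => (h (φ n)).depth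

/-- A norming functional that is extreme in the positive direction, together with a vector
spanning its kernel. -/
theorem exists_extreme_norming {v : ℝ × ℝ} (hv : v ≠ 0) : ∃ φ w : ℝ × ℝ,
    (∀ u, dot φ u ≤ N.nm u) ∧ dot φ v = N.nm v ∧ dot φ w = 0 ∧ 0 < wedge v w ∧
      ∀ ψ, (∀ u, dot ψ u ≤ N.nm u) → dot ψ v = N.nm v → dot ψ w ≤ 0 := by
  have hρ := N.nm_pos hv
  -- Among the functionals norming `v`, `φ` maximises the value on the rotated chord `j`.
  -- Subtracting a multiple of `v` from `j` puts `w` in the kernel of `φ` and changes the value of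
  -- every norming functional by the same constant.
  set j : ℝ × ℝ := (-v.2, v.1) with hj
  have hcomp : IsCompact ({p : ℝ × ℝ | ∀ u, dot p u ≤ N.nm u} ∩ {p | dot p v = N.nm v}) :=
    (isCompact_dual_ball N).inter_right
      (isClosed_eq (Continuous.dot continuous_id continuous_const) continuous_const)
  obtain ⟨φ, ⟨hφ, hφv⟩, hmax⟩ := hcomp.exists_isMaxOn (N.exists_norming v)
    (f := fun p => dot p j) (Continuous.dot continuous_id continuous_const).continuousOn
  refine ⟨φ, j - (dot φ j / N.nm v) • v, hφ, hφv, ?_, ?_, fun ψ hψ hψv => ?_⟩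
  · have hφv' : dot φ v = N.nm v := hφv
    rw [dot_sub, dot_smul, hφv', div_mul_cancel₀ _ hρ.ne', sub_self]
  · rw [wedge_sub, wedge_smul, wedge_self]
    simp only [hj, wedge]
    have h : v.1 ≠ 0 ∨ v.2 ≠ 0 := by
      by_contra! h
      exact hv (Prod.ext h.1 h.2)
    rcases h with h | h
    · nlinarith [sq_nonneg v.2, pow_pos (abs_pos.2 h) 2, sq_abs v.1]
    · nlinarith [sq_nonneg v.1, pow_pos (abs_pos.2 h) 2, sq_abs v.2]
  · rw [dot_sub, dot_smul, hψv, div_mul_cancel₀ _ hρ.ne']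
    exact sub_nonpos.2 (hmax ⟨hψ, hψv⟩)

/-- At a point above the plane reached by a path that is straight for the norm, the chord has a
unique norming functional. -/
theorem norming_unique {q : Heis} (hv : q.pr ≠ 0) (hz : 0 < q.z) (hq : ccn N q ≤ N.nm q.pr)
    {φ ψ : ℝ × ℝ} (hφ : ∀ u, dot φ u ≤ N.nm u) (hφv : dot φ q.pr = N.nm q.pr)
    (hψ : ∀ u, dot ψ u ≤ N.nm u) (hψv : dot ψ q.pr = N.nm q.pr) (w : ℝ × ℝ) :
    dot φ w = dot ψ w := by
  obtain ⟨g, hg, hne⟩ := exists_isBetween_wedge_ne_zero (N := N) hv hz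
  -- A norming functional calibrates the whole geodesic, as its values on the two pieces already add
  -- up to `ccn N q`. So it is determined on `g.pr`, which together with `q.pr` spans the plane.
  have key : ∀ φ : ℝ × ℝ, (∀ u, dot φ u ≤ N.nm u) → dot φ q.pr = N.nm q.pr →
      dot φ g.pr = ccn N g := by
    intro φ hφ hφv
    have h1 := (le_abs_self _).trans (dot_pr_le_ccn N hφ g)
    have h2 := (le_abs_self _).trans (dot_pr_le_ccn N hφ (g⁻¹ * q))
    rw [pr_mul, pr_inv, dot_add, dot_neg, hφv] at h2
    unfold IsBetween at hg
    linarith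
  rw [wedge_decomp hne w]
  simp only [dot_add, dot_smul, key φ hφ hφv, key ψ hψ hψv, hφv, hψv]

/-- `w` is taken in the kernel of the extreme norming functional `φ` of the chord. If `ξ = 0`, then
`p` norms the chord and agrees with `φ` by uniqueness. If `ξ > 0` and `dot p w ≤ 0`, the eikonal
vector `u` forces `|dot p q.pr| = N.nm q.pr`, and both signs are impossible. -/
theorem exists_almost_noncritical {q : Heis} (hv : q.pr ≠ 0) (hz : 0 < q.z) : ∃ w : ℝ × ℝ,
    ∀ p ξ u, IsLimSub N q p ξ u → dot p w ≤ 0 → dot p w = 0 ∧ 0 < dot p q.pr := by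
  obtain ⟨φ, w, hφ, hφv, hφw, hvw, hext⟩ := exists_extreme_norming (N := N) hv
  have hρ := N.nm_pos hv
  refine ⟨w, fun p ξ u h hpw => ?_⟩
  have hpv := h.dot_le q.pr
  have hd := nm_pr_le_ccn N q
  have hξ : 0 ≤ ξ := by
    have : 0 ≤ 2 * q.z * ξ := by linarith [h.euler]
    exact nonneg_of_mul_nonneg_right this (by positivity)
  rcases hξ.eq_or_lt with hξ0 | hξpos
  · have he := h.euler
    rw [← hξ0, mul_zero, add_zero] at he
    have hpv' : dot p q.pr = N.nm q.pr := le_antisymm hpv (by rw [he]; exact hd)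
    rw [norming_unique hv hz (by rw [← he]; exact hpv) h.dot_le hpv' hφ hφv w, hφw, hpv']
    exact ⟨rfl, hρ⟩
  exfalso
  set α := wedge u w / wedge q.pr w with hα
  set β := wedge q.pr u / wedge q.pr w with hβ
  have hu := wedge_decomp hvw.ne' u
  rw [← hα, ← hβ] at hu
  -- First variation at the start of the geodesic puts `u` on the same side of the chord as `w`.
  have hβ0 : 0 ≤ β := by
    refine div_nonneg ?_ hvw.le
    have h1 := h.dot_sub_le u
    have h2 : 0 ≤ ξ * wedge q.pr u := by linarith [h.nm_le, h.le_dot]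
    exact nonneg_of_mul_nonneg_right h2 hξpos
  have hα1 : |α| * N.nm q.pr ≤ 1 := by
    have h1 := dot_abs_le hφ u
    rw [hu, dot_add, dot_smul, dot_smul, hφw, mul_zero, add_zero, hφv, abs_mul,
      abs_of_pos hρ, ← hu] at h1
    exact h1.trans h.nm_le
  have h1 : 1 ≤ |α| * |dot p q.pr| := by
    have h2 := h.le_dot
    rw [hu, dot_add, dot_smul, dot_smul] at h2
    have h3 : β * dot p w ≤ 0 := mul_nonpos_of_nonneg_of_nonpos hβ0 hpw
    rw [← abs_mul]
    exact (by linarith : 1 ≤ α * dot p q.pr).trans (le_abs_self _)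
  have hαpos : 0 < |α| := by
    refine (abs_nonneg α).lt_of_ne fun h0 => ?_
    rw [← h0, zero_mul] at h1
    linarith
  have habs : N.nm q.pr ≤ |dot p q.pr| := le_of_mul_le_mul_left (hα1.trans h1) hαpos
  rcases abs_cases (dot p q.pr) with ⟨he, -⟩ | ⟨he, -⟩
  -- The positive sign: the depth condition gives `ccn N q ≤ N.nm q.pr`, which contradicts Euler's
  -- identity with `ξ > 0`.
  · have hpv' : dot p q.pr = N.nm q.pr := le_antisymm hpv (by rw [← he]; exact habs)
    have h2 := h.depth
    rw [hpv'] at h2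
    have h3 : ccn N q ≤ N.nm q.pr := by
      have : N.nm q.pr * (ccn N q - N.nm q.pr) ≤ 0 := by linarith
      have := nonpos_of_mul_nonpos_right this hρ
      linarith
    have h4 := h.euler
    have h5 : 0 < 2 * q.z * ξ := by positivity
    linarith
  -- The negative sign: `ψ`, the negative of the covector transported to the start of the geodesic,
  -- norms the chord. Extremality of `φ` gives `dot ψ w ≤ 0`, but the term `ξ * wedge q.pr w` makes
  -- it positive.
  · set ψ : ℝ × ℝ := (-p.1 - ξ * q.pr.2, -p.2 + ξ * q.pr.1) with hψ
    have hψd : ∀ u, dot ψ u = dot p (-u) - ξ * wedge q.pr (-u) := fun u => by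
      simp only [hψ, dot, wedge, Prod.fst_neg, Prod.snd_neg]
      ring
    have h2 := hext ψ (fun u => by
      rw [hψd, ← N.nm_neg u]
      exact h.dot_sub_le (-u)) (by
      rw [hψd, wedge_neg, wedge_self, dot_neg, neg_zero, mul_zero, sub_zero]
      refine le_antisymm ?_ (by rw [← he]; exact habs)
      rw [← he]
      exact dot_abs_le h.dot_le _)
    rw [hψd, dot_neg, wedge_neg] at h2
    have h5 : 0 < ξ * wedge q.pr w := by positivity
    linarith

/-- A slight tilt of `w` towards the chord suffices. Otherwise bad covectors for the tilts `1 / (n +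
1)` have a limit that is nonpositive both on `w` and on the chord, which `exists_almost_noncritical`
excludes. -/
theorem exists_noncritical {q : Heis} (hv : q.pr ≠ 0) (hz : 0 < q.z) : ∃ w : ℝ × ℝ,
    ∀ p ξ u, IsLimSub N q p ξ u → 0 < dot p w := by
  obtain ⟨w, hw⟩ := exists_almost_noncritical (N := N) hv hz
  by_contra! hcon
  choose p ξ u h hp using fun n : ℕ => hcon (w + (1 / ((n : ℝ) + 1)) • q.pr)
  obtain ⟨p₀, ξ₀, u₀, φ, hφ, h₀, hlim⟩ := IsLimSub.exists_limit tendsto_const_nhds hz h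
  have hpv : ∀ n, dot (p n) q.pr ≤ 0 := by
    intro n
    have h1 := hp n
    rw [dot_add, dot_smul] at h1
    have hn : (0 : ℝ) < 1 / ((n : ℝ) + 1) := by positivity
    rcases le_or_gt (dot (p n) w) 0 with h2 | h2
    · obtain ⟨h3, h4⟩ := hw _ _ _ (h n) h2
      have := mul_pos hn h4
      linarith
    · exact nonpos_of_mul_nonpos_right (by linarith) hn
  have hlv := hlim.dot (tendsto_const_nhds (x := q.pr))
  have hlw := hlim.dot (tendsto_const_nhds (x := w))
  have h1 : dot p₀ q.pr ≤ 0 := le_of_tendsto' hlv fun n => hpv (φ n)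
  have h2 : dot p₀ w ≤ -(0 * dot p₀ q.pr) := by
    have h3 : Tendsto (fun n => 1 / ((φ n : ℝ) + 1)) atTop (𝓝 0) :=
      tendsto_one_div_add_atTop_nhds_zero_nat.comp hφ.tendsto_atTop
    refine le_of_tendsto_of_tendsto' hlw (h3.mul hlv).neg fun n => ?_
    have h1 := hp (φ n)
    rw [dot_add, dot_smul] at h1
    simp only [Function.comp_apply]
    linarith
  rw [zero_mul, neg_zero] at h2
  exact absurd h1 (hw _ _ _ h₀ h2).2.not_ge

/-- Near a point off the vertical axis and above the plane, all subgradients are positive on a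
common horizontal vector. -/
theorem exists_noncritical_nhds {q : Heis} (hv : q.pr ≠ 0) (hz : 0 < q.z) :
    ∃ (w : ℝ × ℝ) (c r : ℝ), 0 < c ∧ 0 < r ∧
      ∀ m, dist m q < r → ∀ p ξ, IsSubgrad N m p ξ → c ≤ dot p w := by
  obtain ⟨w, hw⟩ := exists_noncritical (N := N) hv hz
  have hopen : IsOpen {m : Heis | m.pr ≠ 0 ∧ 0 < m.z} :=
    (isOpen_ne_fun continuous_pr continuous_const).inter (isOpen_lt continuous_const continuous_z)
  obtain ⟨r₀, hr₀, hball⟩ := Metric.isOpen_iff.1 hopen q ⟨hv, hz⟩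
  by_contra! hcon
  have hn : ∀ n : ℕ, (0 : ℝ) < 1 / ((n : ℝ) + 1) := fun n => by positivity
  choose m hm p ξ hp hpw using fun n : ℕ =>
    hcon w (1 / ((n : ℝ) + 1)) (min r₀ (1 / ((n : ℝ) + 1))) (hn n) (lt_min hr₀ (hn n))
  have hmq : Tendsto m atTop (𝓝 q) := by
    rw [tendsto_iff_dist_tendsto_zero]
    exact squeeze_zero (fun _ => dist_nonneg)
      (fun n => (hm n).le.trans (min_le_right _ _)) tendsto_one_div_add_atTop_nhds_zero_nat
  choose u hu using fun n => (hp n).exists_isLimSub (hball ((hm n).trans_le (min_le_left _ _))).1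
    (hball ((hm n).trans_le (min_le_left _ _))).2
  obtain ⟨p₀, ξ₀, u₀, φ, hφ, h₀, hlim⟩ := IsLimSub.exists_limit hmq hz hu
  have h1 : dot p₀ w ≤ 0 := le_of_tendsto_of_tendsto'
    (hlim.dot (tendsto_const_nhds (x := w)))
    (tendsto_one_div_add_atTop_nhds_zero_nat.comp hφ.tendsto_atTop) fun n => (hpw (φ n)).le
  exact absurd h1 (hw _ _ _ h₀).not_ge

/-- Near a point of the plane other than the origin, all subgradients are positive on a common
horizontal vector. -/
theorem exists_noncritical_nhds_of_z_eq_zero {q : Heis} (hv : q.pr ≠ 0) (hz : q.z = 0) :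
    ∃ (w : ℝ × ℝ) (c r : ℝ), 0 < c ∧ 0 < r ∧
      ∀ m, dist m q < r → ∀ p ξ, IsSubgrad N m p ξ → c ≤ dot p w := by
  have hρ := N.nm_pos hv
  have hd : 0 < ccn N q := hρ.trans_le (nm_pr_le_ccn N q)
  -- A lower bound for `dot p q.pr`: Euler's identity at `m`, a bound for `|ξ|`, and the price of
  -- replacing `m.pr` by `q.pr`. At `m = q` it equals `ccn N q > 0`, so `w = q.pr` works.
  set B : Heis → ℝ := fun m => ccn N m - N.nm (q.pr - m.pr) -
    4 * |m.z| * N.nm (-m.pr.2, m.pr.1) / (m.pr.1 ^ 2 + m.pr.2 ^ 2) with hB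
  have hne : ∀ v : ℝ × ℝ, v ≠ 0 → 0 < v.1 ^ 2 + v.2 ^ 2 := fun v hv => by
    have h : v.1 ≠ 0 ∨ v.2 ≠ 0 := by
      by_contra! h
      exact hv (Prod.ext h.1 h.2)
    rcases h with h | h <;> positivity
  have hcont : ContinuousAt B q := by
    refine ContinuousAt.sub (Continuous.continuousAt (by fun_prop)) (ContinuousAt.div
      (Continuous.continuousAt (by fun_prop)) (Continuous.continuousAt (by fun_prop)) (hne _ hv).ne')
  have hBq : B q = ccn N q := by simp [hB, hz, N.nm_zero]
  have hev : ∀ᶠ m in 𝓝 q, ccn N q / 2 < B m ∧ m.pr ≠ 0 :=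
    (hcont.eventually (lt_mem_nhds (by rw [hBq]; linarith))).and
      (continuous_pr.continuousAt.eventually_ne hv)
  obtain ⟨r, hr, hball⟩ := Metric.eventually_nhds_iff.1 hev
  refine ⟨q.pr, ccn N q / 2, r, by positivity, hr, fun m hm p ξ h => ?_⟩
  obtain ⟨h1, hmv⟩ := hball hm
  have hS := hne _ hmv
  set S := m.pr.1 ^ 2 + m.pr.2 ^ 2 with hSdef
  set j : ℝ × ℝ := (-m.pr.2, m.pr.1) with hj
  have hwj : wedge m.pr j = S := by
    simp only [wedge, hj, hSdef]
    ring
  -- First variation of `±j` at the start, combined with that of `∓j` at the end, isolates `ξ`.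
  have h2 : |ξ| * S ≤ 2 * N.nm j := by
    have e1 := h.dot_sub_wedge_le j
    have e2 := h.dot_sub_wedge_le (-j)
    have e3 := h.dot_le j
    have e4 := h.dot_le (-j)
    rw [N.nm_neg] at e2 e4
    rw [dot_neg, wedge_neg] at e2
    rw [dot_neg] at e4
    rw [hwj] at e1 e2
    rcases abs_cases ξ with ⟨he, -⟩ | ⟨he, -⟩ <;> rw [he] <;> linarith
  have h3 : 2 * m.z * ξ ≤ 4 * |m.z| * N.nm j / S := by
    rw [le_div_iff₀ hS]
    calc 2 * m.z * ξ * S = 2 * (m.z * ξ) * S := by ring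
      _ ≤ 2 * |m.z * ξ| * S := by gcongr; exact le_abs_self _
      _ = 2 * |m.z| * (|ξ| * S) := by rw [abs_mul]; ring
      _ ≤ 2 * |m.z| * (2 * N.nm j) := by gcongr
      _ = 4 * |m.z| * N.nm j := by ring
  have h4 := h.euler
  have h5 := (abs_le.1 (dot_abs_le h.dot_le (q.pr - m.pr))).1
  rw [dot_sub] at h5
  simp only [hB] at h1
  linarith

/-- Near the positive vertical axis, the CC norm decreases in the radial direction. -/
theorem exists_radial_subgrad_bound {q : Heis} (hv : q.pr = 0) (hz : 0 < q.z) :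
    ∃ c r : ℝ, 0 < c ∧ 0 < r ∧ ∀ m, dist m q < r → m.pr ≠ 0 → ∀ p ξ, IsSubgrad N m p ξ →
      dot p m.pr ≤ -c * N.nm m.pr := by
  obtain ⟨L, E, hLE⟩ := exists_isAreaBound N
  have hL := hLE.1
  have hd : 0 < ccn N q := (ccn_nonneg N q).lt_of_ne fun h => by
    rw [ccn_eq_zero N h.symm] at hz
    exact lt_irrefl _ hz
  set d₀ := ccn N q with hd₀
  -- A uniform lower bound for the depth near `q`, where `m.z > q.z / 2` and `ccn N m < 2 * d₀`; `θ`
  -- is the resulting saving in the area estimate.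
  set D₁ := q.z / (8 * d₀) with hD₁
  have hD₁pos : 0 < D₁ := by positivity
  set θ := D₁ / (4 * L) with hθ
  have hθpos : 0 < θ := by positivity
  have hev : ∀ᶠ m in 𝓝 q, (q.z / 2 < m.z ∧ ccn N m < 2 * d₀) ∧
      (N.nm m.pr < θ / 8 ∧ N.nm m.pr < ccn N m) := by
    refine ((continuous_z.continuousAt.eventually (lt_mem_nhds (by linarith))).and
      ((continuous_ccn N).continuousAt.eventually (gt_mem_nhds (by linarith)))).and
      (Filter.Eventually.and ?_ ?_)
    · refine Tendsto.eventually (f := fun m : Heis => N.nm m.pr)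
        (Continuous.tendsto (by fun_prop) q) (gt_mem_nhds ?_)
      rw [hv, N.nm_zero]
      positivity
    · refine ContinuousAt.eventually_lt (f := fun m : Heis => N.nm m.pr) (g := fun m => ccn N m)
        (Continuous.continuousAt (by fun_prop)) (Continuous.continuousAt (by fun_prop)) ?_
      rw [hv, N.nm_zero]
      exact hd
  obtain ⟨r, hr, hball⟩ := Metric.eventually_nhds_iff.1 hev
  refine ⟨θ / (4 * d₀), r, by positivity, hr, fun m hm hmv p ξ h => ?_⟩
  obtain ⟨⟨hmz, hmd⟩, hmθ, hlt⟩ := hball hm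
  have hρ := N.nm_pos hmv
  have hz' : 0 < m.z := by linarith
  obtain ⟨g, D, hg, hD, hDz, hDa⟩ := exists_isBetween_depth hLE hmv hz' hlt
  have h1 := h.dot_add_depth_le hg hmv hD
  have h2 := h.euler
  have h3 := h.dot_le m.pr
  set ρ := N.nm m.pr with hρdef
  set d := ccn N m with hddef
  have hdpos : 0 < d := hρ.trans hlt
  have hDD : D₁ ≤ D := by
    refine le_trans ?_ hDz
    rw [hD₁, div_le_div_iff₀ (by positivity) (by positivity)]
    nlinarith
  have hDpos := hD₁pos.trans_le hDD
  have h4 : θ ≤ D / (4 * L) := by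
    rw [hθ]
    gcongr
  have h5 : 2 * m.z ≤ D * (d + ρ - θ) := hDa.trans (by gcongr)
  have hX : 0 < d + ρ - θ := by
    have : 0 < D * (d + ρ - θ) := by linarith
    exact (pos_iff_pos_of_mul_pos this).1 hDpos
  -- Euler's identity and the area estimate give `ξ * D ≥ (d - ρ) / (d + ρ - θ)`, which exceeds one
  -- by a definite amount as `ρ < θ / 8`. The first variation then bounds `dot p m.pr` by `(1 - ξ *
  -- D) * ρ`.
  have h6 : 1 + θ / (4 * d₀) ≤ ξ * D := by
    have e1 : (1 + θ / (4 * d₀)) * (d + ρ - θ) ≤ d - ρ := by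
      have : θ / (4 * d₀) * (d + ρ - θ) ≤ θ / 2 := by
        calc θ / (4 * d₀) * (d + ρ - θ) ≤ θ / (4 * d₀) * (2 * d₀) := by gcongr; linarith
          _ = θ / 2 := by field_simp; norm_num
      linarith
    have e2 : (d - ρ) * D ≤ ξ * D * (2 * m.z) := by
      have : d - ρ ≤ ξ * (2 * m.z) := by linarith
      calc (d - ρ) * D ≤ ξ * (2 * m.z) * D := by gcongr
        _ = ξ * D * (2 * m.z) := by ring
    have e3 : (1 + θ / (4 * d₀)) * (2 * m.z) ≤ ξ * D * (2 * m.z) := by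
      calc (1 + θ / (4 * d₀)) * (2 * m.z) ≤ (1 + θ / (4 * d₀)) * (D * (d + ρ - θ)) := by gcongr
        _ = (1 + θ / (4 * d₀)) * (d + ρ - θ) * D := by ring
        _ ≤ (d - ρ) * D := by gcongr
        _ ≤ _ := e2
    exact le_of_mul_le_mul_right e3 (by positivity)
  have h7 := mul_le_mul_of_nonneg_right h6 hρ.le
  linarith

end noncritical

/-! ### Descent of the CC norm in horizontal directions -/

section descent

/-- The reflection of the norm in the horizontal axis. -/
noncomputable def RationalPolygonalNorm.reflect (N : RationalPolygonalNorm) :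
    RationalPolygonalNorm where
  toSeminorm := N.toSeminorm.comp (LinearMap.prodMap LinearMap.id (-LinearMap.id))
  eq_zero_of_map_eq_zero v hv := by
    have h := N.eq_zero_of_map_eq_zero _ hv
    simp only [LinearMap.prodMap_apply, LinearMap.id_apply, LinearMap.neg_apply,
      Prod.mk_eq_zero, neg_eq_zero] at h
    exact Prod.ext h.1 h.2
  exists_vertices := by
    obtain ⟨V, hV, hr, hball⟩ := N.exists_vertices
    set f : ℝ × ℝ →ₗ[ℝ] ℝ × ℝ := LinearMap.prodMap LinearMap.id (-LinearMap.id) with hf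
    have hff : ∀ v, f (f v) = v := fun v => by simp [hf]
    refine ⟨f '' V, hV.image _, ?_, ?_⟩
    · rintro _ ⟨v, hv, rfl⟩
      obtain ⟨a, b, rfl⟩ := hr v hv
      exact ⟨a, -b, by simp [hf]⟩
    · rw [← f.image_convexHull, ← hball]
      ext v
      simp only [mem_ofPred_eq, mem_image, Seminorm.comp_apply]
      constructor
      · exact fun h => ⟨f v, h, hff v⟩
      · rintro ⟨u, hu, rfl⟩
        rwa [hff]

variable {N : RationalPolygonalNorm}

theorem RationalPolygonalNorm.reflect_nm (v : ℝ × ℝ) : N.reflect.nm v = N.nm (v.1, -v.2) := rfl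

theorem ccn_reflect (q : Heis) : ccn N.reflect (diag 1 (-1) q) = ccn N q := by
  have h1 : ∀ u : ℝ × ℝ, N.reflect.nm (1 * u.1, -1 * u.2) ≤ 1 * N.nm u := fun u => by
    rw [RationalPolygonalNorm.reflect_nm]
    simp
  have h2 : ∀ u : ℝ × ℝ, N.nm (1 * u.1, -1 * u.2) ≤ 1 * N.reflect.nm u := fun u => by
    rw [RationalPolygonalNorm.reflect_nm]
    simp
  refine le_antisymm ((ccn_diag_le zero_le_one h1 q).trans_eq (one_mul _)) ?_
  have h := ccn_diag_le zero_le_one h2 (diag 1 (-1) q)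
  have h3 : diag 1 (-1) (diag 1 (-1) q) = q := Heis.ext (by simp) (by simp) (by simp)
  rwa [one_mul, h3] at h

theorem dist_diag_reflect (p q : Heis) : dist (diag 1 (-1) p) (diag 1 (-1) q) = dist p q := by
  change dist (diag 1 (-1) p).coords (diag 1 (-1) q).coords = dist p.coords q.coords
  simp only [coords, Prod.dist_eq, diag, one_mul, neg_mul, dist_neg_neg]

variable (N)

/-- Near `q` the CC norm decreases in a common horizontal direction. -/
def HasDescent (q : Heis) : Prop := ∃ (w : ℝ × ℝ) (c r : ℝ), N.nm w ≤ 1 ∧ 0 < c ∧ 0 < r ∧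
  ∀ m, dist m q < r → ∀ s ∈ Icc 0 r, ccn N (m * hexp (s • w)) ≤ ccn N m - c * s

/-- Near the point `q` of the vertical axis the CC norm decreases in radial directions. -/
def HasRadialDescent (q : Heis) : Prop := ∃ c r : ℝ, 0 < c ∧ 0 < r ∧
  ∀ m, dist m q < r → ∀ e, N.nm e = 1 → N.nm (m.pr - N.nm m.pr • e) ≤ c * N.nm m.pr →
    ∀ s ∈ Icc 0 r, ccn N (m * hexp (s • e)) ≤ ccn N m - c * s

variable {N}

theorem exists_nhds_mul_hexp (q : Heis) {r : ℝ} (hr : 0 < r) : ∃ δ, 0 < δ ∧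
    ∀ m, dist m q < δ → ∀ w : ℝ × ℝ, ‖w‖ < δ → dist (m * hexp w) q < r := by
  have hcont : Continuous fun x : Heis × (ℝ × ℝ) => x.1 * hexp x.2 := by fun_prop
  obtain ⟨δ, hδ, h⟩ := Metric.continuous_iff.1 hcont (q, 0) r hr
  refine ⟨δ, hδ, fun m hm w hw => ?_⟩
  have h1 := h (m, w) (by
    rw [Prod.dist_eq]
    exact max_lt hm (by simpa [dist_zero_right] using hw))
  have h2 : q * hexp (0 : ℝ × ℝ) = q := by ext <;> simp
  simpa [h2] using h1

/-- The direction of descent is `-w`, rescaled to norm at most one; the mean value inequality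
integrates the bound. -/
theorem hasDescent_of_subgrad {q : Heis} (h : ∃ (w : ℝ × ℝ) (c r : ℝ), 0 < c ∧ 0 < r ∧
    ∀ m, dist m q < r → ∀ p ξ, IsSubgrad N m p ξ → c ≤ dot p w) : HasDescent N q := by
  obtain ⟨w, c, r, hc, hr, h⟩ := h
  have hw : 0 < 1 + N.nm w := by linarith [N.nm_nonneg w]
  set w' := -((1 + N.nm w)⁻¹ • w) with hw'
  obtain ⟨δ, hδ, hnear⟩ := exists_nhds_mul_hexp q (show 0 < r / 2 by positivity)
  have hn : 0 ≤ ‖w'‖ := norm_nonneg _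
  refine ⟨w', c / (1 + N.nm w), min δ (δ / (2 * (1 + ‖w'‖))), ?_, by positivity, by positivity,
    fun m hm S hS => ?_⟩
  · rw [hw', N.nm_neg, N.nm_smul_of_nonneg (by positivity), inv_mul_le_iff₀ hw]
    linarith
  refine ccn_mul_hexp_le_of_subgrad N hS.1 (show 0 < r / 2 by positivity)
    fun s hs k hk p ξ hp => ?_
  have h1 : dist (m * hexp (s • w')) q < r / 2 := by
    refine hnear m (hm.trans_le (min_le_left _ _)) _ ?_
    rw [norm_smul, Real.norm_eq_abs, abs_of_nonneg hs.1]
    have h2 : s ≤ δ / (2 * (1 + ‖w'‖)) := (hs.2.trans hS.2).trans (min_le_right _ _)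
    rw [le_div_iff₀ (by positivity)] at h2
    have := hs.1
    nlinarith
  have h2 := h k (by linarith [dist_triangle k (m * hexp (s • w')) q]) p ξ hp
  rw [hw', dot_neg, dot_smul, div_eq_inv_mul]
  have h3 : (1 + N.nm w)⁻¹ * c ≤ (1 + N.nm w)⁻¹ * dot p w := by gcongr
  linarith

theorem hasDescent_of_nonneg {q : Heis} (hv : q.pr ≠ 0) (hz : 0 ≤ q.z) : HasDescent N q := by
  refine hasDescent_of_subgrad ?_
  rcases hz.eq_or_lt with h | h
  · exact exists_noncritical_nhds_of_z_eq_zero hv h.symm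
  · exact exists_noncritical_nhds hv h

theorem diag_hexp_reflect (w : ℝ × ℝ) : diag 1 (-1) (hexp w) = hexp (w.1, -w.2) := by
  ext <;> simp

/-- The reflection changes the sign of `z`, which reduces points below the plane to points above it,
for another norm. -/
theorem HasDescent.of_reflect {q : Heis} (h : HasDescent N.reflect (diag 1 (-1) q)) :
    HasDescent N q := by
  obtain ⟨w, c, r, hw, hc, hr, h⟩ := h
  refine ⟨(w.1, -w.2), c, r, hw, hc, hr, fun m hm s hs => ?_⟩
  have h1 := h (diag 1 (-1) m) (by rwa [dist_diag_reflect]) s hs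
  rw [ccn_reflect] at h1
  rw [← ccn_reflect (N := N), diag_mul, diag_hexp_reflect]
  convert h1 using 4
  ext <;> simp

theorem hasDescent {q : Heis} (hv : q.pr ≠ 0) : HasDescent N q := by
  rcases le_total 0 q.z with hz | hz
  · exact hasDescent_of_nonneg hv hz
  · refine HasDescent.of_reflect (hasDescent_of_nonneg (fun h => hv ?_) (by simpa using hz))
    have h1 := congrArg Prod.fst h
    have h2 := congrArg Prod.snd h
    simp at h1 h2
    exact Prod.ext h1 h2

variable (N) in
theorem exists_nm_pr_sub_le : ∃ K : ℝ, 0 < K ∧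
    ∀ p q : Heis, N.nm (p.pr - q.pr) ≤ K * dist p q := by
  have hN1 := N.nm_nonneg (1, 0)
  have hN2 := N.nm_nonneg (0, 1)
  refine ⟨N.nm (1, 0) + N.nm (0, 1) + 1, by positivity, fun p q => ?_⟩
  have h : p.pr - q.pr = (p.x - q.x) • ((1 : ℝ), (0 : ℝ)) + (p.y - q.y) • ((0 : ℝ), (1 : ℝ)) := by
    ext <;> simp
  rw [h]
  refine (N.nm_add _ _).trans ?_
  rw [N.nm_smul, N.nm_smul]
  have h1 := mul_le_mul_of_nonneg_right (abs_x_sub_le p q) hN1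
  have h2 := mul_le_mul_of_nonneg_right (abs_y_sub_le p q) hN2
  have h3 : 0 ≤ dist p q := dist_nonneg
  linarith

theorem hasRadialDescent_of_pos {q : Heis} (hv : q.pr = 0) (hz : 0 < q.z) :
    HasRadialDescent N q := by
  obtain ⟨c₀, r₀, hc₀, hr₀, h⟩ := exists_radial_subgrad_bound (N := N) hv hz
  obtain ⟨δ, hδ, hnear⟩ := exists_nhds_mul_hexp q (show 0 < r₀ / 2 by positivity)
  obtain ⟨R, hR, hRb, -⟩ := exists_coord_bound N
  obtain ⟨K, hK, hKb⟩ := exists_nm_pr_sub_le N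
  -- Chosen so that the rate survives the perturbation: `-4 * c * (1 - 2 * c) + 2 * c ≤ -c`.
  set c := min c₀ (1 / 2) / 4 with hc
  have hcpos : 0 < c := by positivity
  have hc1 : 4 * c ≤ c₀ := by
    rw [hc]
    linarith [min_le_left c₀ (1 / 2)]
  have hc2 : 8 * c ≤ 1 := by
    rw [hc]
    linarith [min_le_right c₀ (1 / 2)]
  set r := min δ (δ / (2 * R)) with hr
  have hrpos : 0 < r := by positivity
  have hoff : ∀ m, dist m q < r → m.pr ≠ 0 → ∀ e, N.nm e = 1 →
      N.nm (m.pr - N.nm m.pr • e) ≤ c * N.nm m.pr →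
        ∀ s ∈ Icc 0 r, ccn N (m * hexp (s • e)) ≤ ccn N m - c * s := by
    intro m hm hmv e he hme S hS
    have hρ := N.nm_pos hmv
    set ρ := N.nm m.pr with hρd
    refine ccn_mul_hexp_le_of_subgrad N hS.1
      (show 0 < min (r₀ / 2) (c * ρ / K) by positivity) fun s hs k hk p ξ hp => ?_
    have hs0 := hs.1
    have h1 : dist (m * hexp (s • e)) q < r₀ / 2 := by
      refine hnear m (hm.trans_le (min_le_left _ _)) _ ?_
      have h2 : s ≤ δ / (2 * R) := (hs.2.trans hS.2).trans (min_le_right _ _)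
      rw [le_div_iff₀ (by positivity)] at h2
      have h3 : ‖e‖ ≤ R := by
        rw [Prod.norm_def]
        have := hRb e
        rw [he, mul_one] at this
        exact max_le this.1 this.2
      rw [norm_smul, Real.norm_eq_abs, abs_of_nonneg hs0]
      have h4 : s * ‖e‖ ≤ s * R := by gcongr
      linarith
    have h2 : dist k q < r₀ := by
      linarith [dist_triangle k (m * hexp (s • e)) q, hk.trans (min_le_left _ _)]
    have h3 : N.nm (k.pr - (m * hexp (s • e)).pr) ≤ c * ρ := by
      refine (hKb _ _).trans ?_
      have := hk.trans (min_le_right _ _)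
      rw [le_div_iff₀ hK] at this
      linarith
    -- Points near the segment project close to the ray of `e`, so the radial bound holds for `e` up
    -- to a small relative error.
    have h4 : N.nm (k.pr - (ρ + s) • e) ≤ 2 * c * (ρ + s) := by
      have h5 : k.pr - (ρ + s) • e = (k.pr - (m * hexp (s • e)).pr) + (m.pr - ρ • e) := by
        rw [pr_mul, pr_hexp]
        module
      rw [h5]
      refine (N.nm_add _ _).trans ?_
      have : 0 ≤ c * s := by positivity
      linarith
    have h5 : (ρ + s) * (1 - 2 * c) ≤ N.nm k.pr := by
      have h6 := N.nm_add k.pr ((ρ + s) • e - k.pr)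
      rw [add_sub_cancel, N.nm_sub_rev, N.nm_smul_of_nonneg (by positivity), he] at h6
      linarith
    have hρs : 0 < ρ + s := by positivity
    have h6 : k.pr ≠ 0 := by
      intro h0
      rw [h0, N.nm_zero] at h5
      have : 0 < (ρ + s) * (1 - 2 * c) := mul_pos hρs (by linarith)
      linarith
    have h7 := h k h2 h6 p ξ hp
    have h8 := (abs_le.1 (dot_abs_le hp.dot_le (k.pr - (ρ + s) • e))).1
    rw [dot_sub, dot_smul] at h8
    have h9 : c₀ * ((ρ + s) * (1 - 2 * c)) ≤ c₀ * N.nm k.pr := by gcongr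
    have h10 : 4 * c * ((ρ + s) * (1 - 2 * c)) ≤ c₀ * ((ρ + s) * (1 - 2 * c)) := by
      refine mul_le_mul_of_nonneg_right hc1 (mul_nonneg hρs.le (by linarith))
    have h11 : (ρ + s) * dot p e ≤ (ρ + s) * (-4 * c * (1 - 2 * c) + 2 * c) := by linarith
    have h12 := le_of_mul_le_mul_left h11 hρs
    nlinarith
  refine ⟨c, r, hcpos, hrpos, fun m hm e he hme s hs => ?_⟩
  -- On the axis the radial vector vanishes; the inequality is the limit of those at `m * hexp (t •
  -- e)` as `t → 0`.
  by_cases hmv : m.pr = 0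
  · have hpr : ∀ t : ℝ, (m * hexp (t • e)).pr = t • e := fun t => by
      rw [pr_mul, pr_hexp, hmv, zero_add]
    have hlim : Tendsto (fun t : ℝ => m * hexp (t • e)) (𝓝[>] 0) (𝓝 m) := by
      have hc : Continuous fun t : ℝ => m * hexp (t • e) := by fun_prop
      have h1 := (hc.tendsto 0).mono_left (nhdsWithin_le_nhds (s := Ioi 0))
      have h2 : m * hexp ((0 : ℝ) • e) = m := by ext <;> simp
      rwa [h2] at h1
    have e1 : Tendsto (fun t : ℝ => ccn N (m * hexp (t • e) * hexp (s • e))) (𝓝[>] 0)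
        (𝓝 (ccn N (m * hexp (s • e)))) :=
      ((show Continuous fun k : Heis => ccn N (k * hexp (s • e)) by fun_prop).tendsto m).comp hlim
    have e2 : Tendsto (fun t : ℝ => ccn N (m * hexp (t • e)) - c * s) (𝓝[>] 0)
        (𝓝 (ccn N m - c * s)) :=
      ((show Continuous fun k : Heis => ccn N k - c * s by fun_prop).tendsto m).comp hlim
    refine le_of_tendsto_of_tendsto e1 e2 ?_
    filter_upwards [hlim.eventually (Metric.ball_mem_nhds m (show 0 < r - dist m q by linarith)),
      self_mem_nhdsWithin] with t ht ht0
    have ht0' : 0 < t := ht0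
    refine hoff _ ?_ ?_ e he ?_ s hs
    · have := dist_triangle (m * hexp (t • e)) m q
      have h2 : dist (m * hexp (t • e)) m < r - dist m q := ht
      linarith
    · rw [hpr]
      intro h0
      have := N.nm_smul_of_nonneg ht0'.le e
      rw [h0, N.nm_zero, he, mul_one] at this
      linarith
    · rw [hpr, N.nm_smul_of_nonneg ht0'.le, he, mul_one, sub_self, N.nm_zero]
      positivity
  · exact hoff m hm hmv e he hme s hs

theorem HasRadialDescent.of_reflect {q : Heis} (h : HasRadialDescent N.reflect (diag 1 (-1) q)) :
    HasRadialDescent N q := by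
  obtain ⟨c, r, hc, hr, h⟩ := h
  refine ⟨c, r, hc, hr, fun m hm e he hme s hs => ?_⟩
  have hnm : N.reflect.nm (diag 1 (-1) m).pr = N.nm m.pr := by
    rw [RationalPolygonalNorm.reflect_nm]
    congr 1
    ext <;> simp
  have h1 := h (diag 1 (-1) m) (by rwa [dist_diag_reflect]) (e.1, -e.2)
    (by rw [RationalPolygonalNorm.reflect_nm]; simpa using he) (by
      rw [hnm, RationalPolygonalNorm.reflect_nm]
      convert hme using 2
      ext <;> simp
      ring) s hs
  rw [ccn_reflect] at h1
  rw [← ccn_reflect (N := N), diag_mul, diag_hexp_reflect]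
  convert h1 using 4
  ext <;> simp

theorem hasRadialDescent {q : Heis} (hv : q.pr = 0) (hz : q.z ≠ 0) : HasRadialDescent N q := by
  rcases hz.lt_or_gt with hz | hz
  · refine HasRadialDescent.of_reflect (hasRadialDescent_of_pos ?_ (by simpa using hz))
    have h1 := congrArg Prod.fst hv
    have h2 := congrArg Prod.snd hv
    simp at h1 h2
    ext <;> simp [h1, h2]
  · exact hasRadialDescent_of_pos hv hz

end descent

/-! ### Joining close points inside the unit ball -/

section joining

variable (N : RationalPolygonalNorm)

/-- The points `x` and `y` are joined by an admissible curve of length at most `M` in the closed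
unit ball about the identity. -/
def JoinedInBall (x y : Heis) (M : ℝ) : Prop := ∃ c : AdmissibleCurve x y,
  (∀ t ∈ Icc 0 c.T, ccn N (c.γ t) ≤ 1) ∧ c.length N ≤ ENNReal.ofReal M

variable {N}

theorem JoinedInBall.mono {x y : Heis} {M M' : ℝ} (h : JoinedInBall N x y M) (hM : M ≤ M') :
    JoinedInBall N x y M' := by
  obtain ⟨c, hc, hl⟩ := h
  exact ⟨c, hc, hl.trans (ENNReal.ofReal_le_ofReal hM)⟩

theorem JoinedInBall.symm {x y : Heis} {M : ℝ} (h : JoinedInBall N x y M) :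
    JoinedInBall N y x M := by
  obtain ⟨c, hc, hl⟩ := h
  refine ⟨c.symm, fun t ht => hc _ ⟨?_, ?_⟩, (c.length_symm N).trans_le hl⟩
  · linarith [show t ≤ c.T from ht.2]
  · linarith [ht.1]

theorem JoinedInBall.trans {x y z : Heis} {M M' : ℝ} (h : JoinedInBall N x y M)
    (h' : JoinedInBall N y z M') (hM : 0 ≤ M) (hM' : 0 ≤ M') : JoinedInBall N x z (M + M') := by
  obtain ⟨c, hc, hl⟩ := h
  obtain ⟨d, hd, hl'⟩ := h'
  refine ⟨c.trans d, fun t ht => ?_, ?_⟩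
  · have ht2 : t ≤ c.T + d.T := ht.2
    change ccn N (if t ≤ c.T then c.γ t else d.γ (t - c.T)) ≤ 1
    split_ifs with h
    · exact hc t ⟨ht.1, h⟩
    · exact hd _ ⟨by linarith, by linarith⟩
  · rw [AdmissibleCurve.length_trans, ENNReal.ofReal_add hM hM']
    exact add_le_add hl hl'

theorem joinedInBall_mul_hexp {x : Heis} {w : ℝ × ℝ}
    (h : ∀ s ∈ Icc (0 : ℝ) 1, ccn N (x * hexp (s • w)) ≤ 1) :
    JoinedInBall N x (x * hexp w) (N.nm w) := by
  refine ⟨AdmissibleCurve.line x w, fun t ht => h t ht, ?_⟩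
  simp [AdmissibleCurve.length, AdmissibleCurve.line, RationalPolygonalNorm.nm]

theorem joinedInBall_mul_hexp_smul {x : Heis} {w : ℝ × ℝ} {S : ℝ} (hS : 0 ≤ S) (hw : N.nm w ≤ 1)
    (h : ∀ s ∈ Icc 0 S, ccn N (x * hexp (s • w)) ≤ 1) :
    JoinedInBall N x (x * hexp (S • w)) S := by
  refine (joinedInBall_mul_hexp fun s hs => ?_).mono ?_
  · rw [smul_smul]
    exact h _ ⟨mul_nonneg hs.1 hS, mul_le_of_le_one_left hS hs.2⟩
  · rw [N.nm_smul_of_nonneg hS]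
    exact mul_le_of_le_one_right hS hw

theorem joinedInBall_refl {x : Heis} (hx : ccn N x ≤ 1) : JoinedInBall N x x 0 := by
  have h0 : x * hexp 0 = x := by ext <;> simp
  have h := joinedInBall_mul_hexp (N := N) (x := x) (w := 0) fun s _ => by rwa [smul_zero, h0]
  rwa [h0, N.nm_zero] at h

/-- A curve of length below `L` stays among the points whose distances to `x` and `y` add up to at
most `L`. -/
theorem joinedInBall_of_lt {x y : Heis} {L : ℝ} (h : ccn N (x⁻¹ * y) < L)
    (hm : ∀ m, ccn N (x⁻¹ * m) + ccn N (m⁻¹ * y) ≤ L → ccn N m ≤ 1) : JoinedInBall N x y L := by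
  obtain ⟨c, hc⟩ := exists_curve_lt N h
  exact ⟨c, fun t ht => hm _ (ccn_add_ccn_le_of_length_le N c ((ccn_nonneg N _).trans h.le) hc.le ht),
    hc.le⟩

theorem ccn_le_add (x m : Heis) : ccn N m ≤ ccn N x + ccn N (x⁻¹ * m) := by
  simpa using ccn_mul_le N x (x⁻¹ * m)

variable (N)

/-- Moving two points along the same `w` conjugates their difference `h`, which multiplies it by a
central element of size `|wedge h.pr w|`; the CC norm of that is a square root. -/
theorem exists_conj_bound : ∃ A : ℝ, 0 < A ∧ ∀ h w,
    ccn N ((hexp w)⁻¹ * h * hexp w) ≤ ccn N h + A * √(ccn N h * N.nm w) := by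
  obtain ⟨L, hL, hLb⟩ := exists_wedge_bound N
  have hκ := ccn_nonneg N (vert 1)
  have hsL := Real.sqrt_nonneg L
  refine ⟨√L * ccn N (vert 1) + 1, by positivity, fun h w => ?_⟩
  have h1 : (hexp w)⁻¹ * h * hexp w = h * vert (wedge h.pr w) := by
    refine Heis.ext (by simp) (by simp) ?_
    simp [wedge]
    ring
  rw [h1]
  refine (ccn_mul_le N _ _).trans ?_
  rw [ccn_vert]
  have h2 : √|wedge h.pr w| ≤ √L * √(ccn N h * N.nm w) := by
    rw [← Real.sqrt_mul hL.le]
    refine Real.sqrt_le_sqrt ((hLb _ _).trans ?_)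
    have := mul_le_mul_of_nonneg_right (nm_pr_le_ccn N h) (N.nm_nonneg w)
    gcongr
  have h3 := mul_le_mul_of_nonneg_right h2 hκ
  have h4 := Real.sqrt_nonneg (ccn N h * N.nm w)
  linarith

/-- Two close points of the ball from which the CC norm decreases in a common direction are
joined by a short curve. -/
theorem exists_joinedInBall_of_common_descent {c : ℝ} (hc : 0 < c) : ∃ C M : ℝ, 0 < C ∧ 0 ≤ M ∧
    ∀ (x y : Heis) (w : ℝ × ℝ), 0 < ccn N (x⁻¹ * y) → ccn N x ≤ 1 → ccn N y ≤ 1 → N.nm w ≤ 1 →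
    (∀ s ∈ Icc 0 (C * ccn N (x⁻¹ * y)), ccn N (x * hexp (s • w)) ≤ ccn N x - c * s) →
    (∀ s ∈ Icc 0 (C * ccn N (x⁻¹ * y)), ccn N (y * hexp (s • w)) ≤ ccn N y - c * s) →
    JoinedInBall N x y (M * ccn N (x⁻¹ * y)) := by
  obtain ⟨A, hA, hAb⟩ := exists_conj_bound N
  -- After a push by `s = S ^ 2 * ε` the points are at distance at most `ε + A * S * ε`. As `c * S >
  -- 1 + A`, this is below the depth `c * s` that both have gained.
  set S := (1 + A) / c + 1 with hS
  have hS1 : 1 ≤ S := by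
    have : 0 ≤ (1 + A) / c := by positivity
    linarith
  have hcS : c * S = 1 + A + c := by
    rw [hS]
    field_simp
  refine ⟨S ^ 2, S ^ 2 * (2 + c), by positivity, by positivity,
    fun x y w hε hx hy hw hdx hdy => ?_⟩
  set ε := ccn N (x⁻¹ * y)
  set s := S ^ 2 * ε with hs
  have hs0 : 0 < s := by positivity
  have hline : ∀ x, ccn N x ≤ 1 → (∀ t ∈ Icc 0 s, ccn N (x * hexp (t • w)) ≤ ccn N x - c * t) →
      JoinedInBall N x (x * hexp (s • w)) s := fun x hx h =>
    joinedInBall_mul_hexp_smul hs0.le hw fun t ht => by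
      have h1 := h t ht
      have : 0 ≤ c * t := mul_nonneg hc.le ht.1
      linarith
  have hmid : JoinedInBall N (x * hexp (s • w)) (y * hexp (s • w)) (c * s) := by
    refine joinedInBall_of_lt ?_ fun m hm => ?_
    · have h1 : (x * hexp (s • w))⁻¹ * (y * hexp (s • w)) =
          (hexp (s • w))⁻¹ * (x⁻¹ * y) * hexp (s • w) := by group
      rw [h1]
      refine (hAb _ _).trans_lt ?_
      have h2 : √(ε * N.nm (s • w)) ≤ S * ε := by
        refine Real.sqrt_le_iff.2 ⟨by positivity, ?_⟩
        have h3 : N.nm (s • w) ≤ s := by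
          rw [N.nm_smul_of_nonneg hs0.le]
          exact mul_le_of_le_one_right hs0.le hw
        calc ε * N.nm (s • w) ≤ ε * s := by gcongr
          _ = (S * ε) ^ 2 := by rw [hs]; ring
      have h4 : A * √(ε * N.nm (s • w)) ≤ A * (S * ε) := by gcongr
      have h5 : c * s = (1 + A + c) * S * ε := by rw [hs, ← hcS]; ring
      have h6 : ε ≤ S * ε := le_mul_of_one_le_left hε.le hS1
      have h7 : 0 < c * (S * ε) := by positivity
      change ε + _ < _
      nlinarith
    · have h1 := ccn_le_add (N := N) (x * hexp (s • w)) m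
      have h2 := hdx s ⟨hs0.le, le_rfl⟩
      have h3 := ccn_nonneg N (m⁻¹ * (y * hexp (s • w)))
      linarith
  refine (((hline x hx hdx).trans hmid hs0.le (by positivity)).trans (hline y hy hdy).symm
    (by positivity) hs0.le).mono (le_of_eq ?_)
  rw [hs]
  ring

/-- Close points of the unit ball near `q` are joined by short curves. -/
def LocallyJoined (q : Heis) : Prop := ∃ r M ε₀ : ℝ, 0 < r ∧ 0 < ε₀ ∧
  ∀ x y, dist x q < r → dist y q < r → ccn N x ≤ 1 → ccn N y ≤ 1 → 0 < ccn N (x⁻¹ * y) →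
    ccn N (x⁻¹ * y) ≤ ε₀ → JoinedInBall N x y (M * ccn N (x⁻¹ * y))

variable {N}

theorem HasDescent.locallyJoined {q : Heis} (h : HasDescent N q) : LocallyJoined N q := by
  obtain ⟨w, c, r, hw, hc, hr, h⟩ := h
  obtain ⟨C, M, hC, -, hT⟩ := exists_joinedInBall_of_common_descent N hc
  refine ⟨r, M, r / C, hr, by positivity, fun x y hx hy hx1 hy1 hε hε0 => ?_⟩
  rw [le_div_iff₀' hC] at hε0
  exact hT x y w hε hx1 hy1 hw (fun s hs => h x hx s ⟨hs.1, hs.2.trans hε0⟩)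
    fun s hs => h y hy s ⟨hs.1, hs.2.trans hε0⟩

theorem exists_unit_smul_eq (v : ℝ × ℝ) : ∃ e, N.nm e = 1 ∧ N.nm v • e = v := by
  have key : ∀ v : ℝ × ℝ, v ≠ 0 → N.nm ((N.nm v)⁻¹ • v) = 1 := fun v hv => by
    have := N.nm_pos hv
    rw [N.nm_smul_of_nonneg (by positivity), inv_mul_cancel₀ this.ne']
  by_cases hv : v = 0
  · exact ⟨_, key (1, 0) (by simp), by simp [hv, N.nm_zero]⟩
  · exact ⟨_, key v hv, by rw [smul_smul, mul_inv_cancel₀ (N.nm_pos hv).ne', one_smul]⟩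

theorem exists_unit_dot_nonneg (a b : ℝ × ℝ) (ha : a ≠ 0) :
    ∃ f, N.nm f = 1 ∧ dot a f = 0 ∧ 0 ≤ dot b f := by
  have hJ : ((-a.2, a.1) : ℝ × ℝ) ≠ 0 := fun h => ha (by
    simp only [Prod.mk_eq_zero, neg_eq_zero] at h
    exact Prod.ext h.2 h.1)
  obtain ⟨e, he, hve⟩ := exists_unit_smul_eq (N := N) (-a.2, a.1)
  have h0 : dot a e = 0 := by
    have h1 : N.nm (-a.2, a.1) * dot a e = 0 := by
      rw [← dot_smul, hve]
      simp only [dot]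
      ring
    exact (mul_eq_zero.1 h1).resolve_left (N.nm_pos hJ).ne'
  rcases le_total 0 (dot b e) with h | h
  · exact ⟨e, he, h0, h⟩
  · exact ⟨-e, by rwa [N.nm_neg], by rw [dot_neg, h0, neg_zero], by rw [dot_neg]; linarith⟩

-- Adding a vector at a non-obtuse angle does not decrease Euclidean length, to which the norm is
-- comparable.
variable (N) in
theorem exists_nm_add_ge : ∃ k : ℝ, 0 < k ∧ ∀ u w : ℝ × ℝ, 0 ≤ dot u w →
    k * N.nm u ≤ N.nm (u + w) := by
  obtain ⟨R, hR, hRb, -⟩ := exists_coord_bound N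
  obtain ⟨K, hK, hKb⟩ := exists_nm_pr_sub_le N
  refine ⟨1 / (2 * R * K), by positivity, fun u w huw => ?_⟩
  have h1 : N.nm u ≤ K * √(dot u u) := by
    have h2 := hKb (hexp u) 1
    rw [pr_hexp, pr_one, sub_zero] at h2
    refine h2.trans (mul_le_mul_of_nonneg_left (dist_le_iff.2 ?_) hK.le)
    refine ⟨Real.abs_le_sqrt ?_, Real.abs_le_sqrt ?_, ?_⟩
    · simp only [dot, hexp_x, one_x]
      nlinarith [sq_nonneg u.2]
    · simp only [dot, hexp_y, one_y]
      nlinarith [sq_nonneg u.1]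
    · simp
  have h3 : √(dot u u) ≤ 2 * R * N.nm (u + w) := by
    have hn := N.nm_nonneg (u + w)
    refine Real.sqrt_le_iff.2 ⟨by positivity, ?_⟩
    have h4 : dot u u ≤ (u + w).1 ^ 2 + (u + w).2 ^ 2 := by
      simp only [dot, Prod.fst_add, Prod.snd_add] at huw ⊢
      nlinarith [sq_nonneg w.1, sq_nonneg w.2]
    have h5 := sq_le_sq' (abs_le.1 (hRb (u + w)).1).1 (abs_le.1 (hRb (u + w)).1).2
    have h6 := sq_le_sq' (abs_le.1 (hRb (u + w)).2).1 (abs_le.1 (hRb (u + w)).2).2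
    nlinarith [sq_nonneg (R * N.nm (u + w))]
  have h7 : K * √(dot u u) ≤ K * (2 * R * N.nm (u + w)) := by gcongr
  rw [one_div, inv_mul_le_iff₀ (by positivity)]
  linarith

theorem sqrt_le_add_div {a b : ℝ} (hb : 0 < b) : √a ≤ √b + |a - b| / √b := by
  have hs := Real.sqrt_pos.2 hb
  refine Real.sqrt_le_iff.2 ⟨by positivity, ?_⟩
  have h1 : √b * (|a - b| / √b) = |a - b| := by field_simp
  nlinarith [Real.sq_sqrt hb.le, sq_nonneg (|a - b| / √b), le_abs_self (a - b), abs_nonneg (a - b)]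

/-- Near the vertical axis, points sufficiently far from the axis lie in the unit ball. -/
theorem exists_ccn_le_one_of_le_nm_pr {q : Heis} (hz : q.z ≠ 0) (hv : q.pr = 0) {c r : ℝ}
    (hr : 0 < r) (h : ∀ m, dist m q < r → ∀ e, N.nm e = 1 →
      N.nm (m.pr - N.nm m.pr • e) ≤ c * N.nm m.pr →
        ∀ s ∈ Icc 0 r, ccn N (m * hexp (s • e)) ≤ ccn N m - c * s) {K C : ℝ} (hK : 0 < K)
    (hC : 0 < C) : ∃ r₁ ε₁ : ℝ, 0 < r₁ ∧ 0 < ε₁ ∧ ∀ x, dist x q < r₁ → ∀ ε, 0 < ε → ε ≤ ε₁ →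
      ccn N x ≤ 1 → N.nm x.pr ≤ K * ε → ∀ g, ccn N g ≤ C * ε →
        2 * K * ε ≤ c * N.nm (x * g).pr → ccn N (x * g) ≤ 1 := by
  obtain ⟨L, E, hL, hE, hLb, hEb⟩ := exists_isAreaBound N
  -- `x * g` is reached by a horizontal segment from the axis point at its own height. That height
  -- differs from the one of `x` by at most `Q * ε ^ 2`, so the axis point has norm at most `1 + 2 *
  -- K * ε`, and radial descent along the segment makes up for the excess.
  set Q := (E * C ^ 2 + L * (K * C)) / 2 with hQ
  have hQ0 : 0 < Q := by positivity
  set b := |q.z| / 2 with hb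
  have hb0 : 0 < b := by
    have := abs_pos.2 hz
    positivity
  have hsb := Real.sqrt_pos.2 hb0
  set κ := ccn N (vert 1)
  have hκ : 0 ≤ κ := ccn_nonneg N _
  refine ⟨min b (r / 2), min (min 1 (r / (2 * Q))) (min (r / (K + C)) (K * √b / (κ * Q + 1))),
    by positivity, by positivity, fun x hx ε hε hε1 hx1 hxp g hg hm => ?_⟩
  have e1 : ε ≤ 1 := hε1.trans ((min_le_left _ _).trans (min_le_left _ _))
  have e2 : ε ≤ r / (2 * Q) := hε1.trans ((min_le_left _ _).trans (min_le_right _ _))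
  have e3 : ε ≤ r / (K + C) := hε1.trans ((min_le_right _ _).trans (min_le_left _ _))
  have e4 : ε ≤ K * √b / (κ * Q + 1) := hε1.trans ((min_le_right _ _).trans (min_le_right _ _))
  rw [le_div_iff₀ (by positivity)] at e2 e3 e4
  have hgp : N.nm g.pr ≤ C * ε := (nm_pr_le_ccn N g).trans hg
  have hzx : |x.z - q.z| < min b (r / 2) := (abs_z_sub_le x q).trans_lt hx
  have hxz : b ≤ |x.z| := by
    have h1 := hzx.trans_le (min_le_left _ _)
    have h2 := abs_sub_abs_le_abs_sub q.z x.z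
    rw [abs_sub_comm q.z x.z] at h2
    linarith
  have hdz : |(x * g).z - x.z| ≤ Q * ε ^ 2 := by
    have h1 : (x * g).z - x.z = g.z + wedge x.pr g.pr / 2 := by
      simp only [mul_z, wedge, pr_fst, pr_snd]
      ring
    have h2 : E * ccn N g ^ 2 ≤ E * (C * ε) ^ 2 := by
      have := ccn_nonneg N g
      gcongr
    have h3 : L * (N.nm x.pr * N.nm g.pr) ≤ L * ((K * ε) * (C * ε)) := by
      have := N.nm_nonneg g.pr
      gcongr
    have h4 := (abs_add_le g.z (wedge x.pr g.pr / 2))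
    rw [abs_div, abs_two] at h4
    rw [h1, hQ]
    have h5 := hEb g
    have h6 := hLb x.pr g.pr
    linarith
  have hεε : ε ^ 2 ≤ ε := by nlinarith
  have hax : ccn N (vert (x * g).z) ≤ 1 + 2 * K * ε := by
    have h0 : 0 < |x.z| := hb0.trans_le hxz
    have h1 := sqrt_le_add_div (a := |(x * g).z|) h0
    have h2 : |(|(x * g).z| - |x.z|)| / √|x.z| ≤ Q * ε ^ 2 / √b := by
      have := Real.sqrt_le_sqrt hxz
      gcongr
      exact (abs_abs_sub_abs_le_abs_sub _ _).trans hdz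
    have h3 : vert x.z = (hexp x.pr)⁻¹ * x := by
      rw [eq_inv_mul_iff_mul_eq, hexp_mul_vert]
    have h4 : ccn N (vert x.z) ≤ K * ε + 1 := by
      rw [h3]
      refine (ccn_mul_le N _ _).trans ?_
      rw [ccn_inv]
      exact add_le_add ((ccn_hexp_le N _).trans hxp) hx1
    rw [ccn_vert] at h4 ⊢
    have h5 : Q * ε ^ 2 / √b * κ ≤ K * ε := by
      rw [div_mul_eq_mul_div, div_le_iff₀ hsb]
      nlinarith
    have h6 : √|(x * g).z| * κ ≤ (√|x.z| + Q * ε ^ 2 / √b) * κ := by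
      gcongr
      linarith
    change √|x.z| * κ ≤ _ at h4
    change √|(x * g).z| * κ ≤ _
    linarith
  have hdist : dist (vert (x * g).z) q < r := by
    have hqx : q.x = 0 := congrArg Prod.fst hv
    have hqy : q.y = 0 := congrArg Prod.snd hv
    refine lt_of_le_of_lt (dist_le_iff.2 ⟨?_, ?_, le_rfl⟩) ?_
    · simp [hqx]
    · simp [hqy]
    · have h1 := abs_sub_le (x * g).z x.z q.z
      have h2 := hzx.trans_le (min_le_right _ _)
      have h3 : Q * ε ^ 2 ≤ Q * ε := by gcongr
      change |(x * g).z - q.z| < r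
      linarith
  obtain ⟨e, he, hve⟩ := exists_unit_smul_eq (N := N) (x * g).pr
  have hpr : (vert (x * g).z).pr = 0 := rfl
  have hρ : N.nm (x * g).pr ≤ r := by
    rw [pr_mul]
    linarith [N.nm_add x.pr g.pr]
  have hfin := h _ hdist e he (by rw [hpr, N.nm_zero, zero_smul, sub_zero, N.nm_zero, mul_zero]) _
    ⟨N.nm_nonneg (x * g).pr, hρ⟩
  have hcomm : vert (x * g).z * hexp (x * g).pr = x * g := by
    refine Heis.ext ?_ ?_ ?_ <;> simp
  rw [hve, hcomm] at hfin
  linarith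

end joining

/-! ### Points near the vertical axis, and compactness of the sphere -/

section axis

variable {N : RationalPolygonalNorm}

/-- If `x` is far from the axis compared with `ε`, its radial direction serves both points.
Otherwise the radial directions of `x` and `y` may be very different: each point moves outwards by
`s`, then both move by `T ^ 2 * s` along a common `f` making no obtuse angle with either direction.
This keeps them off the axis, in a region where there is room for a joining curve. -/
theorem HasRadialDescent.locallyJoined {q : Heis} (hv : q.pr = 0) (hz : q.z ≠ 0)
    (h : HasRadialDescent N q) : LocallyJoined N q := by
  obtain ⟨c, r, hc, hr, h⟩ := h
  obtain ⟨C, M, hC, hM, hT⟩ := exists_joinedInBall_of_common_descent N hc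
  obtain ⟨A, hA, hAb⟩ := exists_conj_bound N
  obtain ⟨k, hk, hkb⟩ := exists_nm_add_ge N
  -- `K` bounds the distance to the axis in units of `ε` in the near case, `C₁` makes the radial
  -- move long enough for `hfar`, and `T` makes the common move dominate the joining curve, of
  -- length at most `2 * J * s`.
  set K := (2 + c) / c + 1 with hK
  have hK0 : 0 < K := by positivity
  set T := 1 + (6 + 4 * A) / k with hTd
  have hT0 : 0 < T := by positivity
  set C₁ := 2 * K / (c * k) + 1 with hC₁
  have hC₁0 : 0 < C₁ := by positivity
  set J := 3 + 2 * A * T with hJ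
  have hJ0 : 0 < J := by positivity
  obtain ⟨r₁, ε₁, hr₁, hε₁, hfar⟩ := exists_ccn_le_one_of_le_nm_pr hz hv hr h hK0
    (show 0 < C₁ * (1 + T ^ 2 + 2 * J) by positivity)
  refine ⟨min r r₁, max M ((2 + 2 * T ^ 2 + 2 * J) * C₁), min ε₁ (min (r / C) (r / C₁)),
    by positivity, by positivity, fun x y hx hy hx1 hy1 hε hε0 => ?_⟩
  set ε := ccn N (x⁻¹ * y) with hεd
  have hεε₁ : ε ≤ ε₁ := hε0.trans (min_le_left _ _)
  have hεC : C * ε ≤ r := by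
    rw [← le_div_iff₀' hC]
    exact hε0.trans ((min_le_right _ _).trans (min_le_left _ _))
  have hεC₁ : C₁ * ε ≤ r := by
    rw [← le_div_iff₀' hC₁0]
    exact hε0.trans ((min_le_right _ _).trans (min_le_right _ _))
  have hxy : N.nm (y.pr - x.pr) ≤ ε := by
    have := nm_pr_le_ccn N (x⁻¹ * y)
    rwa [pr_mul, pr_inv, neg_add_eq_sub] at this
  have hxy1 : N.nm y.pr ≤ N.nm x.pr + ε := by
    have := N.nm_add x.pr (y.pr - x.pr)
    rw [add_sub_cancel] at this
    linarith
  have hxy2 : N.nm x.pr ≤ N.nm y.pr + ε := by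
    have := N.nm_add y.pr (x.pr - y.pr)
    rw [add_sub_cancel, N.nm_sub_rev] at this
    linarith
  obtain ⟨e, he, hxe⟩ := exists_unit_smul_eq (N := N) x.pr
  obtain ⟨e', he', hye⟩ := exists_unit_smul_eq (N := N) y.pr
  rcases le_total ((2 + c) * ε) (c * N.nm x.pr) with hfarx | hnear
  · refine (hT x y e hε hx1 hy1 he.le (fun s hs => ?_) fun s hs => ?_).mono
      (mul_le_mul_of_nonneg_right (le_max_left _ _) hε.le)
    · refine h x (hx.trans_le (min_le_left _ _)) e he ?_ s ⟨hs.1, hs.2.trans hεC⟩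
      rw [hxe, sub_self, N.nm_zero]
      exact mul_nonneg hc.le (N.nm_nonneg _)
    · refine h y (hy.trans_le (min_le_left _ _)) e he ?_ s ⟨hs.1, hs.2.trans hεC⟩
      have h1 : y.pr - N.nm y.pr • e = (y.pr - x.pr) + (N.nm x.pr - N.nm y.pr) • e := by
        rw [sub_smul, hxe]
        abel
      have h2 : |N.nm x.pr - N.nm y.pr| ≤ ε := abs_le.2 ⟨by linarith, by linarith⟩
      have h3 := N.nm_add (y.pr - x.pr) ((N.nm x.pr - N.nm y.pr) • e)
      rw [N.nm_smul, he, mul_one] at h3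
      rw [h1]
      have h4 : c * N.nm x.pr ≤ c * (N.nm y.pr + ε) := by gcongr
      linarith
  · have hxK : N.nm x.pr + ε ≤ K * ε := by
      have h1 : N.nm x.pr ≤ (2 + c) / c * ε := by
        rw [div_mul_eq_mul_div, le_div_iff₀ hc]
        linarith
      rw [hK]
      linarith
    obtain ⟨f, hf, hef, hef'⟩ := exists_unit_dot_nonneg (N := N) e e' (by
      rintro rfl
      rw [N.nm_zero] at he
      exact one_ne_zero he.symm)
    set s := C₁ * ε with hs
    have hs0 : 0 < s := by positivity
    have hsK : 2 * K * ε ≤ c * (k * s) := by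
      have h1 : c * (k * s) = 2 * K * ε + c * k * ε := by
        rw [hs, hC₁]
        field_simp
      rw [h1]
      have : 0 < c * k * ε := by positivity
      linarith
    -- The common move leads to distance at least `k * T ^ 2 * s` from the axis; a further
    -- displacement of `2 * J * s` still leaves `k * s`.
    have hTk : 2 * J + k ≤ k * T ^ 2 := by
      have h1 : k * T = k + (6 + 4 * A) := by
        rw [hTd]
        field_simp
      have h2 : 1 ≤ T := by
        rw [hTd]
        have : 0 < (6 + 4 * A) / k := by positivity
        linarith
      have h3 : k * T ^ 2 = (k + 6 + 4 * A) * T := by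
        rw [sq, ← mul_assoc, h1]
        ring
      rw [h3, hJ]
      nlinarith
    have hside : ∀ (x : Heis) (e : ℝ × ℝ), dist x q < min r r₁ → ccn N x ≤ 1 →
        N.nm x.pr ≤ K * ε → N.nm e = 1 → N.nm x.pr • e = x.pr → 0 ≤ dot e f →
        JoinedInBall N x (x * hexp (s • e) * hexp ((T ^ 2 * s) • f)) (s + T ^ 2 * s) ∧
        ∀ g, ccn N g ≤ 2 * J * s →
          ccn N (x * hexp (s • e) * hexp ((T ^ 2 * s) • f) * g) ≤ 1 := by
      intro x e hx hx1 hxp he hxe hef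
      have hρ := N.nm_nonneg x.pr
      have hdot : ∀ t : ℝ, 0 ≤ t → 0 ≤ dot ((N.nm x.pr + s) • e) (t • f) := fun t ht => by
        have h1 : dot ((N.nm x.pr + s) • e) (t • f) = (N.nm x.pr + s) * t * dot e f := by
          simp [dot]
          ring
        rw [h1]
        positivity
      have hpr : ∀ t : ℝ, (hexp (s • e) * hexp (t • f)).pr + x.pr = (N.nm x.pr + s) • e + t • f :=
        fun t => by
          rw [pr_mul, pr_hexp, pr_hexp, add_smul, hxe]
          abel
      have hgs : ∀ t : ℝ, 0 ≤ t → ccn N (hexp (s • e) * hexp (t • f)) ≤ s + t := fun t ht => by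
        refine (ccn_mul_le N _ _).trans (add_le_add ?_ ?_)
        · refine (ccn_hexp_le N _).trans_eq ?_
          rw [N.nm_smul_of_nonneg hs0.le, he, mul_one]
        · refine (ccn_hexp_le N _).trans_eq ?_
          rw [N.nm_smul_of_nonneg ht, hf, mul_one]
      refine ⟨(joinedInBall_mul_hexp_smul hs0.le he.le fun t ht => ?_).trans
        (joinedInBall_mul_hexp_smul (by positivity) hf.le fun t ht => ?_) hs0.le (by positivity),
        fun g hg => ?_⟩
      · have h1 := h x (hx.trans_le (min_le_left _ _)) e he (by
          rw [hxe, sub_self, N.nm_zero]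
          positivity) t ⟨ht.1, ht.2.trans hεC₁⟩
        have : 0 ≤ c * t := mul_nonneg hc.le ht.1
        linarith
      · rw [mul_assoc]
        refine hfar x (hx.trans_le (min_le_right _ _)) ε hε hεε₁ hx1 hxp _
          ((hgs t ht.1).trans ?_) (hsK.trans ?_)
        · have h1 : 0 ≤ 2 * J * s := by positivity
          have h2 := ht.2
          rw [show C₁ * (1 + T ^ 2 + 2 * J) * ε = s + T ^ 2 * s + 2 * J * s by rw [hs]; ring]
          linarith
        · rw [pr_mul, add_comm, hpr]
          have h1 := hkb _ _ (hdot t ht.1)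
          rw [N.nm_smul_of_nonneg (by positivity), he, mul_one] at h1
          have h2 : k * s ≤ k * (N.nm x.pr + s) := by
            gcongr
            linarith
          have h3 := h2.trans h1
          gcongr
      · rw [mul_assoc x, mul_assoc x]
        have hTs : 0 ≤ T ^ 2 * s := by positivity
        refine hfar x (hx.trans_le (min_le_right _ _)) ε hε hεε₁ hx1 hxp _
          ((ccn_mul_le N _ _).trans ((add_le_add (hgs _ hTs) hg).trans_eq ?_)) (hsK.trans ?_)
        · rw [hs]
          ring
        · rw [pr_mul, pr_mul _ g, ← add_assoc, add_comm x.pr, hpr, add_comm (_ • e)]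
          have h1 := hkb ((T ^ 2 * s) • f) ((N.nm x.pr + s) • e) (by
            have := hdot _ hTs
            simp only [dot] at this ⊢
            linarith)
          rw [N.nm_smul_of_nonneg hTs, hf, mul_one] at h1
          have h2 := N.nm_add ((T ^ 2 * s) • f + (N.nm x.pr + s) • e + g.pr) (-g.pr)
          rw [add_neg_cancel_right, N.nm_neg] at h2
          have h3 := (nm_pr_le_ccn N g).trans hg
          have h4 := mul_le_mul_of_nonneg_right hTk hs0.le
          gcongr
          linarith
    obtain ⟨hjx, hmid⟩ := hside x e hx hx1 (by linarith) he hxe hef.ge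
    obtain ⟨hjy, -⟩ := hside y e' hy hy1 (by linarith) he' hye hef'
    have hJs : 0 < J * s := by positivity
    have hjm : JoinedInBall N (x * hexp (s • e) * hexp ((T ^ 2 * s) • f))
        (y * hexp (s • e') * hexp ((T ^ 2 * s) • f)) (2 * J * s) := by
      refine joinedInBall_of_lt ?_ fun m hm => ?_
      · have h1 : (x * hexp (s • e) * hexp ((T ^ 2 * s) • f))⁻¹ *
            (y * hexp (s • e') * hexp ((T ^ 2 * s) • f)) = (hexp ((T ^ 2 * s) • f))⁻¹ *
            ((hexp (s • e))⁻¹ * (x⁻¹ * y) * hexp (s • e')) * hexp ((T ^ 2 * s) • f) := by group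
        have h2 : ccn N ((hexp (s • e))⁻¹ * (x⁻¹ * y) * hexp (s • e')) ≤ 3 * s := by
          have h3 := ccn_mul_le N ((hexp (s • e))⁻¹ * (x⁻¹ * y)) (hexp (s • e'))
          have h4 := ccn_mul_le N (hexp (s • e))⁻¹ (x⁻¹ * y)
          have h5 := ccn_hexp_le N (s • e)
          have h6 := ccn_hexp_le N (s • e')
          rw [N.nm_smul_of_nonneg hs0.le, he, mul_one] at h5
          rw [N.nm_smul_of_nonneg hs0.le, he', mul_one] at h6
          rw [ccn_inv] at h4
          have h7 : ε ≤ s := by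
            rw [hs]
            refine le_mul_of_one_le_left hε.le ?_
            rw [hC₁]
            have : 0 < 2 * K / (c * k) := by positivity
            linarith
          linarith
        rw [h1]
        refine (hAb _ _).trans_lt ?_
        rw [N.nm_smul_of_nonneg (by positivity), hf, mul_one]
        -- The factor `√3` coming from the distance `3 * s` is rounded up to `2`.
        have h3 : √(ccn N ((hexp (s • e))⁻¹ * (x⁻¹ * y) * hexp (s • e')) * (T ^ 2 * s)) ≤
            2 * (T * s) := by
          refine Real.sqrt_le_iff.2 ⟨by positivity, ?_⟩
          have h4 : 0 ≤ T ^ 2 * s := by positivity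
          have h5 := mul_le_mul_of_nonneg_right h2 h4
          refine h5.trans ?_
          have h6 : 0 ≤ (T * s) ^ 2 := sq_nonneg _
          linear_combination h6
        have h4 := mul_le_mul_of_nonneg_left h3 hA.le
        have h5 : J * s = 3 * s + A * (2 * (T * s)) := by
          rw [hJ]
          ring
        linarith
      · have h1 := hmid ((x * hexp (s • e) * hexp ((T ^ 2 * s) • f))⁻¹ * m)
          (by linarith [ccn_nonneg N (m⁻¹ * (y * hexp (s • e') * hexp ((T ^ 2 * s) • f)))])
        rwa [mul_inv_cancel_left] at h1
    refine (((hjx.trans hjm (by positivity) (by positivity)).trans hjy.symm (by positivity)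
      (by positivity)).mono (le_of_eq ?_)).mono
      (mul_le_mul_of_nonneg_right (le_max_right M ((2 + 2 * T ^ 2 + 2 * J) * C₁)) hε.le)
    rw [hs]
    ring

theorem ne_zero_of_ccn_eq_one {q : Heis} (hq : ccn N q = 1) (hv : q.pr = 0) : q.z ≠ 0 := by
  intro hz
  have : q = 1 := Heis.ext (congrArg Prod.fst hv) (congrArg Prod.snd hv) hz
  rw [this, ccn_one] at hq
  exact zero_ne_one hq

theorem locallyJoined {q : Heis} (hq : ccn N q = 1) : LocallyJoined N q := by
  by_cases hv : q.pr = 0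
  · exact (hasRadialDescent hv (ne_zero_of_ccn_eq_one hq hv)).locallyJoined hv
      (ne_zero_of_ccn_eq_one hq hv)
  · exact (hasDescent hv).locallyJoined

theorem exists_descent_at {q : Heis} (hq : ccn N q = 1) : ∃ (w : ℝ × ℝ) (c r : ℝ), N.nm w ≤ 1 ∧
    0 < c ∧ 0 < r ∧ ∀ s ∈ Icc 0 r, ccn N (q * hexp (s • w)) ≤ ccn N q - c * s := by
  by_cases hv : q.pr = 0
  · obtain ⟨c, r, hc, hr, h⟩ := hasRadialDescent (N := N) hv (ne_zero_of_ccn_eq_one hq hv)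
    obtain ⟨e, he, hve⟩ := exists_unit_smul_eq (N := N) q.pr
    refine ⟨e, c, r, he.le, hc, hr, h q (by simpa using hr) e he ?_⟩
    rw [hve, hv, sub_self, N.nm_zero, mul_zero]
  · obtain ⟨w, c, r, hw, hc, hr, h⟩ := hasDescent (N := N) hv
    exact ⟨w, c, r, hw, hc, hr, h q (by simpa using hr)⟩

/-- An almost shortest curve from `q` might leave the ball; a short descent beforehand creates the
necessary slack. -/
theorem joinedInBall_one {q : Heis} (hq : ccn N q = 1) : JoinedInBall N q 1 2 := by
  obtain ⟨w, c, r, hw, hc, hr, h⟩ := exists_descent_at hq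
  have hs : 0 < min r 1 := by positivity
  have h1 := h _ ⟨hs.le, min_le_left _ _⟩
  have h2 : JoinedInBall N (q * hexp (min r 1 • w)) 1 1 := by
    refine joinedInBall_of_lt ?_ fun m hm => ?_
    · rw [mul_one, ccn_inv]
      have : 0 < c * min r 1 := by positivity
      linarith
    · rw [mul_one, ccn_inv] at hm
      linarith [ccn_nonneg N ((q * hexp (min r 1 • w))⁻¹ * m)]
  refine ((joinedInBall_mul_hexp_smul hs.le hw fun s hs => ?_).trans h2 hs.le zero_le_one).mono ?_
  · have h3 := h s ⟨hs.1, hs.2.trans (min_le_left _ _)⟩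
    have : 0 ≤ c * s := mul_nonneg hc.le hs.1
    linarith
  · linarith [min_le_right r 1]

variable (N) in
/-- Two points of the unit sphere are joined in the unit ball by a curve whose length is at most
a fixed multiple of their distance. -/
theorem exists_joinedInBall_sphere : ∃ M : ℝ, 0 ≤ M ∧ ∀ x y, ccn N x = 1 → ccn N y = 1 →
    JoinedInBall N x y (M * ccn N (x⁻¹ * y)) := by
  by_contra! hcon
  -- Counterexamples for the constants `n`. Paths through the identity have length `4`, so the
  -- distances are at most `4 / n`, and along a subsequence both points tend to one point of the
  -- sphere, where local joining applies.
  choose x y hx hy hxy using fun n : ℕ => hcon n n.cast_nonneg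
  have hε : ∀ n, n * ccn N ((x n)⁻¹ * y n) ≤ 4 := fun n => by
    by_contra! hn
    refine hxy n (((joinedInBall_one (hx n)).trans (joinedInBall_one (hy n)).symm (by norm_num)
      (by norm_num)).mono ?_)
    linarith
  have hK := isCompact_ccn_le N 1
  obtain ⟨⟨a, b⟩, -, φ, hφ, hlim⟩ := (hK.prod hK).tendsto_subseq (x := fun n => (x n, y n))
    fun n => ⟨(hx n).le, (hy n).le⟩
  rw [nhds_prod_eq] at hlim
  have ha : Tendsto (fun n => x (φ n)) atTop (𝓝 a) := tendsto_fst.comp hlim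
  have hb : Tendsto (fun n => y (φ n)) atTop (𝓝 b) := tendsto_snd.comp hlim
  have hε0 : Tendsto (fun n => ccn N ((x (φ n))⁻¹ * y (φ n))) atTop (𝓝 0) := by
    have h4 : Tendsto (fun n : ℕ => (4 : ℝ) / n) atTop (𝓝 0) :=
      tendsto_const_div_atTop_nhds_zero_nat 4
    refine squeeze_zero' (Eventually.of_forall fun n => ccn_nonneg N _) ?_
      (h4.comp hφ.tendsto_atTop)
    filter_upwards [hφ.tendsto_atTop.eventually_gt_atTop 0] with n hn
    rw [Function.comp_apply, le_div_iff₀' (by exact_mod_cast hn)]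
    exact hε _
  have hlim' : Tendsto (fun n => ccn N ((x (φ n))⁻¹ * y (φ n))) atTop (𝓝 (ccn N (a⁻¹ * b))) :=
    ((continuous_ccn N).tendsto _).comp (ha.inv.mul hb)
  have hab : b = a := by
    have h1 := ccn_eq_zero N (tendsto_nhds_unique hlim' hε0)
    exact (inv_mul_eq_one.1 h1).symm
  rw [hab] at hb
  have ha1 : ccn N a = 1 := by
    refine tendsto_nhds_unique (((continuous_ccn N).tendsto _).comp ha) ?_
    simp only [Function.comp_def, hx, tendsto_const_nhds]
  obtain ⟨r, M, ε₀, hr, hε₀, h⟩ := locallyJoined ha1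
  have hφM : Tendsto (fun n => (φ n : ℝ)) atTop atTop :=
    tendsto_natCast_atTop_atTop.comp hφ.tendsto_atTop
  obtain ⟨n, h1, h2, h3, h4⟩ := ((ha.eventually (Metric.ball_mem_nhds a hr)).and
    ((hb.eventually (Metric.ball_mem_nhds a hr)).and ((hε0.eventually_le_const hε₀).and
    (hφM.eventually_ge_atTop M)))).exists
  refine hxy (φ n) ?_
  have hn := ccn_nonneg N ((x (φ n))⁻¹ * y (φ n))
  rcases hn.eq_or_lt with h0 | h0
  · rw [← h0, mul_zero]
    have h5 : y (φ n) = x (φ n) := (inv_mul_eq_one.1 (ccn_eq_zero N h0.symm)).symm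
    rw [h5]
    exact joinedInBall_refl (hx _).le
  · exact (h _ _ h1 h2 (hx _).le (hy _).le h0 h3).mono (by gcongr)

end axis

/-! ### Spheres of arbitrary centre and radius; paths in the CC metric -/

section conclusion

variable {N : RationalPolygonalNorm}

theorem AdmissibleCurve.length_mapDiag_self {n : ℝ} (hn : 0 ≤ n) {p q : Heis}
    (c : AdmissibleCurve p q) : (c.mapDiag n n).length N = ENNReal.ofReal n * c.length N := by
  unfold AdmissibleCurve.length
  rw [← lintegral_const_mul' _ _ ENNReal.ofReal_ne_top]
  refine lintegral_congr fun t => ?_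
  rw [← ENNReal.ofReal_mul hn]
  exact congrArg ENNReal.ofReal (N.nm_smul_of_nonneg hn (c.vel t))

theorem JoinedInBall.exists_curve {x y : Heis} {M : ℝ} (h : JoinedInBall N x y M) (x₀ : Heis)
    {n : ℝ} (hn : 0 ≤ n) : ∃ c : AdmissibleCurve (x₀ * dil n x) (x₀ * dil n y),
      (∀ t ∈ Icc 0 c.T, ccn N (x₀⁻¹ * c.γ t) ≤ n) ∧ c.length N ≤ ENNReal.ofReal (n * M) := by
  obtain ⟨c, hc, hl⟩ := h
  refine ⟨(c.mapDiag n n).translate x₀, fun t ht => ?_, ?_⟩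
  · change ccn N (x₀⁻¹ * (x₀ * dil n (c.γ t))) ≤ n
    rw [inv_mul_cancel_left, ccn_dil N hn]
    exact mul_le_of_le_one_right hn (hc t ht)
  · refine (c.length_mapDiag_self hn).trans_le ?_
    rw [ENNReal.ofReal_mul hn]
    gcongr

-- Dilations scale lengths and distances alike, so the linear bound on the unit sphere holds with
-- the same constant for every radius.
variable (N) in
theorem exists_curve_in_closedBall : ∃ M : ℝ, 0 ≤ M ∧ ∀ (x₀ : Heis) (n : ℝ) (x y : Heis),
    ccn N (x₀⁻¹ * x) = n → ccn N (x₀⁻¹ * y) = n → ∃ c : AdmissibleCurve x y,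
      (∀ t ∈ Icc 0 c.T, ccn N (x₀⁻¹ * c.γ t) ≤ n) ∧
        c.length N ≤ ENNReal.ofReal (M * ccn N (x⁻¹ * y)) := by
  obtain ⟨M, hM, h⟩ := exists_joinedInBall_sphere N
  refine ⟨M, hM, fun x₀ n x y hx hy => ?_⟩
  have hn : 0 ≤ n := hx ▸ ccn_nonneg N _
  obtain ⟨x', y', hxy, rfl, rfl⟩ : ∃ x' y', JoinedInBall N x' y' (M * ccn N (x'⁻¹ * y')) ∧
      x = x₀ * dil n x' ∧ y = x₀ * dil n y' := by
    rcases hn.eq_or_lt with rfl | hn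
    -- A sphere of radius zero is its centre, the image of the identity under the dilation by zero.
    · have hone : ∀ x, ccn N (x₀⁻¹ * x) = 0 → x = x₀ * dil 0 1 := fun x hx => by
        rw [dil, diag_one, mul_one]
        exact (inv_mul_eq_one.1 (ccn_eq_zero N hx)).symm
      refine ⟨1, 1, ?_, hone x hx, hone y hy⟩
      rw [inv_one, one_mul, ccn_one, mul_zero]
      exact joinedInBall_refl (by simp [ccn_one])
    · have hdil : ∀ x, x = x₀ * dil n (dil n⁻¹ (x₀⁻¹ * x)) := fun x => by
        rw [dil_dil, mul_inv_cancel₀ hn.ne', dil_one_left, mul_inv_cancel_left]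
      have hunit : ∀ x, ccn N (x₀⁻¹ * x) = n → ccn N (dil n⁻¹ (x₀⁻¹ * x)) = 1 := fun x hx => by
        rw [ccn_dil N (by positivity), hx, inv_mul_cancel₀ hn.ne']
      exact ⟨_, _, h _ _ (hunit x hx) (hunit y hy), hdil x, hdil y⟩
  obtain ⟨c, hc, hl⟩ := hxy.exists_curve x₀ hn
  refine ⟨c, hc, hl.trans_eq ?_⟩
  have h1 : (x₀ * dil n x')⁻¹ * (x₀ * dil n y') = dil n (x'⁻¹ * y') := by
    rw [dil_mul, dil_inv]
    group
  rw [h1, ccn_dil N hn]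
  ring_nf

variable (N) in
/-- The identity from the Heisenberg group to its CC metric space. -/
def toCCHeis (p : Heis) : CCHeis N := p

theorem dist_toCCHeis (p q : Heis) : dist (toCCHeis N p) (toCCHeis N q) = ccn N (p⁻¹ * q) := by
  have h : edist (toCCHeis N p) (toCCHeis N q) = ENNReal.ofReal (ccn N (p⁻¹ * q)) :=
    ccEDist_eq N p q
  rw [edist_dist] at h
  exact (ENNReal.ofReal_eq_ofReal_iff dist_nonneg (ccn_nonneg N _)).1 h

theorem continuous_toCCHeis : Continuous (toCCHeis N) := by
  rw [continuous_iff_continuousAt]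
  intro p
  refine tendsto_iff_dist_tendsto_zero.2 ?_
  simp only [dist_toCCHeis]
  have h : Continuous fun q : Heis => ccn N (q⁻¹ * p) := by fun_prop
  simpa [ccn_one] using h.tendsto p

namespace AdmissibleCurve

variable (N) in
/-- An admissible curve, as a path in the CC metric space. -/
noncomputable def toPath {p q : Heis} (c : AdmissibleCurve p q) :
    Path (toCCHeis N p) (toCCHeis N q) where
  toFun t := toCCHeis N (c.γ (c.T * t))
  continuous_toFun := by
    refine continuous_toCCHeis.comp (c.continuousOn_heis.comp_continuous (by fun_prop) fun t => ?_)
    exact ⟨mul_nonneg c.T_nonneg t.2.1, mul_le_of_le_one_right c.T_nonneg t.2.2⟩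
  source' := by simp [c.source]
  target' := by simp [c.target]

/-- Consecutive points of a partition are no further apart than the length of the arc between them,
and these arcs do not overlap. -/
theorem eVariationOn_toPath_le {p q : Heis} (c : AdmissibleCurve p q) :
    eVariationOn (c.toPath N) univ ≤ c.length N := by
  refine iSup_le fun ⟨n, u, hu, _⟩ => ?_
  have hmono : Monotone fun i => c.T * (u i : ℝ) := fun i j hij =>
    mul_le_mul_of_nonneg_left (hu hij) c.T_nonneg
  have h0 : ∀ i, 0 ≤ c.T * (u i : ℝ) := fun i => mul_nonneg c.T_nonneg (u i).2.1
  have h1 : ∀ i, c.T * (u i : ℝ) ≤ c.T := fun i => mul_le_of_le_one_right c.T_nonneg (u i).2.2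
  have hsum : ∀ n : ℕ, ∑ i ∈ Finset.range n, edist (c.toPath N (u (i + 1))) (c.toPath N (u i)) ≤
      ∫⁻ t in Ioc (c.T * (u 0 : ℝ)) (c.T * (u n : ℝ)),
        ENNReal.ofReal (N.toSeminorm (c.vel t)) := by
    intro n
    induction n with
    | zero => simp
    | succ n ih =>
      rw [Finset.sum_range_succ, ← Ioc_union_Ioc_eq_Ioc (hmono n.zero_le) (hmono n.le_succ),
        lintegral_union measurableSet_Ioc (Ioc_disjoint_Ioc_of_le le_rfl), edist_comm]
      exact add_le_add ih
        (c.ccEDist_le_setLIntegral (h0 n) (hmono n.le_succ) (h1 _) N)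
  exact (hsum n).trans (lintegral_mono_set (Ioc_subset_Ioc (h0 0) (h1 n)))

end AdmissibleCurve

end conclusion

theorem mainTheorem5 (N : RationalPolygonalNorm) : IsAlmostConvex (CCHeis N) := by
  obtain ⟨M, hM, h⟩ := exists_curve_in_closedBall N
  refine fun k => ⟨M * k, fun x₀ n x y hx hy hxy => ?_⟩
  rw [Metric.mem_sphere, dist_comm] at hx hy
  obtain ⟨c, hc, hl⟩ := h x₀ n x y ((dist_toCCHeis _ _).symm.trans hx)
    ((dist_toCCHeis _ _).symm.trans hy)
  refine ⟨c.toPath N, fun t => ?_, c.eVariationOn_toPath_le.trans (hl.trans ?_)⟩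
  · rw [Metric.mem_closedBall, dist_comm]
    refine (dist_toCCHeis _ _).trans_le (hc _ ⟨?_, ?_⟩)
    · exact mul_nonneg c.T_nonneg t.2.1
    · exact mul_le_of_le_one_right c.T_nonneg t.2.2
  · refine ENNReal.ofReal_le_ofReal (mul_le_mul_of_nonneg_left ?_ hM)
    exact (dist_toCCHeis (N := N) x y).symm.trans_le hxy
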